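/- Let $\mathfrak g_8$ be the real Lie algebra with a basis whose dual basis satisfies $de^1=e^{16}-e^{25}$, $de^2=e^{15}+e^{26}$, $de^3=-e^{36}+e^{45}$, $de^4=-e^{35}-e^{46}$, $de^5=de^6=0$, where $d\alpha(x,y)=-\alpha([x,y])$ and $e^{ij}=e^i\wedge e^j$. Let $G$ be the connected simply connected Lie group with Lie algebra $\mathfrak g_8$. A lattice in $G$ is a discrete subgroup $\Gamma$ such that $\Gamma\backslash G$ is compact. A complex structure $J$ on $\mathfrak g_8$ (with its induced left-invariant complex structure on $G$ and on $\Gamma\backslash G$) belongs to - Family (Siv2) if it has a basis $\varphi^1,\varphi^2,\varphi^3$ of $(1,0)$-forms with $d\varphi^1=2\sqrt{-1}\,\varphi^{13}+\varphi^{3\bar3}$, $d\varphi^2=-2\sqrt{-1}\,\varphi^{23}+x\,\varphi^{3\bar3}$, $d\varphi^3=0$ for some $x\in\{0,1\}$; - Family (Siv3), with parameter $A\in\mathbb C$, $|A|\neq1$, if it has a basis of $(1,0)$-forms with $d\varphi^1=A\,\varphi^{13}-\varphi^{1\bar3}$, $d\varphi^2=-A\,\varphi^{23}+\varphi^{2\bar3}$,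 $d\varphi^3=0$. A Hermitian metric, with $\omega=g(\cdot,J\cdot)$, is balanced if $d\omega^2=0$. It is Chern-flat if the curvature $R$ of its Chern connection vanishes, and Chern Kähler-like if $R(x,y)z+R(y,z)x+R(z,x)y=0$ and $R(x,y,z,w)=R(x,y,Jz,Jw)=R(Jx,Jy,z,w)$, where $R(x,y,z,w)=g(R(x,y)z,w)$. Let $\Delta\subset\mathbb C$ be the open unit disc. A family $(J_a)_{a\in\Delta}$ of complex structures on $\mathfrak g_8$ is holomorphic if it is smooth in $a$ and the almost complex structure $J_a\oplus\sqrt{-1}$ on $(\Gamma\backslash G)\times\Delta$ is integrable (a condition that does not depend on $\Gamma$). Then the following hold. 1. For every $A\in\mathbb C$ with $|A|\neq1$ there is a complex structure on $\mathfrak g_8$ in Family (Siv3) with parameter $A$. 2. Every complex structure on $\mathfrak g_8$ in Family (Siv3) admits an invariant Hermitian metric that is Chern-flat, hence Chern Kähler-like. 3. Every complex structure in Family (Siv3) with parameter $|A|>1$ is a member $J_a$, for some $a\ne0$, of a holomorphic family $(J_a)_{a\in\Delta}$ of complex structures on $\mathfrak g_8$ such that $J_a$ is in Family (Siv3) for all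 $a\neq0$ and $J_0$ is in Family (Siv2). 4. If $J$ is in Family (Siv2) and $\Gamma$ is a lattice in $G$, then the compact complex manifold $(\Gamma\backslash G,J)$ admits no balanced Hermitian metric, and no Chern Kähler-like Hermitian metric (invariant or not). 5. Consequently the Chern Kähler-like property is not closed under holomorphic deformations: there are a lattice $\Gamma$ in $G$ and a holomorphic family $(J_a)_{a\in\Delta}$ such that $(\Gamma\backslash G,J_a)$ admits a Chern Kähler-like Hermitian metric for every $a\neq0$, while $(\Gamma\backslash G,J_0)$ admits none. -/

import Mathlib

open scoped ContDiff

/-! ## The Lie algebra `𝔤₈ = (16-25, 15+26, -36+45, -35-46, 0, 0)` -/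

/-- The real Lie algebra `𝔤₈`, in the coordinates of its basis `e₁, …, e₆`
(the coordinate `X.co k` of a vector `X` is the value on it of the dual form `e^{k+1}`). -/
def g8 : Type := Fin 6 → ℝ

namespace g8

instance : NormedAddCommGroup g8 := inferInstanceAs (NormedAddCommGroup (Fin 6 → ℝ))

noncomputable instance : NormedSpace ℝ g8 := inferInstanceAs (NormedSpace ℝ (Fin 6 → ℝ))

instance : FiniteDimensional ℝ g8 := inferInstanceAs (FiniteDimensional ℝ (Fin 6 → ℝ))

/-- The coordinates of a vector. -/
def co (X : g8) : Fin 6 → ℝ := X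

/-- A vector from its six coordinates. -/
def mk (c : Fin 6 → ℝ) : g8 := c

/-- The wedge `e^{i+1} ∧ e^{j+1}` of two dual basis vectors. -/
def w (i j : Fin 6) (X Y : g8) : ℝ := X.co i * Y.co j - X.co j * Y.co i

/-- The bracket, determined by `de¹ = e¹⁶ - e²⁵`, `de² = e¹⁵ + e²⁶`, `de³ = -e³⁶ + e⁴⁵`,
`de⁴ = -e³⁵ - e⁴⁶`, `de⁵ = de⁶ = 0` through `dα(X, Y) = -α([X, Y])`. -/
instance : Bracket g8 g8 where
  bracket X Y := mk
    ![-(w 0 5 X Y - w 1 4 X Y), -(w 0 4 X Y + w 1 5 X Y),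
      -(-w 2 5 X Y + w 3 4 X Y), -(-w 2 4 X Y - w 3 5 X Y), 0, 0]

theorem ext6 {X Y : g8} (h0 : X.co 0 = Y.co 0) (h1 : X.co 1 = Y.co 1) (h2 : X.co 2 = Y.co 2)
    (h3 : X.co 3 = Y.co 3) (h4 : X.co 4 = Y.co 4) (h5 : X.co 5 = Y.co 5) : X = Y := by
  funext k
  fin_cases k <;> assumption

theorem bracket_coord (X Y : g8) :
    co ⁅X, Y⁆ 0 = -(w 0 5 X Y - w 1 4 X Y) ∧ co ⁅X, Y⁆ 1 = -(w 0 4 X Y + w 1 5 X Y) ∧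
    co ⁅X, Y⁆ 2 = -(-w 2 5 X Y + w 3 4 X Y) ∧ co ⁅X, Y⁆ 3 = -(-w 2 4 X Y - w 3 5 X Y) ∧
    co ⁅X, Y⁆ 4 = 0 ∧ co ⁅X, Y⁆ 5 = 0 := ⟨rfl, rfl, rfl, rfl, rfl, rfl⟩

theorem add_coord (X Y : g8) (k : Fin 6) : co (X + Y) k = X.co k + Y.co k := rfl

theorem smul_coord (c : ℝ) (X : g8) (k : Fin 6) : co (c • X) k = c * X.co k := rfl

theorem zero_coord (k : Fin 6) : co (0 : g8) k = 0 := rfl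

noncomputable instance : LieRing g8 where
  add_lie X Y Z := by
    apply ext6 <;> simp only [bracket_coord, w, add_coord] <;> ring
  lie_add X Y Z := by
    apply ext6 <;> simp only [bracket_coord, w, add_coord] <;> ring
  lie_self X := by
    apply ext6 <;> simp only [bracket_coord, w, zero_coord] <;> ring
  leibniz_lie X Y Z := by
    apply ext6 <;> simp only [bracket_coord, w, add_coord] <;> ring

noncomputable instance : LieAlgebra ℝ g8 where
  lie_smul c X Y := by
    apply ext6 <;> simp only [bracket_coord, w, smul_coord] <;> ring

end g8

/-! ## Complex structures on `𝔤₈` and the families (Siv2), (Siv3) -/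

/-- `J` is an (integrable) complex structure on `𝔤₈`: `J² = -1` and the Nijenhuis tensor vanishes. -/
def IsComplexStructure (J : g8 →L[ℝ] g8) : Prop :=
  (∀ X : g8, J (J X) = -X) ∧
    ∀ X Y : g8, ⁅X, Y⁆ + J ⁅J X, Y⁆ + J ⁅X, J Y⁆ - ⁅J X, J Y⁆ = 0

/-- `(φ 0, φ 1, φ 2)` is a basis of the space of `(1,0)`-forms of `J`, where `α` is of type `(1,0)`
if `α ∘ J = √-1 α`. -/
def IsCoframe (J : g8 →L[ℝ] g8) (φ : Fin 3 → g8 →ₗ[ℝ] ℂ) : Prop :=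
  (∀ i X, φ i (J X) = Complex.I * φ i X) ∧ LinearIndependent ℂ φ

/-- The differential `dα(X, Y) = -α([X, Y])` of an invariant complex-valued `1`-form. -/
noncomputable def invD (α : g8 →ₗ[ℝ] ℂ) (X Y : g8) : ℂ := -α ⁅X, Y⁆

/-- The wedge `α ∧ β` of two invariant complex-valued `1`-forms. -/
noncomputable def wedge (α β : g8 →ₗ[ℝ] ℂ) (X Y : g8) : ℂ := α X * β Y - α Y * β X

/-- The wedge `α ∧ β̄`. -/
noncomputable def wedgeBar (α β : g8 →ₗ[ℝ] ℂ) (X Y : g8) : ℂ :=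
  α X * starRingEnd ℂ (β Y) - α Y * starRingEnd ℂ (β X)

/-- Family (Siv2): complex structures with a `(1,0)`-coframe such that
`dφ¹ = 2√-1 φ¹³ + φ^{33̄}`, `dφ² = -2√-1 φ²³ + x φ^{33̄}`, `dφ³ = 0`, with `x ∈ {0, 1}`. -/
def FamilySiv2 (J : g8 →L[ℝ] g8) : Prop :=
  IsComplexStructure J ∧ ∃ (x : ℝ) (φ : Fin 3 → g8 →ₗ[ℝ] ℂ), (x = 0 ∨ x = 1) ∧ IsCoframe J φ ∧
    ∀ X Y : g8,
      invD (φ 0) X Y = 2 * Complex.I * wedge (φ 0) (φ 2) X Y + wedgeBar (φ 2) (φ 2) X Y ∧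
      invD (φ 1) X Y = -2 * Complex.I * wedge (φ 1) (φ 2) X Y + x * wedgeBar (φ 2) (φ 2) X Y ∧
      invD (φ 2) X Y = 0

/-- The complex structures of Family (Siv3) with parameter `A`, `|A| ≠ 1`: there is a
`(1,0)`-coframe such that `dφ¹ = A φ¹³ - φ^{13̄}`, `dφ² = -A φ²³ + φ^{23̄}`, `dφ³ = 0`. -/
def FamilySiv3With (A : ℂ) (J : g8 →L[ℝ] g8) : Prop :=
  IsComplexStructure J ∧ ‖A‖ ≠ 1 ∧ ∃ φ : Fin 3 → g8 →ₗ[ℝ] ℂ, IsCoframe J φ ∧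
    ∀ X Y : g8,
      invD (φ 0) X Y = A * wedge (φ 0) (φ 2) X Y - wedgeBar (φ 0) (φ 2) X Y ∧
      invD (φ 1) X Y = -A * wedge (φ 1) (φ 2) X Y + wedgeBar (φ 1) (φ 2) X Y ∧
      invD (φ 2) X Y = 0

/-- Family (Siv3). -/
def FamilySiv3 (J : g8 →L[ℝ] g8) : Prop := ∃ A : ℂ, FamilySiv3With A J

/-! ## The Lie group and its lattices -/

/-- The connected and simply connected Lie group with Lie algebra `𝔤₈`: the manifold `ℂ³`, with
coordinates `(u, v, s)` and the product
`(u, v, s) (u', v', s') = (u + eˢ u', v + e⁻ˢ v', s + s')`. -/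
def G8 : Type := ℂ × ℂ × ℂ

namespace G8

noncomputable instance : NormedAddCommGroup G8 := inferInstanceAs (NormedAddCommGroup (ℂ × ℂ × ℂ))

noncomputable instance : NormedSpace ℝ G8 := inferInstanceAs (NormedSpace ℝ (ℂ × ℂ × ℂ))

/-- A point from its three coordinates. -/
def mk (u v s : ℂ) : G8 := (u, v, s)

/-- The coordinate `u`. -/
def u (p : G8) : ℂ := p.1

/-- The coordinate `v`. -/
def v (p : G8) : ℂ := p.2.1

/-- The coordinate `s`. -/
def s (p : G8) : ℂ := p.2.2

theorem ext {p q : G8} (hu : p.u = q.u) (hv : p.v = q.v) (hs : p.s = q.s) : p = q :=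
  Prod.ext hu (Prod.ext hv hs)

noncomputable instance : Group G8 where
  mul p q := mk (p.u + Complex.exp p.s * q.u) (p.v + Complex.exp (-p.s) * q.v) (p.s + q.s)
  one := mk 0 0 0
  inv p := mk (-(Complex.exp (-p.s) * p.u)) (-(Complex.exp p.s * p.v)) (-p.s)
  mul_assoc p q r := by
    refine ext ?_ ?_ ?_
    · change (p.u + _) + Complex.exp (p.s + q.s) * r.u
        = p.u + Complex.exp p.s * (q.u + Complex.exp q.s * r.u)
      rw [Complex.exp_add]; ring
    · change (p.v + _) + Complex.exp (-(p.s + q.s)) * r.v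
        = p.v + Complex.exp (-p.s) * (q.v + Complex.exp (-q.s) * r.v)
      rw [neg_add, Complex.exp_add]; ring
    · exact add_assoc _ _ _
  one_mul p := by
    refine ext ?_ ?_ ?_
    · change 0 + Complex.exp 0 * p.u = p.u
      simp
    · change 0 + Complex.exp (-0) * p.v = p.v
      simp
    · exact zero_add _
  mul_one p := by
    refine ext ?_ ?_ ?_
    · change p.u + Complex.exp p.s * 0 = p.u
      simp
    · change p.v + Complex.exp (-p.s) * 0 = p.v
      simp
    · exact add_zero _
  inv_mul_cancel p := by
    refine ext ?_ ?_ ?_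
    · exact neg_add_cancel _
    · change -(Complex.exp p.s * p.v) + Complex.exp (- -p.s) * p.v = 0
      rw [neg_neg]; ring
    · exact neg_add_cancel _

theorem mul_eq (p q : G8) :
    p * q = mk (p.u + Complex.exp p.s * q.u) (p.v + Complex.exp (-p.s) * q.v) (p.s + q.s) := rfl

/-- The value at `p` of the left-invariant vector field with value `X` at the identity, where
`𝔤₈` is identified with the tangent space at the identity by `u = X₁ + √-1 X₂`,
`v = X₃ + √-1 X₄`, `s = X₆ + √-1 X₅`. -/
noncomputable def leftField (X : g8) (p : G8) : G8 :=
  mk (Complex.exp p.s * ⟨X.co 0, X.co 1⟩) (Complex.exp (-p.s) * ⟨X.co 2, X.co 3⟩) ⟨X.co 5, X.co 4⟩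

/-- The coordinate `s` as a continuous linear map. -/
noncomputable def sL : G8 →L[ℝ] ℂ :=
  (ContinuousLinearMap.snd ℝ ℂ ℂ).comp (ContinuousLinearMap.snd ℝ ℂ (ℂ × ℂ))

theorem hasFDerivAt_mk {f g h : G8 → ℂ} {f' g' h' : G8 →L[ℝ] ℂ} {p : G8}
    (hf : HasFDerivAt f f' p) (hg : HasFDerivAt g g' p) (hh : HasFDerivAt h h' p) :
    ∃ L : G8 →L[ℝ] G8, HasFDerivAt (fun q => mk (f q) (g q) (h q)) L p ∧
      ∀ q, L q = mk (f' q) (g' q) (h' q) :=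
  ⟨f'.prod (g'.prod h'), hf.prodMk (hg.prodMk hh), fun _ => rfl⟩

/-- `leftField X p` is the image of `X` under the differential at the identity of the left
translation by `p`. -/
theorem hasFDerivAt_mul_left (p : G8) : ∃ L : G8 →L[ℝ] G8,
    HasFDerivAt (fun q => p * q) L 1 ∧ ∀ X : g8, leftField X p = L (leftField X.co 1) := by
  have hu : HasFDerivAt (fun q : G8 => q.u) (ContinuousLinearMap.fst ℝ ℂ (ℂ × ℂ) : G8 →L[ℝ] ℂ) 1 :=
    (ContinuousLinearMap.fst ℝ ℂ (ℂ × ℂ) : G8 →L[ℝ] ℂ).hasFDerivAt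
  have hv : HasFDerivAt (fun q : G8 => q.v) ((ContinuousLinearMap.fst ℝ ℂ ℂ).comp
      (ContinuousLinearMap.snd ℝ ℂ (ℂ × ℂ)) : G8 →L[ℝ] ℂ) 1 :=
    ((ContinuousLinearMap.fst ℝ ℂ ℂ).comp
      (ContinuousLinearMap.snd ℝ ℂ (ℂ × ℂ)) : G8 →L[ℝ] ℂ).hasFDerivAt
  have hs : HasFDerivAt (fun q : G8 => q.s) sL 1 := sL.hasFDerivAt
  obtain ⟨L, hL, hL'⟩ := hasFDerivAt_mk ((hu.const_mul (Complex.exp p.s)).const_add p.u)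
    ((hv.const_mul (Complex.exp (-p.s))).const_add p.v) (hs.const_add p.s)
  refine ⟨L, hL, fun X => ?_⟩
  rw [hL']
  refine ext ?_ ?_ rfl
  · change Complex.exp p.s * _ = Complex.exp p.s * (Complex.exp 0 * _)
    rw [Complex.exp_zero, one_mul]
    rfl
  · change Complex.exp (-p.s) * _ = Complex.exp (-p.s) * (Complex.exp (-0) * _)
    rw [neg_zero, Complex.exp_zero, one_mul]
    rfl

/-- The left-invariant fields satisfy the bracket relations of `𝔤₈`. -/
theorem lieBracket_leftField (X Y : g8) (p : G8) :
    VectorField.lieBracket ℝ (leftField X) (leftField Y) p = leftField ⁅X, Y⁆ p := by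
  have hs : HasFDerivAt (fun q : G8 => q.s) sL p := sL.hasFDerivAt
  have key : ∀ Z W : g8, fderiv ℝ (leftField Z) p (leftField W p) =
      mk (Complex.exp p.s * ⟨W.co 5, W.co 4⟩ * ⟨Z.co 0, Z.co 1⟩)
        (-(Complex.exp (-p.s) * ⟨W.co 5, W.co 4⟩ * ⟨Z.co 2, Z.co 3⟩)) 0 := by
    intro Z W
    obtain ⟨L, hL, hL'⟩ := hasFDerivAt_mk (hs.cexp.mul_const (⟨Z.co 0, Z.co 1⟩ : ℂ))
      (hs.neg.cexp.mul_const (⟨Z.co 2, Z.co 3⟩ : ℂ)) (hasFDerivAt_const (⟨Z.co 5, Z.co 4⟩ : ℂ) p)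
    have : fderiv ℝ (leftField Z) p = L := hL.fderiv
    rw [this, hL']
    have hW : sL (leftField W p) = ⟨W.co 5, W.co 4⟩ := rfl
    refine ext ?_ ?_ rfl
    · simp [mk, u, hW]; ring
    · simp [mk, v, hW]; ring
  rw [VectorField.lieBracket, key, key]
  have h := g8.bracket_coord X Y
  refine ext ?_ ?_ ?_
  · change Complex.exp p.s * _ * _ - Complex.exp p.s * _ * _ = Complex.exp p.s * _
    rw [mul_assoc, mul_assoc, ← mul_sub]
    congr 1
    apply Complex.ext <;> simp [h, g8.w] <;> ring
  · change -(Complex.exp (-p.s) * _ * _) - -(Complex.exp (-p.s) * _ * _) = Complex.exp (-p.s) * _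
    have h2 : (⟨g8.co ⁅X, Y⁆ 2, g8.co ⁅X, Y⁆ 3⟩ : ℂ) =
        ⟨Y.co 5, Y.co 4⟩ * ⟨X.co 2, X.co 3⟩ - ⟨X.co 5, X.co 4⟩ * ⟨Y.co 2, Y.co 3⟩ := by
      apply Complex.ext <;> simp [h, g8.w] <;> ring
    rw [h2]
    ring
  · change (0 : ℂ) - 0 = ⟨g8.co ⁅X, Y⁆ 5, g8.co ⁅X, Y⁆ 4⟩
    rw [h.2.2.2.2.1, h.2.2.2.2.2, sub_zero]
    rfl

end G8

/-- `Γ` is a lattice: a discrete subgroup with compact quotient `Γ \ G`. -/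
def IsCocompactLattice (Γ : Subgroup G8) : Prop :=
  DiscreteTopology Γ ∧ CompactSpace (Quotient (QuotientGroup.rightRel Γ))

/-! ## Tensor calculus on `Γ \ G`

The left-invariant vector fields descend to a global frame of `Γ \ G`. A smooth tensor field on
`Γ \ G` is accordingly a smooth function on `G`, invariant under left translations by `Γ`, with
values in the corresponding tensor space over `𝔤₈`. Invariant tensor fields are the constant
functions. -/

/-- The derivative of a function along the left-invariant vector field `X`. -/
noncomputable def lieD {V : Type*} [NormedAddCommGroup V] [NormedSpace ℝ V]
    (X : g8) (f : G8 → V) (p : G8) : V := fderiv ℝ f p (G8.leftField X p)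

/-- `f` is (the pull-back to `G` of) a smooth field on `Γ \ G`. -/
def IsSmoothField {V : Type*} [NormedAddCommGroup V] [NormedSpace ℝ V]
    (Γ : Subgroup G8) (f : G8 → V) : Prop :=
  ContDiff ℝ ∞ f ∧ ∀ γ ∈ Γ, ∀ p : G8, f (γ * p) = f p

/-- `g` is a Hermitian metric on `(Γ \ G, J)`, not necessarily invariant: a Riemannian metric
with `g(J·, J·) = g`. -/
structure IsHermitianMetric (Γ : Subgroup G8) (J : g8 →L[ℝ] g8) (g : G8 → g8 →L[ℝ] g8 →L[ℝ] ℝ) :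
    Prop where
  smooth : IsSmoothField Γ g
  symm : ∀ p X Y, g p X Y = g p Y X
  pos : ∀ p X, X ≠ 0 → 0 < g p X X
  herm : ∀ p X Y, g p (J X) (J Y) = g p X Y

/-- The torsion `T(X, Y) = ∇_X Y - ∇_Y X - [X, Y]`; here and below a linear connection `∇` on the
tangent bundle is given by the values `∇ p X Y` at `p` of `∇_X Y` for left-invariant `X`, `Y`. -/
noncomputable def torsion (D : G8 → g8 →L[ℝ] g8 →L[ℝ] g8) (p : G8) (X Y : g8) : g8 :=
  D p X Y - D p Y X - ⁅X, Y⁆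

/-- `D` is the Chern connection of `(J, g)` on `Γ \ G`: the unique linear connection with
`∇g = 0`, `∇J = 0` and `∇^{0,1} = ∂̄` on the holomorphic tangent bundle. The last condition says
that the torsion has no `(1,1)`-component, that is, `T(X, Y) + T(JX, JY) = 0`. -/
structure IsChernConnection (Γ : Subgroup G8) (J : g8 →L[ℝ] g8) (g : G8 → g8 →L[ℝ] g8 →L[ℝ] ℝ)
    (D : G8 → g8 →L[ℝ] g8 →L[ℝ] g8) : Prop where
  smooth : IsSmoothField Γ D
  metric : ∀ p X Y Z, lieD X (fun q => g q Y Z) p = g p (D p X Y) Z + g p Y (D p X Z)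
  complex : ∀ p X Y, D p X (J Y) = J (D p X Y)
  torsion_type : ∀ p X Y, torsion D p X Y + torsion D p (J X) (J Y) = 0

/-- The curvature `R(X, Y) Z = ∇_X ∇_Y Z - ∇_Y ∇_X Z - ∇_{[X, Y]} Z`, for left-invariant
`X`, `Y`, `Z`. -/
noncomputable def curvature (D : G8 → g8 →L[ℝ] g8 →L[ℝ] g8) (p : G8) (X Y Z : g8) : g8 :=
  (lieD X (fun q => D q Y Z) p + D p X (D p Y Z))
    - (lieD Y (fun q => D q X Z) p + D p Y (D p X Z)) - D p ⁅X, Y⁆ Z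

/-- The metric `g` on `(Γ \ G, J)` is Chern-flat. -/
def IsChernFlat (Γ : Subgroup G8) (J : g8 →L[ℝ] g8) (g : G8 → g8 →L[ℝ] g8 →L[ℝ] ℝ) : Prop :=
  ∃ D, IsChernConnection Γ J g D ∧ ∀ p X Y Z, curvature D p X Y Z = 0

/-- The Chern connection of `g` is Kähler-like: its curvature satisfies the first Bianchi identity
`R(X, Y) Z + R(Y, Z) X + R(Z, X) Y = 0` and the type condition
`R(X, Y, Z, W) = R(X, Y, JZ, JW) = R(JX, JY, Z, W)`, with `R(X, Y, Z, W) = g(R(X, Y) Z, W)`. -/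
def IsChernKahlerLike (Γ : Subgroup G8) (J : g8 →L[ℝ] g8) (g : G8 → g8 →L[ℝ] g8 →L[ℝ] ℝ) : Prop :=
  ∃ D, IsChernConnection Γ J g D ∧
    (∀ p X Y Z, curvature D p X Y Z + curvature D p Y Z X + curvature D p Z X Y = 0) ∧
    ∀ p X Y Z W,
      g p (curvature D p X Y Z) W = g p (curvature D p X Y (J Z)) (J W) ∧
      g p (curvature D p X Y Z) W = g p (curvature D p (J X) (J Y) Z) W

/-- The fundamental form `ω = g(·, J·)`. -/
noncomputable def fundForm (J : g8 →L[ℝ] g8) (g : G8 → g8 →L[ℝ] g8 →L[ℝ] ℝ) (p : G8) (X Y : g8) : ℝ :=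
  g p X (J Y)

/-- The `4`-form `ω² = ω ∧ ω`. -/
noncomputable def fundFormSq (J : g8 →L[ℝ] g8) (g : G8 → g8 →L[ℝ] g8 →L[ℝ] ℝ)
    (p : G8) (X : Fin 4 → g8) : ℝ :=
  (1 / 4 : ℝ) * ∑ σ : Equiv.Perm (Fin 4), ((Equiv.Perm.sign σ : ℤ) : ℝ) *
    (fundForm J g p (X (σ 0)) (X (σ 1)) * fundForm J g p (X (σ 2)) (X (σ 3)))

/-- The exterior derivative of an `(n+1)`-form, evaluated on left-invariant vector fields. -/
noncomputable def extD {n : ℕ} (η : G8 → (Fin (n + 1) → g8) → ℝ) (p : G8) (X : Fin (n + 2) → g8) :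
    ℝ :=
  (∑ i : Fin (n + 2), (-1 : ℝ) ^ (i : ℕ) * lieD (X i) (fun q => η q (i.removeNth X)) p) -
    ∑ i : Fin (n + 1), ∑ j ≥ i, (-1 : ℝ) ^ (i + j : ℕ) *
      η p (Matrix.vecCons ⁅X i.castSucc, X j.succ⁆ (j.removeNth (i.castSucc.removeNth X)))

/-- The metric is balanced: `d(ω^{n-1}) = 0`, where `n = 3` is the complex dimension. -/
def IsBalanced (J : g8 →L[ℝ] g8) (g : G8 → g8 →L[ℝ] g8 →L[ℝ] ℝ) : Prop :=
  ∀ p X, extD (fundFormSq J g) p X = 0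

/-! ## Holomorphic families of invariant complex structures -/

/-- The almost complex structure `J_a ⊕ √-1` on the total space `(Γ \ G) × Δ`, as an operator on
vector fields `ξ` that are left-invariant along `Γ \ G`. Such a field is a function of the
parameter `a`, whose components are its part along `Γ \ G` and its part along `Δ ⊆ ℂ`. -/
noncomputable def totalJ (J : ℂ → g8 →L[ℝ] g8) (ξ : ℂ → g8 × ℂ) : ℂ → g8 × ℂ :=
  fun a => (J a (ξ a).1, Complex.I * (ξ a).2)

/-- The Lie bracket of two vector fields on the total space that are left-invariant along
`Γ \ G`. -/
noncomputable def totalBracket (ξ η : ℂ → g8 × ℂ) : ℂ → g8 × ℂ :=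
  fun a => fderiv ℝ η a (ξ a).2 - fderiv ℝ ξ a (η a).2 + (⁅(ξ a).1, (η a).1⁆, 0)

/-- `(J_a)`, for `a` in the unit disc `Δ`, is a holomorphic family of invariant complex structures:
it is smooth in `a`, and the almost complex structure `J_a ⊕ √-1` on `(Γ \ G) × Δ` is integrable
(its Nijenhuis tensor vanishes), so that `(Γ \ G) × Δ` is a complex manifold, the projection to `Δ`
is holomorphic, and the fibre over `a` is `(Γ \ G, J_a)`. -/
def IsHolomorphicFamily (J : ℂ → g8 →L[ℝ] g8) : Prop :=
  ContDiffOn ℝ ∞ J (Metric.ball 0 1) ∧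
  (∀ a ∈ Metric.ball (0 : ℂ) 1, ∀ X : g8, J a (J a X) = -X) ∧
  ∀ a ∈ Metric.ball (0 : ℂ) 1, ∀ X Y : g8 × ℂ,
    let ξ : ℂ → g8 × ℂ := fun _ => X
    let η : ℂ → g8 × ℂ := fun _ => Y
    totalBracket ξ η a + totalJ J (totalBracket (totalJ J ξ) η) a
      + totalJ J (totalBracket ξ (totalJ J η)) a
      - totalBracket (totalJ J ξ) (totalJ J η) a = 0

/-! Over the reals, `𝔤₈` is the complex Lie algebra `dα = α ∧ σ`, `dβ = -β ∧ σ`, `dσ = 0`, and all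
the complex structures in play come from choosing new `(1,0)`-forms built from `α`, `β`, `σ`, `σ̄`.
Writing `σ = A τ - τ̄` turns these equations into those of Family (Siv3). There the diagonal
connection with imaginary closed entries `±(φ³ - φ̄³)` is metric, complex and flat, and its torsion
is of type `(2,0)`, so it is a flat Chern connection (`exists_chernFlat`).

The degeneration is the family with `(1,0)`-forms `α + σ̄/4`, `β`, `σ + a σ̄`. These depend
holomorphically on `a`, which makes the family holomorphic. For `a ≠ 0` the term `σ̄/4` can be
absorbed by a multiple of `σ + a σ̄`, giving (Siv3) with `A = 1/ā`; at `a = 0` it cannot, and it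
produces the term `φ^{33̄}` of (Siv2) (`exists_degeneration`).

That term obstructs special metrics on a compact quotient. If `ω` is balanced, then `d(ω² ∧ φ¹) = ω²
∧ φ^{33̄}` by type, and `√-1` times the right side is a volume form, contradicting Stokes
(`not_exists_balanced`). For a Chern Kähler-like metric, the first Bianchi identity makes the Chern
torsion holomorphic. Its trace `τ` then satisfies `div τ^♯ = -|τ|²`, while the dual `W` of `-Re φ¹`
satisfies `div W = c - τ(W)` with a function `c > 0`. For large `K` the field `W - K τ^♯` has
positive divergence, again impossible (`not_exists_chernKahlerLike`).

The required form of Stokes, `not_forall_divergence_pos`, is proved upstairs on `G`: the group is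
amenable and unimodular, so an invariant divergence can be averaged against Følner functions, and no
measure on the quotient is needed. An explicit lattice, from the unit `(3 + √5)/2` acting on a
module over the Gaussian integers, makes the final statement non-vacuous. -/

/-! ### Coframes and integrability. -/

section Frames

open Complex ComplexConjugate

/-- Three real-linear complex-valued forms without common zero identify `𝔤₈` with `ℂ³`. -/
noncomputable def frameEquiv (φ : Fin 3 → g8 →ₗ[ℝ] ℂ) (h : ∀ X, (∀ i, φ i X = 0) → X = 0) :
    g8 ≃ₗ[ℝ] (Fin 3 → ℂ) :=
  LinearMap.linearEquivOfInjective (LinearMap.pi φ)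
    (by
      rw [← LinearMap.ker_eq_bot, LinearMap.ker_eq_bot']
      exact fun X hX => h X fun i => congrFun hX i)
    (by
      have h1 : Module.finrank ℝ g8 = 6 := Module.finrank_fin_fun ℝ
      have h2 : Module.finrank ℝ (Fin 3 → ℂ) = 6 := by simp [Module.finrank_pi_fintype]
      rw [h1, h2])

theorem frameEquiv_apply (φ : Fin 3 → g8 →ₗ[ℝ] ℂ) (h : ∀ X, (∀ i, φ i X = 0) → X = 0)
    (X : g8) (i : Fin 3) : frameEquiv φ h X i = φ i X := rfl

theorem apply_frameEquiv_symm (φ : Fin 3 → g8 →ₗ[ℝ] ℂ) (h : ∀ X, (∀ i, φ i X = 0) → X = 0)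
    (z : Fin 3 → ℂ) (i : Fin 3) : φ i ((frameEquiv φ h).symm z) = z i := by
  rw [← frameEquiv_apply φ h, LinearEquiv.apply_symm_apply]

theorem linearIndependent_of_forall_eq_zero {φ : Fin 3 → g8 →ₗ[ℝ] ℂ}
    (h : ∀ X, (∀ i, φ i X = 0) → X = 0) : LinearIndependent ℂ φ := by
  rw [Fintype.linearIndependent_iff]
  intro c hc i
  have := LinearMap.congr_fun hc ((frameEquiv φ h).symm (Pi.single i 1))
  simpa [apply_frameEquiv_symm, Pi.single_apply] using this

/-- The image of `X ↦ (φ i X)` is a complex subspace of `ℂ³`, since `J` realises multiplication by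
`√-1`. A functional vanishing on it would be a linear relation among the `φ i`, so the map is onto,
hence injective because both real dimensions are 6. -/
theorem IsCoframe.eq_zero {J : g8 →L[ℝ] g8} {φ : Fin 3 → g8 →ₗ[ℝ] ℂ} (hφ : IsCoframe J φ)
    (X : g8) (hX : ∀ i, φ i X = 0) : X = 0 := by
  obtain ⟨hJ, hli⟩ := hφ
  let S : Submodule ℂ (Fin 3 → ℂ) :=
    { carrier := Set.range (LinearMap.pi φ)
      add_mem' := by
        rintro _ _ ⟨x, rfl⟩ ⟨y, rfl⟩
        exact ⟨x + y, map_add _ _ _⟩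
      zero_mem' := ⟨0, map_zero _⟩
      smul_mem' := by
        rintro c _ ⟨x, rfl⟩
        refine ⟨c.re • x + c.im • J x, ?_⟩
        ext i
        simp only [LinearMap.pi_apply, map_add, map_smul, hJ, Pi.smul_apply, smul_eq_mul,
          real_smul]
        conv_rhs => rw [← Complex.re_add_im c]
        ring }
  have hS : S = ⊤ := by
    by_contra hne
    obtain ⟨f, hf0, hf⟩ := Submodule.exists_le_ker_of_lt_top S (lt_top_iff_ne_top.mpr hne)
    apply hf0
    have hfx : ∀ z : Fin 3 → ℂ, f z = ∑ i, f (Pi.single i 1) * z i := by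
      intro z
      conv_lhs => rw [LinearMap.pi_apply_eq_sum_univ f z]
      refine Finset.sum_congr rfl fun i _ => ?_
      rw [smul_eq_mul, mul_comm]
      congr 2
      ext j
      simp [Pi.single_apply, eq_comm]
    have hz : ∑ i, f (Pi.single i 1) • φ i = 0 := by
      ext1 x
      have h1 : f (LinearMap.pi φ x) = 0 := hf (show LinearMap.pi φ x ∈ S from ⟨x, rfl⟩)
      rw [hfx] at h1
      simpa using h1
    have hc := Fintype.linearIndependent_iff.mp hli _ hz
    refine LinearMap.ext fun z => ?_
    rw [hfx]
    simp [hc]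
  have hsurj : Function.Surjective (LinearMap.pi φ) := by
    intro z
    have : z ∈ S := hS ▸ Submodule.mem_top
    exact this
  have h1 : Module.finrank ℝ g8 = 6 := Module.finrank_fin_fun ℝ
  have h2 : Module.finrank ℝ (Fin 3 → ℂ) = 6 := by simp [Module.finrank_pi_fintype]
  have hinj := (LinearMap.injective_iff_surjective_of_finrank_eq_finrank (h1.trans h2.symm)).mpr
    hsurj
  apply hinj
  rw [map_zero]
  exact funext hX

/-- A complex structure is integrable if the differentials of its `(1,0)`-forms have no
`(0,2)`-component. -/
theorem isComplexStructure_of_forms {J : g8 →L[ℝ] g8} {φ : Fin 3 → g8 →ₗ[ℝ] ℂ}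
    (h : ∀ X, (∀ i, φ i X = 0) → X = 0) (hJ : ∀ i X, φ i (J X) = I * φ i X)
    (hd : ∀ i X Y, invD (φ i) X Y + I * invD (φ i) (J X) Y + I * invD (φ i) X (J Y)
      - invD (φ i) (J X) (J Y) = 0) : IsComplexStructure J := by
  refine ⟨fun X => ?_, fun X Y => h _ fun i => ?_⟩
  · rw [eq_neg_iff_add_eq_zero]
    refine h _ fun i => ?_
    rw [map_add, hJ, hJ, ← mul_assoc, I_mul_I]
    ring
  · have := hd i X Y
    simp only [invD] at this
    simp only [map_add, map_sub, hJ]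
    linear_combination -this

end Frames

/-! ### Existence of Family (Siv3) for every parameter. -/

section Existence

open Complex ComplexConjugate

/-- The complex conjugate of a complex-valued form. -/
noncomputable def conjForm (σ : g8 →ₗ[ℝ] ℂ) : g8 →ₗ[ℝ] ℂ := conjAe.toLinearMap.comp σ

theorem conjForm_apply (σ : g8 →ₗ[ℝ] ℂ) (X : g8) : conjForm σ X = conj (σ X) := rfl

/-- `(α, β, σ)` are coordinates in which `𝔤₈` is the complex Lie algebra
`dα = α ∧ σ`, `dβ = -β ∧ σ`, `dσ = 0`. -/
structure IsComplexFrame (α β σ : g8 →ₗ[ℝ] ℂ) : Prop where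
  eq_zero : ∀ X, α X = 0 → β X = 0 → σ X = 0 → X = 0
  d_α : ∀ X Y, invD α X Y = wedge α σ X Y
  d_β : ∀ X Y, invD β X Y = -wedge β σ X Y
  d_σ : ∀ X Y, invD σ X Y = 0

/-- The form `X ↦ X_i + √-1 X_j`. -/
noncomputable def coordForm (i j : Fin 6) : g8 →ₗ[ℝ] ℂ where
  toFun X := ⟨X.co i, X.co j⟩
  map_add' X Y := by apply Complex.ext <;> simp [g8.add_coord]
  map_smul' c X := by apply Complex.ext <;> simp [g8.smul_coord]

theorem coordForm_apply (i j : Fin 6) (X : g8) : coordForm i j X = ⟨X.co i, X.co j⟩ := rfl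

theorem isComplexFrame_coordForm :
    IsComplexFrame (coordForm 0 1) (coordForm 2 3) (coordForm 5 4) := by
  constructor
  · intro X h1 h2 h3
    simp only [coordForm_apply, Complex.ext_iff, zero_re, zero_im] at h1 h2 h3
    exact g8.ext6 h1.1 h1.2 h2.1 h2.2 h3.2 h3.1
  all_goals
    intro X Y
    have h := g8.bracket_coord X Y
    apply Complex.ext <;> simp [invD, wedge, coordForm_apply, h, g8.w] <;> ring

/-- Substituting `σ = A τ - τ̄` in `dα = α ∧ σ`, `dβ = -β ∧ σ` gives the structure equations at
once. The substitution can be inverted exactly when `|A| ≠ 1`. -/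
theorem exists_familySiv3With (A : ℂ) (hA : ‖A‖ ≠ 1) : ∃ J : g8 →L[ℝ] g8, FamilySiv3With A J := by
  obtain ⟨h0, hα, hβ, hσ⟩ := isComplexFrame_coordForm
  set α := coordForm 0 1
  set β := coordForm 2 3
  set σ := coordForm 5 4
  have hk : A * conj A - 1 ≠ 0 := by
    rw [mul_conj, normSq_eq_norm_sq]
    norm_cast
    intro h
    exact hA (by nlinarith [norm_nonneg A, sq_nonneg (‖A‖ - 1)])
  set k := (A * conj A - 1)⁻¹ with hkdef
  have hkc : conj k = k := by simp [hkdef, mul_comm]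
  have hkk : k * (A * conj A - 1) = 1 := inv_mul_cancel₀ hk
  -- The solution of `σ = A τ - τ̄`, with `k = 1 / (|A|² - 1)`.
  let τ : g8 →ₗ[ℝ] ℂ := (k * conj A) • σ + k • conjForm σ
  have hτ : ∀ X, τ X = k * (conj A * σ X + conj (σ X)) := by
    intro X
    simp only [τ, LinearMap.add_apply, LinearMap.smul_apply, conjForm_apply, smul_eq_mul]
    ring
  have hστ : ∀ X, σ X = A * τ X - conj (τ X) := by
    intro X
    rw [hτ]
    simp only [map_mul, map_add, conj_conj, hkc]
    linear_combination (- σ X) * hkk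
  let φ : Fin 3 → g8 →ₗ[ℝ] ℂ := ![α, β, τ]
  have hφ : ∀ X, (∀ i, φ i X = 0) → X = 0 := by
    intro X hX
    have h2 : τ X = 0 := hX 2
    exact h0 X (hX 0) (hX 1) (by rw [hστ, h2]; simp)
  let e := frameEquiv φ hφ
  let J : g8 →L[ℝ] g8 := LinearMap.toContinuousLinearMap
    (e.symm.toLinearMap ∘ₗ (LinearMap.lsmul ℂ (Fin 3 → ℂ) I).restrictScalars ℝ ∘ₗ e.toLinearMap)
  have hJ : ∀ i X, φ i (J X) = I * φ i X := fun i X => by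
    change φ i (e.symm (I • e X)) = _
    rw [apply_frameEquiv_symm]
    rfl
  have hd : ∀ X Y : g8,
      invD (φ 0) X Y = A * wedge (φ 0) (φ 2) X Y - wedgeBar (φ 0) (φ 2) X Y ∧
      invD (φ 1) X Y = -A * wedge (φ 1) (φ 2) X Y + wedgeBar (φ 1) (φ 2) X Y ∧
      invD (φ 2) X Y = 0 := by
    intro X Y
    refine ⟨?_, ?_, ?_⟩
    · change invD α X Y = A * wedge α τ X Y - wedgeBar α τ X Y
      rw [hα]
      simp only [wedge, wedgeBar, hστ]
      ring
    · change invD β X Y = -A * wedge β τ X Y + wedgeBar β τ X Y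
      rw [hβ]
      simp only [wedge, wedgeBar, hστ]
      ring
    · change invD τ X Y = 0
      have := hσ X Y
      simp only [invD, neg_eq_zero] at this ⊢
      rw [hτ, this]
      simp
  refine ⟨J, isComplexStructure_of_forms hφ hJ ?_, hA, φ,
    ⟨hJ, linearIndependent_of_forall_eq_zero hφ⟩, hd⟩
  intro i X Y
  fin_cases i
  · simp only [Fin.zero_eta, (hd _ _).1, wedge, wedgeBar, hJ, map_mul, conj_I]
    ring_nf
    simp only [I_sq]
    ring
  · simp only [Fin.mk_one, (hd _ _).2.1, wedge, wedgeBar, hJ, map_mul, conj_I]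
    ring_nf
    simp only [I_sq]
    ring
  · simp only [Fin.reduceFinMk, (hd _ _).2.2]
    simp

end Existence

/-! ### A Chern-flat metric on Family (Siv3). -/

section ChernFlat

open Complex ComplexConjugate

theorem lieD_const {V : Type*} [NormedAddCommGroup V] [NormedSpace ℝ V] (X : g8) (c : V) (p : G8) :
    lieD X (fun _ => c) p = 0 := by
  simp [lieD]

theorem isSmoothField_const {V : Type*} [NormedAddCommGroup V] [NormedSpace ℝ V]
    (Γ : Subgroup G8) (c : V) : IsSmoothField Γ (fun _ => c) :=
  ⟨contDiff_const, fun _ _ _ => rfl⟩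

/-- A real-bilinear map of finite-dimensional spaces as a continuous bilinear map. -/
noncomputable def bilinCLM {E F : Type*} [NormedAddCommGroup E] [NormedSpace ℝ E]
    [FiniteDimensional ℝ E] [NormedAddCommGroup F] [NormedSpace ℝ F] (B : E →ₗ[ℝ] E →ₗ[ℝ] F) :
    E →L[ℝ] E →L[ℝ] F :=
  LinearMap.toContinuousLinearMap
    ((LinearMap.toContinuousLinearMap (𝕜 := ℝ) (E := E) (F' := F)).toLinearMap ∘ₗ B)

/-- The metric making the coframe unitary works. Its Chern connection is diagonal in the coframe
with constant coefficients, and vanishing curvature satisfies all the Kähler-like symmetries. -/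
theorem exists_chernFlat {J : g8 →L[ℝ] g8} (hS : FamilySiv3 J) :
    ∃ g₀ : g8 →L[ℝ] g8 →L[ℝ] ℝ, ∀ Γ : Subgroup G8,
      IsHermitianMetric Γ J (fun _ => g₀) ∧ IsChernFlat Γ J (fun _ => g₀) ∧
        IsChernKahlerLike Γ J (fun _ => g₀) := by
  obtain ⟨A, hJ, hA, φ, hφ, hd⟩ := hS
  have h0 := hφ.eq_zero
  have hφJ := hφ.1
  let e := frameEquiv φ h0
  let g₀ : g8 →L[ℝ] g8 →L[ℝ] ℝ := bilinCLM (LinearMap.mk₂ ℝ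
    (fun X Y => ∑ i, (φ i X * conj (φ i Y)).re)
    (by intros; simp only [map_add, add_mul, add_re, Finset.sum_add_distrib])
    (by intros; simp [mul_assoc, Finset.mul_sum, -mul_re, re_ofReal_mul])
    (by intros; simp only [map_add, mul_add, add_re, Finset.sum_add_distrib])
    (by intros; simp [mul_left_comm, Finset.mul_sum, -mul_re, re_ofReal_mul]))
  have hg : ∀ X Y, g₀ X Y = ∑ i, (φ i X * conj (φ i Y)).re := fun _ _ => rfl
  -- The connection forms. Being imaginary, they preserve the metric; adding `θ_i ∧ φ^i` to `dφ^i`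
  -- cancels its `(1,1)`-part; and since `φ 2` kills brackets they are closed, so this diagonal
  -- connection is flat.
  let θ : g8 → Fin 3 → ℂ := fun X =>
    ![φ 2 X - conj (φ 2 X), -(φ 2 X - conj (φ 2 X)), 0]
  have hθadd : ∀ X Y, θ (X + Y) = θ X + θ Y := by
    intro X Y
    ext i
    fin_cases i <;> simp [θ] <;> ring
  have hθsmul : ∀ (c : ℝ) X, θ (c • X) = c • θ X := by
    intro c X
    ext i
    fin_cases i <;> simp [θ] <;> ring
  let D₀ : g8 →L[ℝ] g8 →L[ℝ] g8 := bilinCLM (LinearMap.mk₂ ℝ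
    (fun X Y => e.symm (θ X * e Y))
    (by intros; simp only [hθadd, add_mul, map_add])
    (by intros; simp only [hθsmul, smul_mul_assoc, map_smul])
    (by intros; simp only [mul_add, map_add])
    (by intros; simp only [mul_smul_comm, map_smul]))
  have hD : ∀ i X Y, φ i (D₀ X Y) = θ X i * φ i Y := by
    intro i X Y
    change φ i (e.symm (θ X * e Y)) = _
    rw [apply_frameEquiv_symm]
    rfl
  have hθc : ∀ i X, conj (θ X i) = -θ X i := by
    intro i X
    fin_cases i <;> simp [θ]
  have hext : ∀ X Y, (∀ i, φ i X = φ i Y) → X = Y := fun X Y h =>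
    sub_eq_zero.mp (h0 _ fun i => by rw [map_sub, h, sub_self])
  have hbr : ∀ X Y, φ 2 ⁅X, Y⁆ = 0 := fun X Y => by
    simpa [invD] using (hd X Y).2.2
  refine ⟨g₀, fun Γ => ?_⟩
  have hherm : IsHermitianMetric Γ J (fun _ => g₀) := by
    refine ⟨isSmoothField_const Γ g₀, fun p X Y => ?_, fun p X hX => ?_, fun p X Y => ?_⟩
    · simp only [hg]
      refine Finset.sum_congr rfl fun i _ => ?_
      simp [mul_re]
      ring
    · simp only [hg, mul_conj, ofReal_re]
      by_contra hle
      apply hX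
      refine h0 X fun i => ?_
      have hz := (Finset.sum_eq_zero_iff_of_nonneg (fun i _ => normSq_nonneg (φ i X))).mp
        (le_antisymm (not_lt.mp hle) (Finset.sum_nonneg fun i _ => normSq_nonneg (φ i X)))
      exact normSq_eq_zero.mp (hz i (Finset.mem_univ i))
    · simp only [hg, hφJ]
      refine Finset.sum_congr rfl fun i _ => ?_
      simp [mul_re]
  have hchern : IsChernConnection Γ J (fun _ => g₀) (fun _ => D₀) := by
    refine ⟨isSmoothField_const Γ D₀, fun p X Y Z => ?_, fun p X Y => ?_, fun p X Y => ?_⟩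
    · rw [lieD_const]
      simp only [hg, hD, map_mul, hθc, ← Finset.sum_add_distrib]
      refine (Finset.sum_eq_zero fun i _ => ?_).symm
      rw [← add_re]
      ring_nf
      simp
    · refine hext _ _ fun i => ?_
      rw [hD, hφJ, hφJ, hD]
      ring
    · have h1 := fun X Y => (hd X Y).1
      have h2 := fun X Y => (hd X Y).2.1
      simp only [invD, neg_eq_iff_eq_neg] at h1 h2
      refine h0 _ fun i => ?_
      simp only [torsion, map_add, map_sub, hD]
      fin_cases i
      · simp only [Fin.zero_eta, h1, wedge, wedgeBar, hφJ, map_mul, conj_I, θ,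
          Matrix.cons_val_zero]
        ring_nf
        simp only [I_sq]
        ring
      · simp only [Fin.mk_one, h2, wedge, wedgeBar, hφJ, map_mul, conj_I, θ, Matrix.cons_val_one,
          Matrix.cons_val_zero]
        ring_nf
        simp only [I_sq]
        ring
      · simp [hbr, θ]
  have hcurv : ∀ p X Y Z, curvature (fun _ => D₀) p X Y Z = 0 := by
    intro p X Y Z
    simp only [curvature, lieD_const]
    refine h0 _ fun i => ?_
    have h3 : θ ⁅X, Y⁆ = 0 := by
      ext i
      fin_cases i <;> simp [θ, hbr]
    simp only [map_sub, map_add, map_zero, hD, h3, Pi.zero_apply]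
    ring
  refine ⟨hherm, ⟨_, hchern, hcurv⟩, _, hchern, fun p X Y Z => ?_, fun p X Y Z W => ?_⟩
  · simp [hcurv]
  · simp [hcurv]

end ChernFlat

/-! ### The holomorphic degeneration from (Siv3) to (Siv2). -/

section Deformation

open Complex ComplexConjugate

variable {α β σ : g8 →ₗ[ℝ] ℂ}

theorem IsComplexFrame.eq_zero_of_forall (hF : IsComplexFrame α β σ) (X : g8)
    (hX : ∀ i, (![α, β, σ] : Fin 3 → g8 →ₗ[ℝ] ℂ) i X = 0) : X = 0 :=
  hF.eq_zero X (hX 0) (hX 1) (hX 2)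

/-- The vector with coordinates `(x, y, z)` in the frame `(α, β, σ)`. -/
noncomputable def frameVector (hF : IsComplexFrame α β σ) (x y z : ℂ) : g8 :=
  (frameEquiv _ hF.eq_zero_of_forall).symm ![x, y, z]

theorem frameVector_α (hF : IsComplexFrame α β σ) (x y z : ℂ) :
    α (frameVector hF x y z) = x := apply_frameEquiv_symm _ hF.eq_zero_of_forall _ 0

theorem frameVector_β (hF : IsComplexFrame α β σ) (x y z : ℂ) :
    β (frameVector hF x y z) = y := apply_frameEquiv_symm _ hF.eq_zero_of_forall _ 1

theorem frameVector_σ (hF : IsComplexFrame α β σ) (x y z : ℂ) :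
    σ (frameVector hF x y z) = z := apply_frameEquiv_symm _ hF.eq_zero_of_forall _ 2

theorem frameVector_add (hF : IsComplexFrame α β σ) (x y z x' y' z' : ℂ) :
    frameVector hF (x + x') (y + y') (z + z') = frameVector hF x y z + frameVector hF x' y' z' := by
  rw [frameVector, frameVector, frameVector, ← map_add]
  simp

theorem frameVector_smul (hF : IsComplexFrame α β σ) (c : ℝ) (x y z : ℂ) :
    frameVector hF (c * x) (c * y) (c * z) = c • frameVector hF x y z := by
  rw [frameVector, frameVector, ← map_smul]
  simp

/-- The endomorphism with `α ↦ √-1 (α + σ̄ / 4)`, `β ↦ √-1 β`, `σ ↦ 0`. -/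
noncomputable def deformBase (hF : IsComplexFrame α β σ) : g8 →L[ℝ] g8 :=
  LinearMap.toContinuousLinearMap
    { toFun := fun X => frameVector hF (I * (α X + conj (σ X) / 4)) (I * β X) 0
      map_add' := fun X Y => by
        rw [← frameVector_add]
        congr 1 <;> (try simp only [map_add]) <;> ring
      map_smul' := fun c X => by
        rw [RingHom.id_apply, ← frameVector_smul]
        congr 1 <;> (try simp only [map_smul, real_smul, map_mul, conj_ofReal]) <;> ring }

/-- The endomorphism with `σ ↦ m τ` and `α ↦ -m̄ τ̄ / 4`, linearly in `m`. -/
noncomputable def deformPart (hF : IsComplexFrame α β σ) (τ : g8 →ₗ[ℝ] ℂ) :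
    ℂ →L[ℝ] g8 →L[ℝ] g8 :=
  LinearMap.toContinuousLinearMap
    ((LinearMap.toContinuousLinearMap (𝕜 := ℝ) (E := g8) (F' := g8)).toLinearMap ∘ₗ
      LinearMap.mk₂ ℝ (fun m X => frameVector hF (-conj (m * τ X) / 4) 0 (m * τ X))
      (by
        intros
        rw [← frameVector_add]
        congr 1 <;> (try simp only [map_add, map_mul]) <;> ring)
      (by
        intros
        rw [← frameVector_smul]
        congr 1 <;> (try simp only [real_smul, map_mul, conj_ofReal]) <;> ring)
      (by
        intros
        rw [← frameVector_add]
        congr 1 <;> (try simp only [map_add, map_mul]) <;> ring)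
      (by
        intros
        rw [← frameVector_smul]
        congr 1 <;> (try simp only [map_smul, real_smul, map_mul, conj_ofReal]) <;> ring))

/-- The complex structures with `(1,0)`-forms `α + σ̄ / 4`, `β`, `σ + a σ̄`. -/
noncomputable def deformation (hF : IsComplexFrame α β σ) (a : ℂ) : g8 →L[ℝ] g8 :=
  deformBase hF + deformPart hF σ (I * (1 + a * conj a) * (1 - a * conj a)⁻¹) +
    deformPart hF (conjForm σ) (2 * I * a * (1 - a * conj a)⁻¹)

theorem one_sub_mul_conj_ne_zero {a : ℂ} (ha : a ∈ Metric.ball (0 : ℂ) 1) :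
    1 - a * conj a ≠ 0 := by
  rw [mul_conj, normSq_eq_norm_sq]
  norm_cast
  rw [mem_ball_zero_iff] at ha
  intro h
  nlinarith [norm_nonneg a]

theorem contDiffOn_deformation (hF : IsComplexFrame α β σ) :
    ContDiffOn ℝ ∞ (deformation hF) (Metric.ball 0 1) := by
  have hc : ContDiff ℝ ∞ (fun a : ℂ => conj a) := conjCLE.contDiff
  have hid : ContDiff ℝ ∞ (fun a : ℂ => a) := contDiff_id
  refine ContDiffOn.add (ContDiffOn.add contDiffOn_const ?_) ?_
  · refine (deformPart hF σ).contDiff.comp_contDiffOn (ContDiffOn.mul ?_ (ContDiffOn.inv ?_ ?_))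
    · exact (contDiff_const.mul (contDiff_const.add (hid.mul hc))).contDiffOn
    · exact (contDiff_const.sub (hid.mul hc)).contDiffOn
    · exact fun a ha => one_sub_mul_conj_ne_zero ha
  · refine (deformPart hF _).contDiff.comp_contDiffOn (ContDiffOn.mul ?_ (ContDiffOn.inv ?_ ?_))
    · exact (contDiff_const.mul hid).contDiffOn
    · exact (contDiff_const.sub (hid.mul hc)).contDiffOn
    · exact fun a ha => one_sub_mul_conj_ne_zero ha

theorem β_deformation (hF : IsComplexFrame α β σ) (a : ℂ) (X : g8) :
    β (deformation hF a X) = I * β X := by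
  change β (frameVector hF _ _ _ + frameVector hF _ _ _ + frameVector hF _ _ _) = _
  simp only [map_add, frameVector_β]
  ring

theorem α_deformation (hF : IsComplexFrame α β σ) (a : ℂ) (X : g8) :
    α (deformation hF a X) + conj (σ (deformation hF a X)) / 4 = I * (α X + conj (σ X) / 4) := by
  change α (frameVector hF _ _ _ + frameVector hF _ _ _ + frameVector hF _ _ _) +
    conj (σ (frameVector hF _ _ _ + frameVector hF _ _ _ + frameVector hF _ _ _)) / 4 = _
  simp only [map_add, frameVector_α, frameVector_σ, map_zero]
  ring

theorem σ_deformation (hF : IsComplexFrame α β σ) {a : ℂ} (ha : a ∈ Metric.ball (0 : ℂ) 1)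
    (X : g8) :
    σ (deformation hF a X) + a * conj (σ (deformation hF a X)) = I * (σ X + a * conj (σ X)) := by
  have hk := one_sub_mul_conj_ne_zero ha
  have hk' : 1 - conj a * a ≠ 0 := by rwa [mul_comm]
  change σ (frameVector hF _ _ _ + frameVector hF _ _ _ + frameVector hF _ _ _) +
    a * conj (σ (frameVector hF _ _ _ + frameVector hF _ _ _ + frameVector hF _ _ _)) = _
  simp only [map_add, frameVector_σ, conjForm_apply, map_mul, map_inv₀, map_sub, conj_conj, conj_I,
    map_one, map_ofNat, map_zero]
  field_simp
  ring

/-- Eliminating `conj z` between the equation and its conjugate leaves `(1 - |a|²) z = 0`. -/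
theorem σ_eq_zero {a z : ℂ} (ha : a ∈ Metric.ball (0 : ℂ) 1) (h : z + a * conj z = 0) : z = 0 := by
  have h' := congrArg conj h
  simp only [map_add, map_mul, conj_conj, map_zero] at h'
  have : (1 - a * conj a) * z = 0 := by linear_combination h - a * h'
  exact (mul_eq_zero.mp this).resolve_left (one_sub_mul_conj_ne_zero ha)

theorem deformation_eq_zero (hF : IsComplexFrame α β σ) {a : ℂ} (ha : a ∈ Metric.ball (0 : ℂ) 1)
    {X : g8} (h0 : α X + conj (σ X) / 4 = 0) (h1 : β X = 0) (h2 : σ X + a * conj (σ X) = 0) :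
    X = 0 := by
  have hz := σ_eq_zero ha h2
  refine hF.eq_zero X ?_ h1 hz
  simpa [hz] using h0

/-- With `φ 0 = α + σ̄/4` one has `dφ 0 = (φ 0 - σ̄/4) ∧ σ`. Both `σ` and `σ̄` are combinations of
`φ 2` and its conjugate, so `σ̄ ∧ σ` is of type `(1,1)` and no `(0,2)`-part appears; `β ∧ σ` has the
`(1,0)`-factor `β`. -/
theorem isComplexStructure_deformation (hF : IsComplexFrame α β σ) {a : ℂ}
    (ha : a ∈ Metric.ball (0 : ℂ) 1) : IsComplexStructure (deformation hF a) := by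
  have hk := one_sub_mul_conj_ne_zero ha
  obtain ⟨k, hkc, hkk⟩ : ∃ k : ℂ, conj k = k ∧ k * (1 - a * conj a) = 1 :=
    ⟨(1 - a * conj a)⁻¹, by simp [mul_comm], inv_mul_cancel₀ hk⟩
  let φ : Fin 3 → g8 →ₗ[ℝ] ℂ :=
    ![α + (1 / 4 : ℂ) • conjForm σ, β, σ + a • conjForm σ]
  have e0 : ∀ X, φ 0 X = α X + conj (σ X) / 4 := fun X => by
    simp [φ, conjForm_apply]; ring
  have e1 : ∀ X, φ 1 X = β X := fun X => rfl
  have e2 : ∀ X, φ 2 X = σ X + a * conj (σ X) := fun X => rfl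
  have hσ : ∀ X, σ X = k * (φ 2 X - a * conj (φ 2 X)) := by
    intro X
    rw [e2]
    simp only [map_add, map_mul, conj_conj]
    linear_combination (-σ X) * hkk
  have hα : ∀ X, α X = φ 0 X - conj (k * (φ 2 X - a * conj (φ 2 X))) / 4 := by
    intro X
    rw [← hσ, e0]
    ring
  have hφJ : ∀ i X, φ i (deformation hF a X) = I * φ i X := by
    intro i X
    fin_cases i
    · exact (e0 _).trans ((α_deformation hF a X).trans (by rw [← e0]; rfl))
    · exact β_deformation hF a X
    · exact σ_deformation hF ha X
  have hbr : ∀ X Y, σ ⁅X, Y⁆ = 0 := fun X Y => by simpa [invD] using hF.d_σ X Y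
  have hd0 : ∀ X Y, invD (φ 0) X Y = wedge α σ X Y := by
    intro X Y
    rw [← hF.d_α]
    simp [invD, e0, hbr]
  have hd1 : ∀ X Y, invD (φ 1) X Y = -wedge β σ X Y := hF.d_β
  have hd2 : ∀ X Y, invD (φ 2) X Y = 0 := by
    intro X Y
    simp [invD, e2, hbr]
  refine isComplexStructure_of_forms (φ := φ) (fun X hX => ?_) hφJ fun i X Y => ?_
  · exact deformation_eq_zero hF ha ((e0 X).symm.trans (hX 0)) (hX 1) (hX 2)
  fin_cases i
  · simp only [Fin.zero_eta, hd0, wedge, hσ, hα, hφJ, map_mul, map_sub, map_neg, conj_I,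
      conj_conj]
    ring_nf
    simp only [I_sq]
    ring
  · simp only [Fin.mk_one, hd1, wedge, ← e1, hσ, hφJ, map_mul, conj_I]
    ring_nf
    simp only [I_sq]
    ring
  · simp [hd2]

/-- On fields constant in `a`, the Nijenhuis tensor of the total space is that of the fibre plus
terms in the derivative `L` of `J_a`. The latter cancel precisely when `J_a (L v) = L (√-1 v)`,
which follows from the holomorphic dependence of the `(1,0)`-forms on `a`. -/
theorem isHolomorphicFamily_deformation (hF : IsComplexFrame α β σ) :
    IsHolomorphicFamily (deformation hF) := by
  refine ⟨contDiffOn_deformation hF, fun a ha => (isComplexStructure_deformation hF ha).1,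
    fun a ha X Y => ?_⟩
  obtain ⟨-, hN⟩ := isComplexStructure_deformation hF ha
  have hnhds : Metric.ball (0 : ℂ) 1 ∈ nhds a := Metric.isOpen_ball.mem_nhds ha
  have hdiff : DifferentiableAt ℝ (deformation hF) a :=
    ((contDiffOn_deformation hF).contDiffAt hnhds).differentiableAt (by simp)
  obtain ⟨L, hL⟩ := hdiff
  have hLX : ∀ Z : g8, HasFDerivAt (fun b => deformation hF b Z) (L.flip Z) a := fun Z =>
    ((ContinuousLinearMap.apply ℝ g8 Z).hasFDerivAt.comp a hL)
  have hconst : ∀ Z : g8 × ℂ, HasFDerivAt (totalJ (deformation hF) fun _ => Z)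
      ((L.flip Z.1).prod (0 : ℂ →L[ℝ] ℂ)) a := fun Z =>
    (hLX Z.1).prodMk (hasFDerivAt_const _ _)
  have hform : ∀ (φ : g8 →ₗ[ℝ] ℂ) (Z : g8), HasFDerivAt (fun b => φ (deformation hF b Z))
      ((LinearMap.toContinuousLinearMap φ).comp (L.flip Z)) a := fun φ Z =>
    (LinearMap.toContinuousLinearMap φ).hasFDerivAt.comp a (hLX Z)
  have hconj : ∀ Z : g8, HasFDerivAt (fun b => conj (σ (deformation hF b Z)))
      ((LinearMap.toContinuousLinearMap (conjForm σ)).comp (L.flip Z)) a := hform (conjForm σ)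
  have h1 : ∀ v Z, β (L v Z) = 0 := by
    intro v Z
    have hc := hform β Z
    simp only [β_deformation] at hc
    exact congrArg (fun T : ℂ →L[ℝ] ℂ => T v) (hc.unique (hasFDerivAt_const _ _))
  have h0 : ∀ v Z, α (L v Z) + conj (σ (L v Z)) / 4 = 0 := by
    intro v Z
    have hc := (hform α Z).add ((hconj Z).mul_const (1 / 4 : ℂ))
    have he : (fun b => α (deformation hF b Z)) + (fun b => conj (σ (deformation hF b Z)) * (1 / 4))
        = fun _ => I * (α Z + conj (σ Z) / 4) := by
      funext b
      rw [← α_deformation hF b]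
      simp only [Pi.add_apply]
      ring
    rw [he] at hc
    have := congrArg (fun T : ℂ →L[ℝ] ℂ => T v) (hc.unique (hasFDerivAt_const _ _))
    simp [conjForm_apply] at this
    linear_combination this
  -- The derivative in `a` of `σ_deformation`. The right side is complex linear in `v` because `σ +
  -- a σ̄` is holomorphic in `a`; the two other forms do not involve `a`, whence the zeros in `h0`
  -- and `h1`.
  have h2 : ∀ v Z, σ (L v Z) + a * conj (σ (L v Z)) =
      v * (I * conj (σ Z) - conj (σ (deformation hF a Z))) := by
    intro v Z
    have hc := (hform σ Z).add ((hasFDerivAt_id (𝕜 := ℝ) a).mul (hconj Z))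
    have hr := ((hasFDerivAt_id (𝕜 := ℝ) a).mul_const (conj (σ Z))).const_add (σ Z) |>.const_mul I
    have he : (fun b => I * (σ Z + id b * conj (σ Z))) =ᶠ[nhds a]
        (fun b => σ (deformation hF b Z)) + (id * fun b => conj (σ (deformation hF b Z))) := by
      filter_upwards [hnhds] with b hb
      exact (σ_deformation hF hb Z).symm
    have := congrArg (fun T : ℂ →L[ℝ] ℂ => T v) ((hc.congr_of_eventuallyEq he).unique hr)
    simp [conjForm_apply] at this
    linear_combination this
  -- Compared on the three `(1,0)`-forms, which separate vectors by `deformation_eq_zero`.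
  have hJL : ∀ v Z, deformation hF a (L v Z) = L (I * v) Z := by
    intro v Z
    rw [← sub_eq_zero]
    refine deformation_eq_zero hF ha ?_ ?_ ?_
    · have e1 := α_deformation hF a (L v Z)
      have e2 := h0 (I * v) Z
      rw [h0] at e1
      simp only [map_sub]
      linear_combination e1 - e2
    · rw [map_sub, β_deformation, h1, h1]
      simp
    · have e1 := σ_deformation hF ha (L v Z)
      have e2 := h2 (I * v) Z
      rw [h2] at e1
      simp only [map_sub]
      linear_combination e1 - e2
  intro ξ η
  have hξ : fderiv ℝ ξ a = 0 := (hasFDerivAt_const _ _).fderiv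
  have hη : fderiv ℝ η a = 0 := (hasFDerivAt_const _ _).fderiv
  have hJξ : fderiv ℝ (totalJ (deformation hF) ξ) a = _ := (hconst X).fderiv
  have hJη : fderiv ℝ (totalJ (deformation hF) η) a = _ := (hconst Y).fderiv
  have hb1 : totalBracket ξ η a = (⁅X.1, Y.1⁆, 0) := by
    simp [totalBracket, hξ, hη, ξ, η]
  have hb2 : totalBracket (totalJ (deformation hF) ξ) η a =
      (-L Y.2 X.1 + ⁅deformation hF a X.1, Y.1⁆, 0) := by
    rw [totalBracket, hJξ, hη]
    simp [totalJ, ξ, η]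
  have hb3 : totalBracket ξ (totalJ (deformation hF) η) a =
      (L X.2 Y.1 + ⁅X.1, deformation hF a Y.1⁆, 0) := by
    rw [totalBracket, hJη, hξ]
    simp [totalJ, ξ, η]
  have hb4 : totalBracket (totalJ (deformation hF) ξ) (totalJ (deformation hF) η) a =
      (L (I * X.2) Y.1 - L (I * Y.2) X.1 + ⁅deformation hF a X.1, deformation hF a Y.1⁆, 0) := by
    rw [totalBracket, hJη, hJξ]
    simp [totalJ, ξ, η]
  rw [hb1, hb4, totalJ, totalJ, hb2, hb3]
  refine Prod.ext ?_ (by simp)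
  have := hN X.1 Y.1
  simp only [Prod.fst_add, Prod.fst_sub, Prod.fst_zero, map_add, map_neg, hJL]
  rw [← this]
  abel

/-- Here `α - σ/(4a) = (α + σ̄/4) - (σ + a σ̄)/(4a)` is a combination of `(1,0)`-forms: the term
`σ̄` can be removed as long as `a ≠ 0`. -/
theorem α_sub_deformation (hF : IsComplexFrame α β σ) {a : ℂ} (ha : a ∈ Metric.ball (0 : ℂ) 1)
    (ha0 : a ≠ 0) (X : g8) :
    α (deformation hF a X) - σ (deformation hF a X) / (4 * a) = I * (α X - σ X / (4 * a)) := by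
  have h0 := α_deformation hF a X
  have h2 := σ_deformation hF ha X
  field_simp
  linear_combination (4 * a) * h0 - h2

theorem familySiv3_deformation (hF : IsComplexFrame α β σ) {a : ℂ}
    (ha : a ∈ Metric.ball (0 : ℂ) 1) (ha0 : a ≠ 0) : FamilySiv3 (deformation hF a) := by
  have hk := one_sub_mul_conj_ne_zero ha
  obtain ⟨k, hkc, hkk⟩ : ∃ k : ℂ, conj k = k ∧ k * (1 - a * conj a) = 1 :=
    ⟨(1 - a * conj a)⁻¹, by simp [mul_comm], inv_mul_cancel₀ hk⟩
  have hac : conj a ≠ 0 := by simpa using ha0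
  have hk0 : k ≠ 0 := by
    rintro rfl
    simp at hkk
  -- The factor `ā k`, with `k = 1/(1 - |a|²)`, is chosen so that `σ = φ³/ā - φ̄³`, the substitution
  -- defining Family (Siv3) with `A = 1/ā`.
  let φ : Fin 3 → g8 →ₗ[ℝ] ℂ :=
    ![α - (4 * a)⁻¹ • σ, β, (conj a * k) • (σ + a • conjForm σ)]
  have e0 : ∀ X, φ 0 X = α X - σ X / (4 * a) := fun X => by
    simp [φ]; ring
  have e1 : ∀ X, φ 1 X = β X := fun X => rfl
  have e2 : ∀ X, φ 2 X = conj a * k * (σ X + a * conj (σ X)) := fun X => rfl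
  have hφJ : ∀ i X, φ i (deformation hF a X) = I * φ i X := by
    intro i X
    fin_cases i
    · exact (e0 _).trans ((α_sub_deformation hF ha ha0 X).trans (by rw [← e0]; rfl))
    · exact β_deformation hF a X
    · change conj a * k * _ = I * (conj a * k * _)
      rw [LinearMap.add_apply, LinearMap.smul_apply, conjForm_apply, smul_eq_mul,
        σ_deformation hF ha]
      simp only [LinearMap.add_apply, LinearMap.smul_apply, conjForm_apply, smul_eq_mul]
      ring
  have hσ : ∀ X, σ X = (conj a)⁻¹ * φ 2 X - conj (φ 2 X) := by
    intro X
    rw [e2]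
    simp only [map_add, map_mul, conj_conj, hkc]
    field_simp
    linear_combination (-σ X) * hkk
  have hli : LinearIndependent ℂ φ := by
    refine linearIndependent_of_forall_eq_zero fun X hX => ?_
    have hz : σ X = 0 := by rw [hσ, hX 2]; simp
    have h0 := (e0 X).symm.trans (hX 0)
    exact hF.eq_zero X (by simpa [hz] using h0) (hX 1) hz
  have hbr : ∀ X Y, σ ⁅X, Y⁆ = 0 := fun X Y => by simpa [invD] using hF.d_σ X Y
  refine ⟨(conj a)⁻¹, isComplexStructure_deformation hF ha, ?_, φ, ⟨hφJ, hli⟩, fun X Y =>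
    ⟨?_, ?_, ?_⟩⟩
  · rw [norm_inv, norm_conj]
    rw [mem_ball_zero_iff] at ha
    intro h
    rw [inv_eq_one] at h
    exact absurd h ha.ne
  · have h : invD (φ 0) X Y = wedge α σ X Y := by
      rw [← hF.d_α]
      simp [invD, e0, hbr]
    have hw : wedge α σ X Y = wedge (φ 0) σ X Y := by
      simp only [wedge, e0]
      ring
    rw [h, hw]
    simp only [wedge, wedgeBar, hσ]
    ring
  · rw [show invD (φ 1) X Y = -wedge (φ 1) σ X Y from hF.d_β X Y]
    simp only [wedge, wedgeBar, hσ]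
    ring
  · simp [invD, e2, hbr]

theorem familySiv2_deformation (hF : IsComplexFrame α β σ) : FamilySiv2 (deformation hF 0) := by
  have ha : (0 : ℂ) ∈ Metric.ball (0 : ℂ) 1 := by simp
  -- With `σ = 2√-1 φ³`, the summand `-σ̄/4` of `α` contributes `-(σ̄ ∧ σ)/4 = φ^{33̄}` to `α ∧ σ`;
  -- this fixes the constant `1/4`. The parameter is `x = 0`.
  let φ : Fin 3 → g8 →ₗ[ℝ] ℂ :=
    ![α + (1 / 4 : ℂ) • conjForm σ, β, (-I / 2) • σ]
  have e0 : ∀ X, φ 0 X = α X + conj (σ X) / 4 := fun X => by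
    simp [φ, conjForm_apply]; ring
  have e1 : ∀ X, φ 1 X = β X := fun X => rfl
  have e2 : ∀ X, φ 2 X = (-I / 2) * σ X := fun X => rfl
  have hσ2 := σ_deformation hF ha
  simp only [zero_mul, add_zero] at hσ2
  have hφJ : ∀ i X, φ i (deformation hF 0 X) = I * φ i X := by
    intro i X
    fin_cases i
    · exact (e0 _).trans ((α_deformation hF 0 X).trans (by rw [← e0]; rfl))
    · exact β_deformation hF 0 X
    · change (-I / 2) * σ _ = I * ((-I / 2) * σ X)
      rw [hσ2]
      ring
  have hσ : ∀ X, σ X = 2 * I * φ 2 X := by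
    intro X
    rw [e2]
    linear_combination (σ X) * I_mul_I
  have hbr : ∀ X Y, σ ⁅X, Y⁆ = 0 := fun X Y => by simpa [invD] using hF.d_σ X Y
  refine ⟨isComplexStructure_deformation hF ha, 0, φ, Or.inl rfl, ⟨hφJ, ?_⟩, fun X Y =>
    ⟨?_, ?_, ?_⟩⟩
  · refine linearIndependent_of_forall_eq_zero fun X hX => ?_
    have hz : σ X = 0 := by rw [hσ, hX 2]; simp
    have h0 := (e0 X).symm.trans (hX 0)
    exact hF.eq_zero X (by simpa [hz] using h0) (hX 1) hz
  · have h : invD (φ 0) X Y = wedge α σ X Y := by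
      rw [← hF.d_α]
      simp [invD, e0, hbr]
    have hα : ∀ X, α X = φ 0 X - conj (2 * I * φ 2 X) / 4 := by
      intro X
      rw [← hσ, e0]
      ring
    rw [h]
    simp only [wedge, wedgeBar, hσ, hα, map_mul, conj_I, map_ofNat]
    ring_nf
    simp only [I_sq]
    ring
  · rw [show invD (φ 1) X Y = -wedge (φ 1) σ X Y from hF.d_β X Y]
    simp only [wedge, wedgeBar, hσ, ofReal_zero]
    ring
  · simp [invD, e2, hbr]

/-- A complex structure of Family (Siv3) with `|A| > 1` degenerates to Family (Siv2). -/
theorem exists_degeneration {A : ℂ} {J₁ : g8 →L[ℝ] g8} (hA : 1 < ‖A‖) (hJ₁ : FamilySiv3With A J₁) :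
    ∃ J : ℂ → g8 →L[ℝ] g8, IsHolomorphicFamily J ∧
      (∃ a ∈ Metric.ball (0 : ℂ) 1, a ≠ 0 ∧ J a = J₁) ∧
      (∀ a ∈ Metric.ball (0 : ℂ) 1, a ≠ 0 → FamilySiv3 (J a)) ∧ FamilySiv2 (J 0) := by
  obtain ⟨-, -, φ, hφ, hd⟩ := hJ₁
  have hA0 : A ≠ 0 := norm_pos_iff.mp (zero_lt_one.trans hA)
  have hAc : conj A ≠ 0 := by simpa using hA0
  -- Inverse to `A = 1/ā`; the condition `|A| > 1` places `a` in the disc. The forms `σ` and `α`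
  -- below undo the normalisations of `familySiv3_deformation`.
  set a : ℂ := (conj A)⁻¹ with ha_def
  have ha0 : a ≠ 0 := inv_ne_zero hAc
  have ha : a ∈ Metric.ball (0 : ℂ) 1 := by
    rw [mem_ball_zero_iff, ha_def, norm_inv, norm_conj]
    exact inv_lt_one_of_one_lt₀ hA
  have hca : conj a = A⁻¹ := by rw [ha_def, map_inv₀, conj_conj]
  let σ : g8 →ₗ[ℝ] ℂ := A • φ 2 - conjForm (φ 2)
  have hσ : ∀ X, σ X = A * φ 2 X - conj (φ 2 X) := fun _ => rfl
  let α : g8 →ₗ[ℝ] ℂ := φ 0 + (4 * a)⁻¹ • σ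
  have hα : ∀ X, α X = φ 0 X + (4 * a)⁻¹ * σ X := fun _ => rfl
  have hφσ : ∀ X, σ X + a * conj (σ X) = (A - a) * φ 2 X := by
    intro X
    rw [hσ]
    simp only [map_sub, map_mul, conj_conj]
    rw [ha_def]
    field_simp
    ring
  have hAa : A - a ≠ 0 := by
    intro h
    rw [mem_ball_zero_iff, ← sub_eq_zero.mp h] at ha
    exact absurd ha hA.le.not_gt
  have hbr : ∀ X Y : g8, φ 2 ⁅X, Y⁆ = 0 := fun X Y => by simpa [invD] using (hd X Y).2.2
  have hbrσ : ∀ X Y : g8, σ ⁅X, Y⁆ = 0 := fun X Y => by simp [hσ, hbr]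
  have hF : IsComplexFrame α (φ 1) σ := by
    refine ⟨fun X h0 h1 h2 => ?_, fun X Y => ?_, fun X Y => ?_, fun X Y => ?_⟩
    · refine hφ.eq_zero X fun i => ?_
      fin_cases i
      · simpa [hα, h2] using h0
      · exact h1
      · have := hφσ X
        rw [h2] at this
        simpa [hAa] using this
    · have h : invD α X Y = invD (φ 0) X Y := by simp [invD, hα, hbrσ]
      rw [h, (hd X Y).1]
      simp only [wedge, wedgeBar, hα, hσ]
      ring
    · rw [(hd X Y).2.1]
      simp only [wedge, wedgeBar, hσ]
      ring
    · simp [invD, hbrσ]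
  refine ⟨deformation hF, isHolomorphicFamily_deformation hF, ⟨a, ha, ha0, ?_⟩,
    fun b hb hb0 => familySiv3_deformation hF hb hb0, familySiv2_deformation hF⟩
  ext1 X
  rw [← sub_eq_zero]
  refine hφ.eq_zero _ fun i => ?_
  rw [map_sub, hφ.1, sub_eq_zero]
  fin_cases i
  · have h := α_sub_deformation hF ha ha0 X
    simp only [hα] at h
    simp only [Fin.zero_eta]
    linear_combination h
  · exact β_deformation hF a X
  · have h := σ_deformation hF ha X
    rw [hφσ, hφσ] at h
    simp only [Fin.reduceFinMk]
    apply mul_left_cancel₀ hAa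
    linear_combination h

end Deformation

/-! ### Smooth fields on the quotient and their bounds. -/

section SmoothFields

variable {V W : Type*} [NormedAddCommGroup V] [NormedSpace ℝ V]
  [NormedAddCommGroup W] [NormedSpace ℝ W] {Γ : Subgroup G8}

/-- Left-invariance at an arbitrary point, which makes `lieD` preserve invariance under `Γ`. -/
theorem hasFDerivAt_mul_left_of_point (γ p : G8) : ∃ L : G8 →L[ℝ] G8,
    HasFDerivAt (fun q => γ * q) L p ∧ ∀ X : g8, L (G8.leftField X p) = G8.leftField X (γ * p) := by
  have hu : HasFDerivAt (fun q : G8 => q.u) (ContinuousLinearMap.fst ℝ ℂ (ℂ × ℂ) : G8 →L[ℝ] ℂ) p :=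
    (ContinuousLinearMap.fst ℝ ℂ (ℂ × ℂ) : G8 →L[ℝ] ℂ).hasFDerivAt
  have hv : HasFDerivAt (fun q : G8 => q.v) ((ContinuousLinearMap.fst ℝ ℂ ℂ).comp
      (ContinuousLinearMap.snd ℝ ℂ (ℂ × ℂ)) : G8 →L[ℝ] ℂ) p :=
    ((ContinuousLinearMap.fst ℝ ℂ ℂ).comp
      (ContinuousLinearMap.snd ℝ ℂ (ℂ × ℂ)) : G8 →L[ℝ] ℂ).hasFDerivAt
  have hs : HasFDerivAt (fun q : G8 => q.s) G8.sL p := G8.sL.hasFDerivAt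
  obtain ⟨L, hL, hL'⟩ := G8.hasFDerivAt_mk ((hu.const_mul (Complex.exp γ.s)).const_add γ.u)
    ((hv.const_mul (Complex.exp (-γ.s))).const_add γ.v) (hs.const_add γ.s)
  refine ⟨L, hL, fun X => ?_⟩
  rw [hL']
  refine G8.ext ?_ ?_ rfl
  · change Complex.exp γ.s * (Complex.exp p.s * _) = Complex.exp (γ.s + p.s) * _
    rw [Complex.exp_add, mul_assoc]
  · change Complex.exp (-γ.s) * (Complex.exp (-p.s) * _) = Complex.exp (-(γ.s + p.s)) * _
    rw [neg_add, Complex.exp_add, mul_assoc]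

theorem contDiff_leftField (X : g8) : ContDiff ℝ ∞ (G8.leftField X) := by
  have hs : ContDiff ℝ ∞ (fun q : G8 => q.s) := G8.sL.contDiff
  exact ((hs.cexp).mul contDiff_const).prodMk (((hs.neg.cexp).mul contDiff_const).prodMk
    contDiff_const)

theorem IsSmoothField.lieD {f : G8 → V} (hf : IsSmoothField Γ f) (X : g8) :
    IsSmoothField Γ (lieD X f) := by
  refine ⟨(hf.1.fderiv_right (m := ∞) (by simp)).clm_apply (contDiff_leftField X), fun γ hγ p => ?_⟩
  obtain ⟨L, hL, hLX⟩ := hasFDerivAt_mul_left_of_point γ p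
  have hd : ∀ q, DifferentiableAt ℝ f q := fun q => hf.1.differentiable (by simp) q
  have h1 : HasFDerivAt (fun q => f (γ * q)) ((fderiv ℝ f (γ * p)).comp L) p :=
    (hd (γ * p)).hasFDerivAt.comp p hL
  have h2 : (fun q => f (γ * q)) = f := funext fun q => hf.2 γ hγ q
  rw [h2] at h1
  rw [_root_.lieD, _root_.lieD, ← hLX, h1.fderiv]
  rfl

theorem IsSmoothField.differentiableAt {f : G8 → V} (hf : IsSmoothField Γ f) (p : G8) :
    DifferentiableAt ℝ f p := hf.1.differentiable (by simp) p

theorem IsSmoothField.clm {f : G8 → V} (hf : IsSmoothField Γ f) (L : V →L[ℝ] W) :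
    IsSmoothField Γ (fun p => L (f p)) :=
  ⟨L.contDiff.comp hf.1, fun γ hγ p => by simp only [hf.2 γ hγ]⟩

theorem IsSmoothField.clm_apply {f : G8 → V →L[ℝ] W} {g : G8 → V} (hf : IsSmoothField Γ f)
    (hg : IsSmoothField Γ g) : IsSmoothField Γ (fun p => f p (g p)) :=
  ⟨hf.1.clm_apply hg.1, fun γ hγ p => by simp only [hf.2 γ hγ, hg.2 γ hγ]⟩

theorem IsSmoothField.add {f g : G8 → V} (hf : IsSmoothField Γ f) (hg : IsSmoothField Γ g) :
    IsSmoothField Γ (fun p => f p + g p) :=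
  ⟨hf.1.add hg.1, fun γ hγ p => by simp only [hf.2 γ hγ, hg.2 γ hγ]⟩

theorem IsSmoothField.sub {f g : G8 → V} (hf : IsSmoothField Γ f) (hg : IsSmoothField Γ g) :
    IsSmoothField Γ (fun p => f p - g p) :=
  ⟨hf.1.sub hg.1, fun γ hγ p => by simp only [hf.2 γ hγ, hg.2 γ hγ]⟩

theorem IsSmoothField.neg {f : G8 → V} (hf : IsSmoothField Γ f) :
    IsSmoothField Γ (fun p => -f p) :=
  ⟨hf.1.neg, fun γ hγ p => by simp only [hf.2 γ hγ]⟩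

theorem IsSmoothField.mul {f g : G8 → ℝ} (hf : IsSmoothField Γ f) (hg : IsSmoothField Γ g) :
    IsSmoothField Γ (fun p => f p * g p) :=
  ⟨hf.1.mul hg.1, fun γ hγ p => by simp only [hf.2 γ hγ, hg.2 γ hγ]⟩

theorem IsSmoothField.sum {ι : Type*} {s : Finset ι} {f : ι → G8 → V}
    (hf : ∀ i ∈ s, IsSmoothField Γ (f i)) : IsSmoothField Γ (fun p => ∑ i ∈ s, f i p) :=
  ⟨ContDiff.sum fun i hi => (hf i hi).1, fun γ hγ p =>
    Finset.sum_congr rfl fun i hi => (hf i hi).2 γ hγ p⟩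

/-- A smooth function on a compact quotient is bounded. -/
theorem IsSmoothField.exists_bound {f : G8 → ℝ} (hf : IsSmoothField Γ f)
    (hΓ : CompactSpace (Quotient (QuotientGroup.rightRel Γ))) : ∃ C, ∀ p, |f p| ≤ C := by
  let F : Quotient (QuotientGroup.rightRel Γ) → ℝ := Quotient.lift f (fun a b hab => by
    have h : b * a⁻¹ ∈ Γ := QuotientGroup.rightRel_apply.mp hab
    have := hf.2 _ h a
    rwa [inv_mul_cancel_right, eq_comm] at this)
  have hF : Continuous F := hf.1.continuous.quotient_lift _
  obtain ⟨C, hC⟩ := isCompact_univ.exists_bound_of_continuousOn hF.continuousOn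
  exact ⟨C, fun p => hC (Quotient.mk _ p) trivial⟩

/-- Boundedness applied to the reciprocal. -/
theorem IsSmoothField.exists_pos_lower_bound {f : G8 → ℝ} (hf : IsSmoothField Γ f)
    (hΓ : CompactSpace (Quotient (QuotientGroup.rightRel Γ))) (h0 : ∀ p, 0 < f p) :
    ∃ c, 0 < c ∧ ∀ p, c ≤ f p := by
  have hinv : IsSmoothField Γ (fun p => (f p)⁻¹) :=
    ⟨hf.1.inv fun p => (h0 p).ne', fun γ hγ p => by simp only [hf.2 γ hγ]⟩
  obtain ⟨C, hC⟩ := hinv.exists_bound hΓ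
  have hC0 : 0 < C := (inv_pos.mpr (h0 1)).trans_le ((le_abs_self _).trans (hC 1))
  exact ⟨C⁻¹, inv_pos.mpr hC0, fun p =>
    inv_le_of_inv_le₀ (h0 p) ((le_abs_self _).trans (hC p))⟩

end SmoothFields

/-! ### Lebesgue measure on the group. -/

namespace G8

instance : FiniteDimensional ℝ G8 := inferInstanceAs (FiniteDimensional ℝ (ℂ × ℂ × ℂ))

instance : MeasurableSpace G8 := inferInstanceAs (MeasurableSpace (ℂ × ℂ × ℂ))

instance : BorelSpace G8 := inferInstanceAs (BorelSpace (ℂ × ℂ × ℂ))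

noncomputable instance : MeasureTheory.MeasureSpace G8 :=
  inferInstanceAs (MeasureTheory.MeasureSpace (ℂ × ℂ × ℂ))

instance : (MeasureTheory.volume : MeasureTheory.Measure G8).IsAddHaarMeasure :=
  have : (MeasureTheory.volume : MeasureTheory.Measure (ℂ × ℂ)).IsAddHaarMeasure :=
    MeasureTheory.Measure.prod.instIsAddHaarMeasure MeasureTheory.volume MeasureTheory.volume
  MeasureTheory.Measure.prod.instIsAddHaarMeasure
    (MeasureTheory.volume : MeasureTheory.Measure ℂ)
    (MeasureTheory.volume : MeasureTheory.Measure (ℂ × ℂ))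

theorem finrank_eq : Module.finrank ℝ G8 = 6 := by
  change Module.finrank ℝ (ℂ × ℂ × ℂ) = 6
  simp

/-- The coordinate `u` as a continuous linear map. -/
noncomputable def uL : G8 →L[ℝ] ℂ := ContinuousLinearMap.fst ℝ ℂ (ℂ × ℂ)

/-- The coordinate `v` as a continuous linear map. -/
noncomputable def vL : G8 →L[ℝ] ℂ :=
  (ContinuousLinearMap.fst ℝ ℂ ℂ).comp (ContinuousLinearMap.snd ℝ ℂ (ℂ × ℂ))

end G8

/-! ### Integration by parts along left-invariant fields. -/

section Stokes

open MeasureTheory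

theorem integral_mul_fderiv_eq_zero {F c : G8 → ℝ} {E : G8} (hF : ContDiff ℝ 1 F)
    (hFc : HasCompactSupport F) (hc : ContDiff ℝ 1 c) (hcE : ∀ p, fderiv ℝ c p E = 0) :
    ∫ p, c p * fderiv ℝ F p E = 0 := by
  have hcont : Continuous fun p => fderiv ℝ F p E :=
    (hF.continuous_fderiv (by simp)).clm_apply continuous_const
  have hsupp : HasCompactSupport fun p => fderiv ℝ F p E := hFc.fderiv_apply (𝕜 := ℝ) E
  rw [integral_mul_fderiv_eq_neg_fderiv_mul_of_integrable]
  · simp [hcE]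
  · simp [hcE]
  · exact (hc.continuous.mul hcont).integrable_of_hasCompactSupport hsupp.mul_left
  · exact (hc.continuous.mul hF.continuous).integrable_of_hasCompactSupport hFc.mul_left
  · exact fun p _ => hc.differentiable (by simp) p
  · exact fun p _ => hF.differentiable (by simp) p

/-- The coefficients of left-invariant fields depend on `s` alone and those that vary multiply
derivatives in `u` and `v`, so integrating by parts never differentiates a coefficient. -/
theorem integral_mul_fderiv_eq_zero_of_s {F : G8 → ℝ} {h : ℂ → ℝ} {E : G8} (hF : ContDiff ℝ 1 F)
    (hFc : HasCompactSupport F) (hh : ContDiff ℝ 1 h) (hE : E.s = 0) :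
    Integrable (fun p : G8 => h p.s * fderiv ℝ F p E) ∧ ∫ p : G8, h p.s * fderiv ℝ F p E = 0 := by
  have hc : ContDiff ℝ 1 (fun p : G8 => h p.s) := hh.comp G8.sL.contDiff
  constructor
  · have hcont : Continuous fun p => fderiv ℝ F p E :=
      (hF.continuous_fderiv (by simp)).clm_apply continuous_const
    exact (hc.continuous.mul hcont).integrable_of_hasCompactSupport
      (hFc.fderiv_apply (𝕜 := ℝ) E).mul_left
  · refine integral_mul_fderiv_eq_zero hF hFc hc fun p => ?_
    have : HasFDerivAt (fun p : G8 => h p.s) ((fderiv ℝ h p.s).comp G8.sL) p :=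
      (hh.differentiable (by simp) p.s).hasFDerivAt.comp p G8.sL.hasFDerivAt
    rw [this.fderiv]
    change fderiv ℝ h p.s E.s = 0
    rw [hE, map_zero]

/-- The left-invariant vector fields are divergence-free. -/
theorem integral_lieD_eq_zero {F : G8 → ℝ} (hF : ContDiff ℝ 1 F) (hFc : HasCompactSupport F)
    (X : g8) : ∫ p, lieD X F p = 0 := by
  have hexp : ∀ z : ℂ, ContDiff ℝ 1 (fun s : ℂ => Complex.exp s * z) ∧
      ContDiff ℝ 1 (fun s : ℂ => Complex.exp (-s) * z) := fun z =>
    ⟨contDiff_id.cexp.mul contDiff_const, contDiff_id.neg.cexp.mul contDiff_const⟩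
  have hre : ∀ {k : ℂ → ℂ}, ContDiff ℝ 1 k → ContDiff ℝ 1 fun s => (k s).re :=
    fun hk => Complex.reCLM.contDiff.comp hk
  have him : ∀ {k : ℂ → ℂ}, ContDiff ℝ 1 k → ContDiff ℝ 1 fun s => (k s).im :=
    fun hk => Complex.imCLM.contDiff.comp hk
  obtain ⟨i1, z1⟩ := integral_mul_fderiv_eq_zero_of_s (E := G8.mk 1 0 0) hF hFc
    (hre (hexp ⟨X.co 0, X.co 1⟩).1) rfl
  obtain ⟨i2, z2⟩ := integral_mul_fderiv_eq_zero_of_s (E := G8.mk Complex.I 0 0) hF hFc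
    (him (hexp ⟨X.co 0, X.co 1⟩).1) rfl
  obtain ⟨i3, z3⟩ := integral_mul_fderiv_eq_zero_of_s (E := G8.mk 0 1 0) hF hFc
    (hre (hexp ⟨X.co 2, X.co 3⟩).2) rfl
  obtain ⟨i4, z4⟩ := integral_mul_fderiv_eq_zero_of_s (E := G8.mk 0 Complex.I 0) hF hFc
    (him (hexp ⟨X.co 2, X.co 3⟩).2) rfl
  have z5 := integral_mul_fderiv_eq_zero (c := fun _ => 1) (E := G8.mk 0 0 ⟨X.co 5, X.co 4⟩) hF hFc
    contDiff_const (by simp)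
  have i5 : Integrable fun p => 1 * fderiv ℝ F p (G8.mk 0 0 ⟨X.co 5, X.co 4⟩) := by
    simp only [one_mul]
    exact ((hF.continuous_fderiv (by simp)).clm_apply
      continuous_const).integrable_of_hasCompactSupport (hFc.fderiv_apply (𝕜 := ℝ) _)
  have key : ∀ p, lieD X F p =
      ((Complex.exp p.s * ⟨X.co 0, X.co 1⟩).re * fderiv ℝ F p (G8.mk 1 0 0) +
      (Complex.exp p.s * ⟨X.co 0, X.co 1⟩).im * fderiv ℝ F p (G8.mk Complex.I 0 0)) +
      ((Complex.exp (-p.s) * ⟨X.co 2, X.co 3⟩).re * fderiv ℝ F p (G8.mk 0 1 0) +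
      (Complex.exp (-p.s) * ⟨X.co 2, X.co 3⟩).im * fderiv ℝ F p (G8.mk 0 Complex.I 0)) +
      1 * fderiv ℝ F p (G8.mk 0 0 ⟨X.co 5, X.co 4⟩) := by
    intro p
    simp only [lieD, ← smul_eq_mul, ← map_smul, ← map_add]
    congr 1
    have hz : ∀ z : ℂ, z = z.re • (1 : ℂ) + z.im • Complex.I := fun z => by
      apply Complex.ext <;> simp
    refine G8.ext ?_ ?_ ?_
    · change Complex.exp p.s * ⟨X.co 0, X.co 1⟩ =
        _ • (1 : ℂ) + _ • Complex.I + (_ • (0 : ℂ) + _ • (0 : ℂ)) + (1 : ℝ) • (0 : ℂ)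
      rw [smul_zero, smul_zero, smul_zero, add_zero, add_zero, add_zero]
      exact hz _
    · change Complex.exp (-p.s) * ⟨X.co 2, X.co 3⟩ =
        _ • (0 : ℂ) + _ • (0 : ℂ) + (_ • (1 : ℂ) + _ • Complex.I) + (1 : ℝ) • (0 : ℂ)
      rw [smul_zero, smul_zero, smul_zero, add_zero, add_zero, zero_add]
      exact hz _
    · change (⟨X.co 5, X.co 4⟩ : ℂ) = _ • (0 : ℂ) + _ • (0 : ℂ) + (_ • (0 : ℂ) + _ • (0 : ℂ)) +
        (1 : ℝ) • (⟨X.co 5, X.co 4⟩ : ℂ)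
      simp
  simp only [key]
  have hadd : ∀ {f g : G8 → ℝ}, Integrable f ∧ ∫ p, f p = 0 → Integrable g ∧ ∫ p, g p = 0 →
      Integrable (fun p => f p + g p) ∧ ∫ p, (f p + g p) = 0 := fun hf hg =>
    ⟨hf.1.add hg.1, by rw [integral_add hf.1 hg.1, hf.2, hg.2, add_zero]⟩
  exact (hadd (hadd (hadd ⟨i1, z1⟩ ⟨i2, z2⟩) (hadd ⟨i3, z3⟩ ⟨i4, z4⟩)) ⟨i5, z5⟩).2

theorem lieD_mul {f g : G8 → ℝ} {p : G8} (X : g8) (hf : DifferentiableAt ℝ f p)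
    (hg : DifferentiableAt ℝ g p) :
    lieD X (fun q => f q * g q) p = f p * lieD X g p + g p * lieD X f p := by
  simp only [lieD]
  rw [fderiv_fun_mul hf hg]
  simp

theorem lieD_continuous {f : G8 → ℝ} (hf : ContDiff ℝ 1 f) (X : g8) : Continuous (lieD X f) :=
  (hf.continuous_fderiv (by simp)).clm_apply (contDiff_leftField X).continuous

theorem lieD_hasCompactSupport {f : G8 → ℝ} (hf : HasCompactSupport f) (X : g8) :
    HasCompactSupport (lieD X f) := by
  refine (hf.fderiv (𝕜 := ℝ)).mono fun p hp => ?_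
  rw [Function.mem_support] at hp ⊢
  intro h
  exact hp (by rw [lieD, h]; rfl)

theorem integral_mul_lieD {ψ f : G8 → ℝ} (hψ : ContDiff ℝ 1 ψ) (hψc : HasCompactSupport ψ)
    (hf : ContDiff ℝ 1 f) (X : g8) : ∫ p, ψ p * lieD X f p = -∫ p, lieD X ψ p * f p := by
  have h := integral_lieD_eq_zero (hψ.mul hf) hψc.mul_right X
  have h' : ∀ p, lieD X (fun q => ψ q * f q) p = ψ p * lieD X f p + lieD X ψ p * f p := fun p => by
    rw [lieD_mul X (hψ.differentiable (by simp) p) (hf.differentiable (by simp) p),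
      mul_comm (f p)]
  change ∫ p, lieD X (fun q => ψ q * f q) p = 0 at h
  simp only [h'] at h
  have i1 : Integrable (fun p => ψ p * lieD X f p) :=
    (hψ.continuous.mul (lieD_continuous hf X)).integrable_of_hasCompactSupport hψc.mul_right
  have i2 : Integrable (fun p => lieD X ψ p * f p) :=
    ((lieD_continuous hψ X).mul hf.continuous).integrable_of_hasCompactSupport
      (lieD_hasCompactSupport hψc X).mul_right
  rw [integral_add i1 i2] at h
  linarith

end Stokes

/-! ### Følner functions and positivity of divergences. -/

section Foelner

open MeasureTheory

/-- The product cut-off function `χ(δu) χ(δv) χ(ηs)`. -/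
noncomputable def cutoff (χ : ContDiffBump (0 : ℂ)) (δ η : ℝ) (p : G8) : ℝ :=
  χ (δ • p.u) * (χ (δ • p.v) * χ (η • p.s))

/-- The box `{|δu| ≤ r, |δv| ≤ r, |ηs| ≤ r}`. -/
def cutoffBox (δ η r : ℝ) : Set G8 := {p | ‖δ • p.u‖ ≤ r ∧ ‖δ • p.v‖ ≤ r ∧ ‖η • p.s‖ ≤ r}

theorem isCompact_cutoffBox {δ η : ℝ} (hδ : 0 < δ) (hη : 0 < η) (r : ℝ) :
    IsCompact (cutoffBox δ η r) := by
  have h1 : IsClosed (cutoffBox δ η r) :=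
    (isClosed_le ((G8.uL.continuous.const_smul δ).norm) continuous_const).inter
      ((isClosed_le ((G8.vL.continuous.const_smul δ).norm) continuous_const).inter
        (isClosed_le ((G8.sL.continuous.const_smul η).norm) continuous_const))
  refine Metric.isCompact_of_isClosed_isBounded h1 ?_
  refine (Metric.isBounded_closedBall (x := (0 : G8)) (r := max (r / δ) (r / η))).subset ?_
  rintro p ⟨hu, hv, hs⟩
  rw [norm_smul, Real.norm_of_nonneg hδ.le] at hu hv
  rw [norm_smul, Real.norm_of_nonneg hη.le] at hs
  rw [← le_div_iff₀' hδ] at hu hv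
  rw [← le_div_iff₀' hη] at hs
  rw [mem_closedBall_zero_iff]
  exact max_le (hu.trans (le_max_left _ _)) (max_le (hv.trans (le_max_left _ _))
    (hs.trans (le_max_right _ _)))

theorem contDiff_cutoff (χ : ContDiffBump (0 : ℂ)) (δ η : ℝ) : ContDiff ℝ 1 (cutoff χ δ η) :=
  (χ.contDiff.comp (G8.uL.contDiff.const_smul δ)).mul
    ((χ.contDiff.comp (G8.vL.contDiff.const_smul δ)).mul
      (χ.contDiff.comp (G8.sL.contDiff.const_smul η)))

theorem cutoff_nonneg (χ : ContDiffBump (0 : ℂ)) (δ η : ℝ) (p : G8) : 0 ≤ cutoff χ δ η p :=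
  mul_nonneg χ.nonneg (mul_nonneg χ.nonneg χ.nonneg)

theorem tsupport_cutoff_subset (χ : ContDiffBump (0 : ℂ)) {δ η : ℝ} (hδ : 0 < δ) (hη : 0 < η) :
    tsupport (cutoff χ δ η) ⊆ cutoffBox δ η χ.rOut := by
  refine closure_minimal (fun p hp => ?_) (isCompact_cutoffBox hδ hη _).isClosed
  rw [Function.mem_support] at hp
  have h : ∀ z : ℂ, χ z ≠ 0 → ‖z‖ ≤ χ.rOut := by
    intro z hz
    by_contra hlt
    exact hz (χ.zero_of_le_dist (by simpa using (not_le.mp hlt).le))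
  exact ⟨h _ fun h0 => hp (by rw [cutoff, h0]; simp), h _ fun h0 => hp (by rw [cutoff, h0]; simp),
    h _ fun h0 => hp (by rw [cutoff, h0]; simp)⟩

theorem hasCompactSupport_cutoff (χ : ContDiffBump (0 : ℂ)) {δ η : ℝ} (hδ : 0 < δ) (hη : 0 < η) :
    HasCompactSupport (cutoff χ δ η) :=
  (isCompact_cutoffBox hδ hη _).of_isClosed_subset (isClosed_tsupport _)
    (tsupport_cutoff_subset χ hδ hη)

theorem lieD_cutoff (χ : ContDiffBump (0 : ℂ)) (δ η : ℝ) (X : g8) (p : G8) :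
    lieD X (cutoff χ δ η) p =
      χ (δ • p.u) * (χ (δ • p.v) * (η * fderiv ℝ χ (η • p.s) (G8.leftField X p).s) +
        χ (η • p.s) * (δ * fderiv ℝ χ (δ • p.v) (G8.leftField X p).v)) +
      χ (δ • p.v) * χ (η • p.s) * (δ * fderiv ℝ χ (δ • p.u) (G8.leftField X p).u) := by
  have hχ : ∀ (L : G8 →L[ℝ] ℂ) (r : ℝ), HasFDerivAt (fun q => χ (r • L q))
      ((fderiv ℝ χ (r • L p)).comp (r • L)) p := fun L r =>
    have hr : HasFDerivAt (fun q => r • L q) (r • L) p := L.hasFDerivAt.const_smul r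
    ((χ.contDiff (n := 1)).differentiable (by simp) (r • L p)).hasFDerivAt.comp
      (f := fun q => r • L q) p hr
  have h := (hχ G8.uL δ).mul ((hχ G8.vL δ).mul (hχ G8.sL η))
  have h' : fderiv ℝ (cutoff χ δ η) p = _ := h.fderiv
  rw [lieD, h']
  simp only [add_apply, smul_apply,
    ContinuousLinearMap.comp_apply, map_smul, smul_eq_mul]
  rfl

/-- The `s`-derivative costs `η`; the `u`- and `v`-derivatives cost `δ` each, times the coefficient
`e^{±s}`, at most `exp (rOut / η)` on the box. The factor 2 in `hM` pays for bounding a complex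
number by the absolute values of its two parts. -/
theorem abs_lieD_cutoff_le (χ : ContDiffBump (0 : ℂ)) {δ η C M : ℝ} (hδ : 0 < δ) (hη : 0 < η)
    (hC : ∀ z, ‖fderiv ℝ χ z‖ ≤ C) {X : g8} (hM : 2 * ‖X‖ ≤ M) (p : G8) :
    |lieD X (cutoff χ δ η) p| ≤ (cutoffBox δ η χ.rOut).indicator
      (fun _ => C * M * (η + 2 * δ * Real.exp (χ.rOut / η))) p := by
  have hC0 : 0 ≤ C := (norm_nonneg _).trans (hC 0)
  have hM0 : 0 ≤ M := (by positivity : 0 ≤ 2 * ‖X‖).trans hM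
  by_cases hp : p ∈ cutoffBox δ η χ.rOut
  · rw [Set.indicator_of_mem hp]
    obtain ⟨-, -, hs⟩ := hp
    rw [norm_smul, Real.norm_of_nonneg hη.le, ← le_div_iff₀' hη] at hs
    have hco : ∀ i j : Fin 6, ‖(⟨X.co i, X.co j⟩ : ℂ)‖ ≤ M := by
      intro i j
      refine (Complex.norm_le_abs_re_add_abs_im _).trans (le_trans ?_ hM)
      have h1 : ∀ i, |X.co i| ≤ ‖X‖ := fun i => norm_le_pi_norm (X : Fin 6 → ℝ) i
      have := h1 i
      have := h1 j
      simp only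
      linarith
    have hexp : ∀ z : ℂ, ‖z‖ ≤ χ.rOut / η → ‖Complex.exp z‖ ≤ Real.exp (χ.rOut / η) := by
      intro z hz
      rw [Complex.norm_exp]
      exact Real.exp_le_exp.mpr ((Complex.re_le_norm z).trans hz)
    have hU : ‖(G8.leftField X p).u‖ ≤ Real.exp (χ.rOut / η) * M := by
      change ‖Complex.exp p.s * _‖ ≤ _
      rw [norm_mul]
      exact mul_le_mul (hexp _ hs) (hco 0 1) (norm_nonneg _) (Real.exp_pos _).le
    have hV : ‖(G8.leftField X p).v‖ ≤ Real.exp (χ.rOut / η) * M := by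
      change ‖Complex.exp (-p.s) * _‖ ≤ _
      rw [norm_mul]
      exact mul_le_mul (hexp _ (by rwa [norm_neg])) (hco 2 3) (norm_nonneg _) (Real.exp_pos _).le
    have hS : ‖(G8.leftField X p).s‖ ≤ M := hco 5 4
    have hd : ∀ (z w : ℂ) (r B : ℝ), 0 ≤ r → ‖w‖ ≤ B → |r * fderiv ℝ χ z w| ≤ r * (C * B) := by
      intro z w r B hr hw
      rw [abs_mul, abs_of_nonneg hr]
      refine mul_le_mul_of_nonneg_left ?_ hr
      exact (ContinuousLinearMap.le_opNorm _ _).trans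
        (mul_le_mul (hC z) hw (norm_nonneg _) hC0)
    have hχ : ∀ z : ℂ, |χ z| ≤ 1 := fun z => by
      rw [abs_of_nonneg χ.nonneg]
      exact χ.le_one
    have hmul : ∀ {a b B : ℝ}, |a| ≤ 1 → |b| ≤ B → |a * b| ≤ B := by
      intro a b B ha hb
      rw [abs_mul]
      exact (mul_le_of_le_one_left (abs_nonneg b) ha).trans hb
    rw [lieD_cutoff]
    have e1 := hmul (hχ (δ • p.u)) ((abs_add_le _ _).trans (add_le_add
      (hmul (hχ (δ • p.v)) (hd (η • p.s) _ η M hη.le hS))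
      (hmul (hχ (η • p.s)) (hd (δ • p.v) _ δ _ hδ.le hV))))
    have e2 := hmul (hmul (hχ (δ • p.v)) (hχ (η • p.s))) (hd (δ • p.u) _ δ _ hδ.le hU)
    refine (abs_add_le _ _).trans ((add_le_add e1 e2).trans_eq ?_)
    ring
  · rw [Set.indicator_of_notMem hp]
    have : fderiv ℝ (cutoff χ δ η) p = 0 :=
      fderiv_of_notMem_tsupport ℝ fun h => hp (tsupport_cutoff_subset χ hδ hη h)
    rw [lieD, this]
    simp

/-- Følner functions: compactly supported functions on the group with arbitrarily small relative
`L¹`-norm of the derivatives along left-invariant fields. -/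
theorem exists_foelner (M : ℝ) {ε : ℝ} (hε : 0 < ε) : ∃ ψ : G8 → ℝ, ContDiff ℝ 1 ψ ∧
    HasCompactSupport ψ ∧ (∀ p, 0 ≤ ψ p) ∧ 0 < ∫ p, ψ p ∧
    ∀ X : g8, 2 * ‖X‖ ≤ M → ∫ p, |lieD X ψ p| ≤ ε * ∫ p, ψ p := by
  let χ : ContDiffBump (0 : ℂ) := ⟨1, 2, one_pos, one_lt_two⟩
  obtain ⟨C, hC⟩ : ∃ C, ∀ z, ‖fderiv ℝ χ z‖ ≤ C :=
    ((χ.contDiff (n := 1)).continuous_fderiv (by simp)).bounded_above_of_compact_support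
      (χ.hasCompactSupport.fderiv (𝕜 := ℝ))
  have hC0 : 0 ≤ C := (norm_nonneg _).trans (hC 0)
  set B := C * |M| + 1 with hB
  have hB0 : 0 < B := by positivity
  -- `192 = 64 · 3`: the ratio of the volumes of the two boxes, times the sum `η + 2 δ e^{2/η} = 3
  -- η` of the three derivative bounds.
  set η := ε / (192 * B) with hη_def
  have hη : 0 < η := by positivity
  -- Boxes far longer in `u`, `v` than in `s`, so that `δ` absorbs the exponential growth of the
  -- left-invariant fields.
  set δ := η * Real.exp (-(2 / η)) with hδ_def
  have hδ : 0 < δ := by positivity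
  have hδe : δ * Real.exp (2 / η) = η := by
    rw [hδ_def, mul_assoc, ← Real.exp_add]
    simp
  have hsupp := hasCompactSupport_cutoff χ hδ hη
  have hcont := (contDiff_cutoff χ δ η).continuous
  have hψint : Integrable (cutoff χ δ η) := hcont.integrable_of_hasCompactSupport hsupp
  have hbox : ∀ r, volume (cutoffBox δ η r) ≠ ⊤ := fun r =>
    (isCompact_cutoffBox hδ hη r).measure_lt_top.ne
  have hboxm : ∀ r, MeasurableSet (cutoffBox δ η r) := fun r =>
    (isCompact_cutoffBox hδ hη r).isClosed.measurableSet
  -- Doubling in real dimension 6 multiplies volume by `2⁶`.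
  have hscale : volume.real (cutoffBox δ η 2) = 64 * volume.real (cutoffBox δ η 1) := by
    have hpre : cutoffBox δ η 1 = (fun p : G8 => (2 : ℝ) • p) ⁻¹' cutoffBox δ η 2 := by
      have h2 : ∀ (r : ℝ) (z : ℂ), ‖r • (2 : ℝ) • z‖ ≤ 2 ↔ ‖r • z‖ ≤ 1 := by
        intro r z
        rw [smul_comm, norm_smul, Real.norm_of_nonneg zero_le_two]
        constructor <;> intro h <;> linarith
      ext p
      exact and_congr (h2 _ _).symm (and_congr (h2 _ _).symm (h2 _ _).symm)
    have := Measure.addHaar_preimage_smul (volume : Measure G8) (two_ne_zero (α := ℝ))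
      (cutoffBox δ η 2)
    rw [← hpre, G8.finrank_eq] at this
    rw [measureReal_def, measureReal_def, this, ENNReal.toReal_mul, ENNReal.toReal_ofReal]
    · norm_num
      ring
    · positivity
  have hlower : volume.real (cutoffBox δ η 1) ≤ ∫ p, cutoff χ δ η p := by
    rw [← integral_indicator_one (hboxm 1)]
    refine integral_mono_of_nonneg (ae_of_all _ fun p => ?_) hψint (ae_of_all _ fun p => ?_)
    · exact Set.indicator_nonneg (fun _ _ => zero_le_one) p
    · refine Set.indicator_le' (fun q hq => ?_) (fun q _ => cutoff_nonneg χ δ η q) p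
      have h1 : ∀ z : ℂ, ‖z‖ ≤ 1 → χ z = 1 := fun z hz =>
        χ.one_of_mem_closedBall (by simpa [χ] using hz)
      rw [cutoff, h1 _ hq.1, h1 _ hq.2.1, h1 _ hq.2.2]
      simp
  have hpos : 0 < ∫ p, cutoff χ δ η p := by
    refine hcont.integral_pos_of_hasCompactSupport_nonneg_nonzero hsupp (cutoff_nonneg χ δ η)
      (x := (0 : G8)) ?_
    have h1 : χ 0 = 1 := χ.one_of_mem_closedBall (by simp [χ])
    have h2 : cutoff χ δ η 0 = χ (δ • (0 : ℂ)) * (χ (δ • (0 : ℂ)) * χ (η • (0 : ℂ))) := rfl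
    rw [h2]
    simp [h1]
  refine ⟨cutoff χ δ η, contDiff_cutoff χ δ η, hsupp, cutoff_nonneg χ δ η, hpos, fun X hX => ?_⟩
  have hbound := abs_lieD_cutoff_le χ hδ hη hC hX
  have hr : χ.rOut = 2 := rfl
  rw [hr] at hbound
  calc ∫ p, |lieD X (cutoff χ δ η) p|
      ≤ ∫ p, (cutoffBox δ η 2).indicator
          (fun _ => C * M * (η + 2 * δ * Real.exp (2 / η))) p := by
        refine integral_mono_of_nonneg (ae_of_all _ fun p => abs_nonneg _) ?_
          (ae_of_all _ hbound)
        exact (integrable_indicator_iff (hboxm 2)).mpr (integrableOn_const (hbox 2))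
    _ = volume.real (cutoffBox δ η 2) * (C * M * (3 * η)) := by
        rw [integral_indicator (hboxm 2), setIntegral_const, smul_eq_mul, mul_assoc 2, hδe]
        ring
    _ = (192 * η * (C * M)) * volume.real (cutoffBox δ η 1) := by
        rw [hscale]
        ring
    _ ≤ ε * volume.real (cutoffBox δ η 1) := by
        refine mul_le_mul_of_nonneg_right ?_ measureReal_nonneg
        have h1 : 192 * η * B = ε := by
          rw [hη_def]
          field_simp
        rw [← h1]
        refine mul_le_mul_of_nonneg_left ?_ (by positivity)
        have := mul_le_mul_of_nonneg_left (le_abs_self M) hC0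
        linarith
    _ ≤ ε * ∫ p, cutoff χ δ η p := mul_le_mul_of_nonneg_left hlower hε.le

/-- The divergence of a smooth vector field on a compact quotient is not everywhere positive. -/
theorem not_forall_divergence_pos {Γ : Subgroup G8}
    (hΓ : CompactSpace (Quotient (QuotientGroup.rightRel Γ))) {ι : Type*} [Fintype ι] (X : ι → g8)
    (f : ι → G8 → ℝ) (hf : ∀ i, IsSmoothField Γ (f i)) :
    ¬ ∀ p, 0 < ∑ i, lieD (X i) (f i) p := by
  intro hpos
  have hh : IsSmoothField Γ (fun p => ∑ i, lieD (X i) (f i) p) :=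
    IsSmoothField.sum fun i _ => (hf i).lieD (X i)
  obtain ⟨c, hc, hcle⟩ := hh.exists_pos_lower_bound hΓ hpos
  choose C hC using fun i => (hf i).exists_bound hΓ
  have hC0 : ∀ i, 0 ≤ C i := fun i => (abs_nonneg _).trans (hC i 1)
  have hS : 0 ≤ ∑ i, C i := Finset.sum_nonneg fun i _ => hC0 i
  -- With `c` a lower bound for the divergence and `C i` bounds for the components, testing against
  -- `ψ` gives `c ∫ψ ≤ (∑ C i) ε ∫ψ < c ∫ψ`.
  set ε := c / (∑ i, C i + 1) with hε_def
  have hε : 0 < ε := by positivity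
  obtain ⟨ψ, hψ, hψc, hψ0, hψpos, hψX⟩ := exists_foelner (∑ i, 2 * ‖X i‖) hε
  have hf1 : ∀ i, ContDiff ℝ 1 (f i) := fun i => (hf i).1.of_le (by norm_num)
  have hint : ∀ {k : G8 → ℝ}, Continuous k → Integrable (fun p => ψ p * k p) := fun hk =>
    (hψ.continuous.mul hk).integrable_of_hasCompactSupport hψc.mul_right
  have hle : ∀ i, ∫ p, ψ p * lieD (X i) (f i) p ≤ C i * (ε * ∫ p, ψ p) := by
    intro i
    rw [integral_mul_lieD hψ hψc (hf1 i)]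
    have hlc := lieD_continuous hψ (X i)
    have hls := lieD_hasCompactSupport hψc (X i)
    have hi1 : Integrable (fun p => |lieD (X i) ψ p|) :=
      (hlc.integrable_of_hasCompactSupport hls).abs
    calc -∫ p, lieD (X i) ψ p * f i p ≤ |∫ p, lieD (X i) ψ p * f i p| := neg_le_abs _
      _ ≤ ∫ p, |lieD (X i) ψ p * f i p| := abs_integral_le_integral_abs
      _ ≤ ∫ p, C i * |lieD (X i) ψ p| := by
          refine integral_mono_of_nonneg (ae_of_all _ fun p => abs_nonneg _) (hi1.const_mul _)
            (ae_of_all _ fun p => ?_)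
          simp only [abs_mul]
          rw [mul_comm]
          exact mul_le_mul_of_nonneg_right (hC i p) (abs_nonneg _)
      _ = C i * ∫ p, |lieD (X i) ψ p| := integral_const_mul _ _
      _ ≤ C i * (ε * ∫ p, ψ p) := by
          refine mul_le_mul_of_nonneg_left (hψX _ ?_) (hC0 i)
          exact Finset.single_le_sum (f := fun i => 2 * ‖X i‖) (fun i _ => by positivity)
            (Finset.mem_univ i)
  have h1 : c * ∫ p, ψ p ≤ ∫ p, ψ p * ∑ i, lieD (X i) (f i) p := by
    rw [← integral_const_mul]
    refine integral_mono ?_ (hint hh.1.continuous) fun p => ?_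
    · exact (hψ.continuous.integrable_of_hasCompactSupport hψc).const_mul c
    · simp only
      rw [mul_comm]
      exact mul_le_mul_of_nonneg_left (hcle p) (hψ0 p)
  have h2 : ∫ p, ψ p * ∑ i, lieD (X i) (f i) p = ∑ i, ∫ p, ψ p * lieD (X i) (f i) p := by
    simp only [Finset.mul_sum]
    exact integral_finsetSum _ fun i _ => hint ((hf i).lieD (X i)).1.continuous
  have h3 : c * ∫ p, ψ p ≤ (∑ i, C i) * (ε * ∫ p, ψ p) := by
    rw [Finset.sum_mul]
    exact h1.trans (h2.trans_le (Finset.sum_le_sum fun i _ => hle i))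
  have h4 : (∑ i, C i + 1) * ε = c := by
    rw [hε_def]
    field_simp
  have h5 : 0 < ε * ∫ p, ψ p := mul_pos hε hψpos
  rw [← h4] at h3
  nlinarith

end Foelner

/-! ### No balanced metric on Family (Siv2). -/

section Balanced

theorem sum_perm_fin_succ {M : Type*} [AddCommMonoid M] {n : ℕ}
    (f : Equiv.Perm (Fin (n + 1)) → M) :
    ∑ σ, f σ = ∑ i, ∑ τ, f (Equiv.Perm.decomposeFin.symm (i, τ)) := by
  rw [← Equiv.sum_comp Equiv.Perm.decomposeFin.symm, Fintype.sum_prod_type]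

theorem sum_perm_four {M : Type*} [AddCommMonoid M] (f : Fin 4 → Fin 4 → Fin 4 → Fin 4 → ℤˣ → M) :
    ∑ σ : Equiv.Perm (Fin 4), f (σ 0) (σ 1) (σ 2) (σ 3) (Equiv.Perm.sign σ) =
      ((f 0 1 2 3 1 + f 0 1 3 2 (-1)) + ((f 0 2 1 3 (-1) + f 0 2 3 1 1) + (f 0 3 2 1 (-1) +
      f 0 3 1 2 1))) + (((f 1 0 2 3 (-1) + f 1 0 3 2 1) + ((f 1 2 0 3 1 + f 1 2 3 0 (-1)) +
      (f 1 3 2 0 1 + f 1 3 0 2 (-1)))) + (((f 2 1 0 3 (-1) + f 2 1 3 0 1) + ((f 2 0 1 3 1 +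
      f 2 0 3 1 (-1)) + (f 2 3 0 1 1 + f 2 3 1 0 (-1)))) + ((f 3 1 2 0 (-1) + f 3 1 0 2 1) +
      ((f 3 2 1 0 1 + f 3 2 0 1 (-1)) + (f 3 0 2 1 1 + f 3 0 1 2 (-1)))))) := by
  simp only [sum_perm_fin_succ, Fin.sum_univ_succ, Finset.univ_unique, Finset.sum_singleton,
    Equiv.Perm.decomposeFin.symm_sign]
  rfl

/-- The 24 permutations fall into the three pairings of four indices, each occurring eight times
with equal contribution. -/
theorem sum_sign_mul_mul (w : Fin 4 → Fin 4 → ℝ) (h : ∀ i j, w i j = -w j i) :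
    ∑ σ : Equiv.Perm (Fin 4), ((Equiv.Perm.sign σ : ℤ) : ℝ) *
      (w (σ 0) (σ 1) * w (σ 2) (σ 3)) = 8 * (w 0 1 * w 2 3 - w 0 2 * w 1 3 + w 0 3 * w 1 2) := by
  rw [sum_perm_four fun i j k l ε => ((ε : ℤ) : ℝ) * (w i j * w k l), h 1 0,
    h 2 0, h 3 0, h 2 1, h 3 1, h 3 2]
  push_cast
  ring

theorem extD_five (η : G8 → (Fin 4 → g8) → ℝ) (p : G8) (a b c d e : g8) :
    extD η p ![a, b, c, d, e] =
      lieD a (fun q => η q ![b, c, d, e]) p - lieD b (fun q => η q ![a, c, d, e]) p +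
      lieD c (fun q => η q ![a, b, d, e]) p - lieD d (fun q => η q ![a, b, c, e]) p +
      lieD e (fun q => η q ![a, b, c, d]) p -
      (η p ![⁅a, b⁆, c, d, e] - η p ![⁅a, c⁆, b, d, e] + η p ![⁅a, d⁆, b, c, e] -
        η p ![⁅a, e⁆, b, c, d] + η p ![⁅b, c⁆, a, d, e] - η p ![⁅b, d⁆, a, c, e] +
        η p ![⁅b, e⁆, a, c, d] + η p ![⁅c, d⁆, a, b, e] - η p ![⁅c, e⁆, a, b, d] +
        η p ![⁅d, e⁆, a, b, c]) := by
  have r0 : (0 : Fin 5).removeNth ![a, b, c, d, e] = ![b, c, d, e] := by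
    ext1 k; fin_cases k <;> rfl
  have r1 : (1 : Fin 5).removeNth ![a, b, c, d, e] = ![a, c, d, e] := by
    ext1 k; fin_cases k <;> rfl
  have r2 : (2 : Fin 5).removeNth ![a, b, c, d, e] = ![a, b, d, e] := by
    ext1 k; fin_cases k <;> rfl
  have r3 : (3 : Fin 5).removeNth ![a, b, c, d, e] = ![a, b, c, e] := by
    ext1 k; fin_cases k <;> rfl
  have r4 : (4 : Fin 5).removeNth ![a, b, c, d, e] = ![a, b, c, d] := by
    ext1 k; fin_cases k <;> rfl
  have s0 (x y z w : g8) : (0 : Fin 4).removeNth ![x, y, z, w] = ![y, z, w] := by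
    ext1 k; fin_cases k <;> rfl
  have s1 (x y z w : g8) : (1 : Fin 4).removeNth ![x, y, z, w] = ![x, z, w] := by
    ext1 k; fin_cases k <;> rfl
  have s2 (x y z w : g8) : (2 : Fin 4).removeNth ![x, y, z, w] = ![x, y, w] := by
    ext1 k; fin_cases k <;> rfl
  have s3 (x y z w : g8) : (3 : Fin 4).removeNth ![x, y, z, w] = ![x, y, z] := by
    ext1 k; fin_cases k <;> rfl
  have c0 : (0 : Fin 4).castSucc = (0 : Fin 5) := rfl
  have c1 : (1 : Fin 4).castSucc = (1 : Fin 5) := rfl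
  have c2 : (2 : Fin 4).castSucc = (2 : Fin 5) := rfl
  have c3 : (3 : Fin 4).castSucc = (3 : Fin 5) := rfl
  have i0 : (Finset.univ.filter fun j : Fin 4 => j ≥ 0) = {0, 1, 2, 3} := by decide
  have i1 : (Finset.univ.filter fun j : Fin 4 => j ≥ 1) = {1, 2, 3} := by decide
  have i2 : (Finset.univ.filter fun j : Fin 4 => j ≥ 2) = {2, 3} := by decide
  have i3 : (Finset.univ.filter fun j : Fin 4 => j ≥ 3) = {3} := by decide
  change (∑ i : Fin 5, (-1 : ℝ) ^ (i : ℕ) *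
      lieD (![a, b, c, d, e] i) (fun q => η q (Fin.removeNth (n := 4) i ![a, b, c, d, e])) p) -
    (∑ i : Fin 4, ∑ j : Fin 4 with j ≥ i, (-1 : ℝ) ^ (i + j : ℕ) *
      η p (Matrix.vecCons ⁅![a, b, c, d, e] i.castSucc, ![a, b, c, d, e] j.succ⁆
        (Fin.removeNth (n := 3) j (Fin.removeNth (n := 4) i.castSucc ![a, b, c, d, e])))) = _
  rw [Fin.sum_univ_five, Fin.sum_univ_four, i0, i1, i2, i3]
  simp only [c0, c1, c2, c3, r0, r1, r2, r3, r4]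
  simp [s0, s1, s2, s3]
  ring

theorem fundFormSq_apply {J : g8 →L[ℝ] g8} {g : G8 → g8 →L[ℝ] g8 →L[ℝ] ℝ}
    (hJ : ∀ X, J (J X) = -X) (hs : ∀ p X Y, g p X Y = g p Y X)
    (hh : ∀ p X Y, g p (J X) (J Y) = g p X Y) (p : G8) (a b c d : g8) :
    fundFormSq J g p ![a, b, c, d] = 2 * (g p a (J b) * g p c (J d) - g p a (J c) * g p b (J d) +
      g p a (J d) * g p b (J c)) := by
  have hanti : ∀ X Y, fundForm J g p X Y = -fundForm J g p Y X := by
    intro X Y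
    rw [fundForm, fundForm, ← hh p X, hJ, map_neg, hs]
  rw [fundFormSq, sum_sign_mul_mul (fun i j => fundForm J g p (![a, b, c, d] i) (![a, b, c, d] j))
    fun i j => hanti _ _]
  simp [fundForm]
  ring

theorem isSmoothField_fundFormSq {Γ : Subgroup G8} {J : g8 →L[ℝ] g8}
    {g : G8 → g8 →L[ℝ] g8 →L[ℝ] ℝ} (hJ : ∀ X, J (J X) = -X) (hg : IsHermitianMetric Γ J g)
    (a b c d : g8) : IsSmoothField Γ (fun p => fundFormSq J g p ![a, b, c, d]) := by
  have h : ∀ X Y, IsSmoothField Γ (fun p => g p X Y) := fun X Y =>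
    (hg.smooth.clm_apply (isSmoothField_const Γ X)).clm_apply (isSmoothField_const Γ Y)
  simp only [fundFormSq_apply hJ hg.symm hg.herm]
  exact (isSmoothField_const Γ 2).mul
    ((((h _ _).mul (h _ _)).sub ((h _ _).mul (h _ _))).add ((h _ _).mul (h _ _)))

open Complex in
/-- A basis of `𝔤₈` adapted to a complex structure of Family (Siv2). -/
theorem FamilySiv2.exists_basis {J : g8 →L[ℝ] g8} (hJ : FamilySiv2 J) :
    ∃ (X₁ X₂ X₃ : g8) (x : ℝ), X₁ ≠ 0 ∧ (∀ a b : ℝ, X₂ ≠ a • X₁ + b • J X₁) ∧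
      ⁅X₁, X₂⁆ = 0 ∧ ⁅X₁, J X₂⁆ = 0 ∧ ⁅X₁, X₃⁆ = (-2 : ℝ) • J X₁ ∧ ⁅X₁, J X₃⁆ = (2 : ℝ) • X₁ ∧
      ⁅X₂, J X₂⁆ = 0 ∧ ⁅X₂, X₃⁆ = (2 : ℝ) • J X₂ ∧ ⁅X₂, J X₃⁆ = (-2 : ℝ) • X₂ ∧
      ⁅J X₂, X₃⁆ = (-2 : ℝ) • X₂ ∧ ⁅J X₂, J X₃⁆ = (-2 : ℝ) • J X₂ ∧
      ⁅X₃, J X₃⁆ = (2 : ℝ) • J X₁ + (2 * x) • J X₂ := by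
  obtain ⟨-, x, φ, -, hφ, hd⟩ := hJ
  have h0 := hφ.eq_zero
  have hext : ∀ X Y, φ 0 X = φ 0 Y → φ 1 X = φ 1 Y → φ 2 X = φ 2 Y → X = Y := by
    intro X Y e0 e1 e2
    refine sub_eq_zero.mp (h0 _ fun i => ?_)
    rw [map_sub, sub_eq_zero]
    fin_cases i <;> assumption
  have hφJ := hφ.1
  have hv : ∀ (z : Fin 3 → ℂ) (i : Fin 3), φ i ((frameEquiv φ h0).symm z) = z i :=
    apply_frameEquiv_symm φ h0
  have h1 := fun X Y => (hd X Y).1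
  have h2 := fun X Y => (hd X Y).2.1
  have h3 := fun X Y => (hd X Y).2.2
  simp only [invD, neg_eq_iff_eq_neg] at h1 h2 h3
  -- The vectors dual to the coframe; the brackets are then read off from the structure equations.
  refine ⟨(frameEquiv φ h0).symm ![1, 0, 0], (frameEquiv φ h0).symm ![0, 1, 0],
    (frameEquiv φ h0).symm ![0, 0, 1], x, ?_, ?_, ?_, ?_, ?_, ?_, ?_, ?_, ?_, ?_, ?_, ?_⟩
  · intro h
    have := congrArg (φ 0) h
    simp [hv] at this
  · intro a b h
    have := congrArg (φ 1) h
    simp [hφJ, hv] at this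
  all_goals
    apply hext <;> simp [h1, h2, h3, hφJ, hv, wedge, wedgeBar] <;> ring_nf <;> simp [I_sq]

/-- Strict Cauchy–Schwarz for the complex Hermitian form underlying `B`: positivity is applied to `B
X X` times the component of `Y` orthogonal to `X` and `J X`. -/
theorem hermitian_gram_pos {J : g8 →L[ℝ] g8} {B : g8 →L[ℝ] g8 →L[ℝ] ℝ}
    (hJ : ∀ X, J (J X) = -X) (hs : ∀ X Y, B X Y = B Y X) (hpos : ∀ X, X ≠ 0 → 0 < B X X)
    (hh : ∀ X Y, B (J X) (J Y) = B X Y) {X Y : g8} (hXY : ∀ a b : ℝ, Y ≠ a • X + b • J X)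
    (hX : X ≠ 0) : 0 < B X X * B Y Y - B X Y ^ 2 - B X (J Y) ^ 2 := by
  have hXX := hpos X hX
  have hZ : B X X • Y - (B X Y • X - B X (J Y) • J X) ≠ 0 := by
    intro h
    apply hXY ((B X X)⁻¹ * B X Y) (-((B X X)⁻¹ * B X (J Y)))
    rw [sub_eq_zero] at h
    rw [mul_smul, neg_smul, mul_smul, ← sub_eq_add_neg, ← smul_sub, ← h, smul_smul,
      inv_mul_cancel₀ hXX.ne', one_smul]
  have h := hpos _ hZ
  have e1 : B (J X) Y = -B X (J Y) := by rw [← hh, hJ, map_neg]; rfl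
  have e2 : B X (J X) = 0 := by
    have : B (J X) X = -B X (J X) := by rw [← hh (J X), hJ, map_neg]; rfl
    rw [hs] at this
    linarith
  have e3 : B (J X) X = 0 := by rw [hs, e2]
  have e4 : B Y (J X) = -B X (J Y) := by rw [hs, e1]
  simp only [map_sub, map_smul, sub_apply, smul_apply, smul_eq_mul, hh, e1, e2, e3, e4, hs Y X] at h
  refine pos_of_mul_pos_right (a := B X X) (lt_of_lt_of_eq h ?_) hXX.le
  ring

/-- No Hermitian metric on a compact quotient with a complex structure of Family (Siv2) is
balanced. -/
theorem not_exists_balanced {J : g8 →L[ℝ] g8} (hJ : FamilySiv2 J) {Γ : Subgroup G8}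
    (hΓ : IsCocompactLattice Γ) : ¬ ∃ g, IsHermitianMetric Γ J g ∧ IsBalanced J g := by
  rintro ⟨g, hg, hbal⟩
  have hJJ := hJ.1.1
  obtain ⟨X₁, X₂, X₃, x, hX1, hX, b12, b12', b13, b13', b22', b23, b23', b2'3, b2'3', b33'⟩ :=
    hJ.exists_basis
  have hsm := isSmoothField_fundFormSq hJJ hg
  let η := fundFormSq J g
  -- The field whose divergence is minus the derivative part of `dω²` on these five vectors.
  -- Omitting `J X₁` amounts to wedging `dω²` with `Im φ¹`.
  refine not_forall_divergence_pos hΓ.2 ![X₁, X₂, J X₂, X₃, J X₃]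
    ![fun p => -η p ![X₂, J X₂, X₃, J X₃], fun p => η p ![X₁, J X₂, X₃, J X₃],
      fun p => -η p ![X₁, X₂, X₃, J X₃], fun p => η p ![X₁, X₂, J X₂, J X₃],
      fun p => -η p ![X₁, X₂, J X₂, X₃]] ?_ fun p => ?_
  · intro i
    fin_cases i
    exacts [(hsm _ _ _ _).neg, hsm _ _ _ _, (hsm _ _ _ _).neg, hsm _ _ _ _, (hsm _ _ _ _).neg]
  have hneg : ∀ (X : g8) (f : G8 → ℝ), lieD X (fun q => -f q) p = -lieD X f p := by
    intro X f
    rw [lieD, lieD, fderiv_fun_neg]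
    rfl
  have h := hbal p ![X₁, X₂, J X₂, X₃, J X₃]
  rw [extD_five] at h
  have hgram := hermitian_gram_pos hJJ (hg.symm p) (hg.pos p) (hg.herm p) hX hX1
  rw [Fin.sum_univ_five]
  change 0 < lieD X₁ (fun p => -η p ![X₂, J X₂, X₃, J X₃]) p +
    lieD X₂ (fun p => η p ![X₁, J X₂, X₃, J X₃]) p +
    lieD (J X₂) (fun p => -η p ![X₁, X₂, X₃, J X₃]) p +
    lieD X₃ (fun p => η p ![X₁, X₂, J X₂, J X₃]) p +
    lieD (J X₃) (fun p => -η p ![X₁, X₂, J X₂, X₃]) p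
  rw [hneg, hneg, hneg]
  have e1 : ∀ X Y, g p (J X) Y = -g p X (J Y) := fun X Y => by
    rw [← hg.herm, hJJ, map_neg]; rfl
  have e2 : ∀ X, g p X (J X) = 0 := fun X => by
    have := e1 X X
    rw [hg.symm] at this
    linarith
  have e3 : ∀ X Y, g p Y (J X) = -g p X (J Y) := fun X Y => by rw [hg.symm, e1]
  rw [b12, b12', b13, b13', b22', b23, b23', b2'3, b2'3', b33'] at h
  simp only [fundFormSq_apply hJJ hg.symm hg.herm] at h
  have key : ∀ P L : ℝ, L - P = 0 → -P > 0 → 0 < -L := fun P L h1 h2 => by linarith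
  refine lt_of_lt_of_eq (key _ _ h ?_) ?_
  -- By `J`-invariance of `ω²` the terms containing a single `X₃` or `J X₃` cancel. Only the
  -- component `2 J X₁` of `[X₃, J X₃]` survives, and the bracket part is `-4` times the Gram
  -- determinant of `hgram`.
  · simp only [map_add, map_smul, map_zero, add_apply, smul_apply, zero_apply, smul_eq_mul, hJJ,
      map_neg, e1, e2, e3 X₁ X₂, hg.symm p X₂ X₁]
    nlinarith [hgram]
  · simp only [η, fundFormSq_apply hJJ hg.symm hg.herm]
    ring

end Balanced

/-! ### Traces of endomorphisms. -/

section Traces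

/-- The trace of an endomorphism of `𝔤₈`, as a continuous linear form. -/
noncomputable def traceL : (g8 →L[ℝ] g8) →L[ℝ] ℝ :=
  LinearMap.toContinuousLinearMap (LinearMap.trace ℝ g8 ∘ₗ ContinuousLinearMap.coeLM ℝ)

theorem traceL_apply (A : g8 →L[ℝ] g8) : traceL A = LinearMap.trace ℝ g8 A := rfl

theorem traceL_comp_comm (A B : g8 →L[ℝ] g8) : traceL (A.comp B) = traceL (B.comp A) :=
  LinearMap.trace_mul_comm ℝ (A : g8 →ₗ[ℝ] g8) (B : g8 →ₗ[ℝ] g8)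

/-- The basis `e₁, …, e₆` of `𝔤₈`. -/
noncomputable def frameBasis : Module.Basis (Fin 6) ℝ g8 := Pi.basisFun ℝ (Fin 6)

theorem frameBasis_repr (X : g8) (i : Fin 6) : frameBasis.repr X i = X.co i :=
  Pi.basisFun_repr ℝ (Fin 6) (X : Fin 6 → ℝ) i

theorem sum_co_smul (X : g8) : ∑ i, X.co i • frameBasis i = X := by
  conv_rhs => rw [← frameBasis.sum_repr X]
  simp only [frameBasis_repr]

theorem traceL_eq_sum (A : g8 →L[ℝ] g8) : traceL A = ∑ i, (A (frameBasis i)).co i := by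
  rw [traceL_apply, LinearMap.trace_eq_matrix_trace ℝ frameBasis, Matrix.trace]
  simp only [Matrix.diag_apply, LinearMap.toMatrix_apply, frameBasis_repr]
  rfl

/-- The coordinate `X ↦ X_i` as a continuous linear form. -/
noncomputable def coL (i : Fin 6) : g8 →L[ℝ] ℝ :=
  (ContinuousLinearMap.proj i : (Fin 6 → ℝ) →L[ℝ] ℝ)

/-- A trace is a sum of values of the associated quadratic form on an orthogonal basis. -/
theorem exists_traceL_eq_sum {B : g8 →L[ℝ] g8 →L[ℝ] ℝ} (hs : ∀ X Y, B X Y = B Y X)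
    (hpos : ∀ X, X ≠ 0 → 0 < B X X) : ∃ (n : ℕ) (v : Module.Basis (Fin n) ℝ g8),
      ∀ A : g8 →L[ℝ] g8, traceL A = ∑ i, B (A (v i)) (v i) / B (v i) (v i) := by
  let b : LinearMap.BilinForm ℝ g8 := (ContinuousLinearMap.coeLM ℝ).comp (B : g8 →ₗ[ℝ] g8 →L[ℝ] ℝ)
  have hb : ∀ X Y, b X Y = B X Y := fun _ _ => rfl
  obtain ⟨v, hv⟩ := LinearMap.BilinForm.exists_orthogonal_basis (B := b) ⟨fun X Y => hs X Y⟩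
  refine ⟨_, v, fun A => ?_⟩
  rw [traceL_apply, LinearMap.trace_eq_matrix_trace ℝ v, Matrix.trace]
  refine Finset.sum_congr rfl fun i _ => ?_
  rw [Matrix.diag_apply, LinearMap.toMatrix_apply, eq_div_iff (hpos _ (v.ne_zero i)).ne']
  conv_rhs => rw [show A (v i) = ∑ j, v.repr (A (v i)) j • v j from (v.sum_repr _).symm]
  rw [map_sum, sum_apply, Finset.sum_eq_single i]
  · simp
  · intro j _ hji
    have : B (v j) (v i) = 0 := hv hji
    simp [this]
  · simp

end Traces

/-! ### Rules for derivatives along left-invariant fields. -/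

section Derivations

variable {V W : Type*} [NormedAddCommGroup V] [NormedSpace ℝ V]
  [NormedAddCommGroup W] [NormedSpace ℝ W]

theorem lieD_clm (L : V →L[ℝ] W) {f : G8 → V} {p : G8} (hf : DifferentiableAt ℝ f p) (X : g8) :
    lieD X (fun q => L (f q)) p = L (lieD X f p) := by
  have h : HasFDerivAt (fun q => L (f q)) (L.comp (fderiv ℝ f p)) p :=
    L.hasFDerivAt.comp p hf.hasFDerivAt
  rw [lieD, h.fderiv]
  rfl

theorem lieD_clm_apply {f : G8 → V →L[ℝ] W} {v : G8 → V} {p : G8} (hf : DifferentiableAt ℝ f p)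
    (hv : DifferentiableAt ℝ v p) (X : g8) :
    lieD X (fun q => f q (v q)) p = lieD X f p (v p) + f p (lieD X v p) := by
  have h := hf.hasFDerivAt.clm_apply hv.hasFDerivAt
  rw [lieD, h.fderiv, add_comm]
  rfl

theorem lieD_apply_const {f : G8 → V →L[ℝ] W} {p : G8} (hf : DifferentiableAt ℝ f p)
    (v : V) (X : g8) : lieD X (fun q => f q v) p = lieD X f p v := by
  rw [lieD_clm_apply hf (differentiableAt_const v), lieD_const, map_zero, add_zero]

theorem lieD_apply_apply_const {U : Type*} [NormedAddCommGroup U] [NormedSpace ℝ U]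
    {f : G8 → U →L[ℝ] V →L[ℝ] W} {p : G8} (hf : DifferentiableAt ℝ f p)
    (u : U) (v : V) (X : g8) : lieD X (fun q => f q u v) p = lieD X f p u v := by
  rw [lieD_apply_const (f := fun q => f q u) (hf.clm_apply (differentiableAt_const u)),
    lieD_apply_const hf]

/-- The value at `p` of left-invariant fields, as a linear map. -/
noncomputable def leftFieldL (p : G8) : g8 →L[ℝ] G8 :=
  LinearMap.toContinuousLinearMap
    { toFun := fun X => G8.leftField X p
      map_add' := fun X Y => by
        refine G8.ext ?_ ?_ ?_
        · change Complex.exp p.s * _ = Complex.exp p.s * _ + Complex.exp p.s * _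
          rw [← mul_add]
          rfl
        · change Complex.exp (-p.s) * _ = Complex.exp (-p.s) * _ + Complex.exp (-p.s) * _
          rw [← mul_add]
          rfl
        · rfl
      map_smul' := fun c X => by
        have h : ∀ a b : ℝ, (⟨c * a, c * b⟩ : ℂ) = c • ⟨a, b⟩ := fun a b => by
          apply Complex.ext <;> simp
        refine G8.ext ?_ ?_ ?_
        · change Complex.exp p.s * (⟨c * _, c * _⟩ : ℂ) = c • (Complex.exp p.s * _)
          rw [h, mul_smul_comm]
          rfl
        · change Complex.exp (-p.s) * (⟨c * _, c * _⟩ : ℂ) = c • (Complex.exp (-p.s) * _)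
          rw [h, mul_smul_comm]
          rfl
        · exact h _ _ }

theorem fderiv_comp_leftFieldL (f : G8 → V) (p : G8) (X : g8) :
    (fderiv ℝ f p).comp (leftFieldL p) X = lieD X f p := rfl

theorem lieD_eq_sum (f : G8 → V) (p : G8) (X : g8) :
    lieD X f p = ∑ i, X.co i • lieD (frameBasis i) f p := by
  rw [← fderiv_comp_leftFieldL]
  conv_lhs => rw [← sum_co_smul X]
  simp only [map_sum, map_smul, fderiv_comp_leftFieldL]

end Derivations

/-! ### Derivatives of determinants. -/

section Determinants

open Matrix

variable {n : Type*} [Fintype n] [DecidableEq n]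

theorem det_updateRow_eq_sum (A : Matrix n n ℝ) (i : n) (v : n → ℝ) :
    (A.updateRow i v).det = ∑ j, v j * A.adjugate j i := by
  rw [det_eq_sum_mul_adjugate_row _ i]
  refine Finset.sum_congr rfl fun j _ => ?_
  rw [updateRow_self, adjugate_apply, adjugate_apply, updateRow_idem]

/-- The determinant as a continuous multilinear map of the rows. -/
noncomputable def detL : ContinuousMultilinearMap ℝ (fun _ : n => n → ℝ) ℝ where
  toMultilinearMap := (detRowAlternating : (n → ℝ) [⋀^n]→ₗ[ℝ] ℝ).toMultilinearMap
  cont := Continuous.matrix_det continuous_id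

theorem contDiff_det : ContDiff ℝ ∞ (fun G : n → n → ℝ => det (of G)) :=
  ContinuousMultilinearMap.contDiff (detL (n := n))

/-- Jacobi's formula for the derivative of a determinant. -/
theorem lieD_det {G : G8 → n → n → ℝ} {p : G8} (hG : DifferentiableAt ℝ G p) (X : g8) :
    lieD X (fun q => det (of (G q))) p = (of (lieD X G p) * adjugate (of (G p))).trace := by
  have h : HasFDerivAt (fun q => det (of (G q))) ((detL.linearDeriv (G p)).comp (fderiv ℝ G p)) p :=
    (detL.hasFDerivAt (x := G p)).comp p hG.hasFDerivAt
  rw [lieD, h.fderiv, ContinuousLinearMap.comp_apply, ContinuousMultilinearMap.linearDeriv_apply,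
    Matrix.trace]
  refine Finset.sum_congr rfl fun i _ => ?_
  exact det_updateRow_eq_sum (of (G p)) i _

theorem trace_add_transpose_mul_adjugate (P G : Matrix n n ℝ) :
    ((P * G + G * Pᵀ) * adjugate G).trace = 2 * (G.det * P.trace) := by
  rw [Matrix.add_mul, trace_add, Matrix.mul_assoc, mul_adjugate, Matrix.mul_assoc, trace_mul_comm G,
    Matrix.mul_assoc, adjugate_mul]
  simp
  ring

end Determinants

/-! ### Volume density and divergence for a connection with torsion. -/

section Volume

open scoped Matrix

variable {Γ : Subgroup G8} {J : g8 →L[ℝ] g8} {g : G8 → g8 →L[ℝ] g8 →L[ℝ] ℝ}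
  {D : G8 → g8 →L[ℝ] g8 →L[ℝ] g8}

/-- The Gram matrix of the metric in the frame `e₁, …, e₆`. -/
noncomputable def gramMatrix (g : G8 → g8 →L[ℝ] g8 →L[ℝ] ℝ) (p : G8) (i j : Fin 6) : ℝ :=
  g p (frameBasis i) (frameBasis j)

theorem det_gram_pos (hg : IsHermitianMetric Γ J g) (p : G8) : 0 < Matrix.det (Matrix.of (gramMatrix g p)) := by
  refine Matrix.PosDef.det_pos (Matrix.PosDef.of_dotProduct_mulVec_pos ?_ fun {x} hx => ?_)
  · ext i j
    simpa [gramMatrix] using hg.symm p _ _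
  · have h0 : g8.mk x ≠ 0 := hx
    have h := hg.pos p _ h0
    rw [← sum_co_smul (g8.mk x)] at h
    simp only [map_sum, map_smul, sum_apply, smul_apply, smul_eq_mul] at h
    refine h.trans_eq ?_
    simp only [dotProduct, Matrix.mulVec, star_trivial, Matrix.of_apply, gramMatrix]
    refine Finset.sum_congr rfl fun i _ => ?_
    change x i * _ = x i * _
    congr 1
    refine Finset.sum_congr rfl fun j _ => ?_
    change x j * _ = _ * x j
    rw [hg.symm, mul_comm]

theorem lieD_metric (hg : IsHermitianMetric Γ J g) (hD : IsChernConnection Γ J g D) (p : G8)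
    (X Y Z : g8) : lieD X g p Y Z = g p (D p X Y) Z + g p Y (D p X Z) := by
  rw [← lieD_apply_apply_const (hg.smooth.differentiableAt p), hD.metric]

/-- The Riemannian volume density. -/
theorem exists_volume_density (hg : IsHermitianMetric Γ J g) (hD : IsChernConnection Γ J g D) :
    ∃ ρ : G8 → ℝ, IsSmoothField Γ ρ ∧ (∀ p, 0 < ρ p) ∧
      ∀ p X, lieD X ρ p = ρ p * traceL (D p X) := by
  have hdet := det_gram_pos hg
  have hgram : ContDiff ℝ ∞ (gramMatrix g) := contDiff_pi.mpr fun i => contDiff_pi.mpr fun j =>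
    (hg.smooth.1.clm_apply contDiff_const).clm_apply contDiff_const
  have hsm : ContDiff ℝ ∞ (fun p => Matrix.det (Matrix.of (gramMatrix g p))) :=
    contDiff_det.comp hgram
  have hlie : ∀ p X, lieD X (fun q => Matrix.det (Matrix.of (gramMatrix g q))) p =
      2 * (Matrix.det (Matrix.of (gramMatrix g p)) * traceL (D p X)) := by
    intro p X
    have hdiff : DifferentiableAt ℝ (gramMatrix g) p := hgram.differentiable (by simp) p
    let P : Matrix (Fin 6) (Fin 6) ℝ := Matrix.of fun i k => (D p X (frameBasis i)).co k
    have htr : P.trace = traceL (D p X) := by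
      rw [traceL_eq_sum]
      rfl
    -- Metric compatibility in matrix form; with Jacobi's formula the logarithmic derivative of the
    -- determinant is `2 tr (D X)`, and the square root halves it.
    have hG' : Matrix.of (lieD X (gramMatrix g) p) = P * Matrix.of (gramMatrix g p) + Matrix.of (gramMatrix g p) * Pᵀ := by
      ext i j
      have h1 : lieD X (gramMatrix g) p i j = lieD X (fun q => gramMatrix g q i j) p := by
        have := lieD_clm ((ContinuousLinearMap.proj j : (Fin 6 → ℝ) →L[ℝ] ℝ).comp
          (ContinuousLinearMap.proj i : (Fin 6 → Fin 6 → ℝ) →L[ℝ] (Fin 6 → ℝ))) hdiff X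
        exact this.symm
      rw [Matrix.of_apply, h1]
      simp only [gramMatrix]
      rw [hD.metric]
      conv_lhs => rw [← sum_co_smul (D p X (frameBasis i)), ← sum_co_smul (D p X (frameBasis j))]
      simp only [map_sum, map_smul, sum_apply, smul_apply, smul_eq_mul, Matrix.add_apply, Matrix.mul_apply,
        P, Matrix.of_apply, Matrix.transpose_apply, gramMatrix]
      congr 1
      exact Finset.sum_congr rfl fun k _ => mul_comm _ _
    rw [lieD_det hdiff, hG', trace_add_transpose_mul_adjugate, htr]
  refine ⟨fun p => Real.sqrt (Matrix.det (Matrix.of (gramMatrix g p))), ⟨hsm.sqrt fun p => (hdet p).ne',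
    fun γ hγ p => ?_⟩, fun p => Real.sqrt_pos.mpr (hdet p), fun p X => ?_⟩
  · have : gramMatrix g (γ * p) = gramMatrix g p := by
      funext i j
      simp only [gramMatrix, hg.smooth.2 γ hγ]
    simp only [this]
  · have hd := (hsm.differentiable (by simp) p).hasFDerivAt.sqrt (hdet p).ne'
    have hs := Real.sqrt_pos.mpr (hdet p)
    rw [lieD, hd.fderiv, smul_apply, smul_eq_mul]
    change _ * lieD X (fun q => Matrix.det (Matrix.of (gramMatrix g q))) p = _
    rw [hlie]
    have hsq := Real.mul_self_sqrt (hdet p).le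
    field_simp
    rw [pow_two, hsq]

/-- The bracket as a continuous bilinear map. -/
noncomputable def bracketL : g8 →L[ℝ] g8 →L[ℝ] g8 :=
  bilinCLM (LinearMap.mk₂ ℝ (fun X Y => ⁅X, Y⁆) add_lie (fun c X Y => smul_lie c X Y) lie_add
    (fun c X Y => lie_smul c X Y))

theorem bracketL_apply (X Y : g8) : bracketL X Y = ⁅X, Y⁆ := rfl

/-- Unimodularity: no structure constants enter the divergence formula. -/
theorem traceL_bracketL (X : g8) : traceL (bracketL X) = 0 := by
  have h := fun Y => g8.bracket_coord X Y
  have hb : ∀ i j, (frameBasis i).co j = if i = j then 1 else 0 := by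
    intro i j
    rw [← frameBasis_repr, Module.Basis.repr_self, Finsupp.single_apply]
  rw [traceL_eq_sum]
  simp [Fin.sum_univ_succ, bracketL_apply, h, g8.w, hb]

/-- The torsion as a bilinear map. -/
noncomputable def torsionL (D : G8 → g8 →L[ℝ] g8 →L[ℝ] g8) (p : G8) : g8 →L[ℝ] g8 →L[ℝ] g8 :=
  D p - (D p).flip - bracketL

theorem torsionL_apply (D : G8 → g8 →L[ℝ] g8 →L[ℝ] g8) (p : G8) (X Y : g8) :
    torsionL D p X Y = D p X Y - D p Y X - ⁅X, Y⁆ := rfl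

/-- Exchange of the arguments of a bilinear map. -/
noncomputable def flipCLM : (g8 →L[ℝ] g8 →L[ℝ] g8) →L[ℝ] g8 →L[ℝ] g8 →L[ℝ] g8 :=
  (ContinuousLinearMap.flipₗᵢ ℝ g8 g8 g8).toContinuousLinearEquiv.toContinuousLinearMap

theorem IsSmoothField.flip {B : G8 → g8 →L[ℝ] g8 →L[ℝ] g8} (hB : IsSmoothField Γ B) :
    IsSmoothField Γ (fun p => (B p).flip) :=
  hB.clm (V := g8 →L[ℝ] g8 →L[ℝ] g8) (W := g8 →L[ℝ] g8 →L[ℝ] g8) flipCLM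

theorem isSmoothField_torsionL (hD : IsSmoothField Γ D) : IsSmoothField Γ (torsionL D) :=
  IsSmoothField.sub (IsSmoothField.sub hD hD.flip) (isSmoothField_const Γ bracketL)

/-- The torsion form `τ(Y) = tr T(·, Y)`. -/
noncomputable def torsionForm (D : G8 → g8 →L[ℝ] g8 →L[ℝ] g8) (p : G8) : g8 →L[ℝ] ℝ :=
  traceL.comp (torsionL D p).flip

theorem isSmoothField_torsionForm (hD : IsSmoothField Γ D) : IsSmoothField Γ (torsionForm D) :=
  (isSmoothField_torsionL hD).flip.clm (V := g8 →L[ℝ] g8 →L[ℝ] g8) (W := g8 →L[ℝ] ℝ)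
    (ContinuousLinearMap.compL ℝ g8 (g8 →L[ℝ] g8) ℝ traceL)

/-- The covariant derivative `X ↦ ∇_X V` of a vector field. -/
noncomputable def covD (D : G8 → g8 →L[ℝ] g8 →L[ℝ] g8) (V : G8 → g8) (p : G8) : g8 →L[ℝ] g8 :=
  (fderiv ℝ V p).comp (leftFieldL p) + (D p).flip (V p)

theorem covD_apply (D : G8 → g8 →L[ℝ] g8 →L[ℝ] g8) (V : G8 → g8) (p : G8) (X : g8) :
    covD D V p X = lieD X V p + D p X (V p) := rfl

/-- The divergence of a vector field with respect to the Riemannian volume. -/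
theorem sum_lieD_density {ρ : G8 → ℝ} {V : G8 → g8} {p : G8} (hρ : DifferentiableAt ℝ ρ p)
    (hρD : ∀ X, lieD X ρ p = ρ p * traceL (D p X)) (hV : DifferentiableAt ℝ V p) :
    ∑ i, lieD (frameBasis i) (fun q => ρ q * (V q).co i) p =
      ρ p * (traceL (covD D V p) - torsionForm D p (V p)) := by
  have hco : ∀ i, DifferentiableAt ℝ (fun q => (V q).co i) p := fun i =>
    ((coL i).differentiableAt).comp p hV
  have h1 : ∀ i, lieD (frameBasis i) (fun q => ρ q * (V q).co i) p =
      ρ p * (lieD (frameBasis i) V p).co i + (V p).co i • lieD (frameBasis i) ρ p := by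
    intro i
    rw [lieD_mul _ hρ (hco i)]
    congr 2
    exact lieD_clm (coL i) hV (frameBasis i)
  simp only [h1]
  rw [Finset.sum_add_distrib, ← lieD_eq_sum, hρD, ← Finset.mul_sum, ← mul_add]
  congr 1
  -- Trace of `T(Y, V) = ∇_Y V - ∇_V Y - [Y, V]` in `Y`; the bracket term has trace zero.
  have h2 : torsionForm D p (V p) = traceL ((D p).flip (V p)) - traceL (D p (V p)) := by
    have : (torsionL D p).flip (V p) = (D p).flip (V p) - D p (V p) + bracketL (V p) := by
      ext1 Y
      change D p Y (V p) - D p (V p) Y - ⁅Y, V p⁆ = D p Y (V p) - D p (V p) Y + ⁅V p, Y⁆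
      rw [← lie_skew (V p) Y]
      abel
    change traceL ((torsionL D p).flip (V p)) = _
    rw [this, map_add, map_sub, traceL_bracketL, add_zero]
  have h3 : traceL (covD D V p) = ∑ i, (lieD (frameBasis i) V p).co i +
      traceL ((D p).flip (V p)) := by
    rw [covD, map_add, traceL_eq_sum ((fderiv ℝ V p).comp (leftFieldL p))]
    rfl
  rw [h2, h3]
  ring

end Volume

/-! ### The Chern torsion and the first Bianchi identity. -/

section ChernTorsion

variable {Γ : Subgroup G8} {J : g8 →L[ℝ] g8} {g : G8 → g8 →L[ℝ] g8 →L[ℝ] ℝ}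
  {D : G8 → g8 →L[ℝ] g8 →L[ℝ] g8}

theorem torsionL_antisymm (D : G8 → g8 →L[ℝ] g8 →L[ℝ] g8) (p : G8) (X Y : g8) :
    torsionL D p Y X = -torsionL D p X Y := by
  rw [torsionL_apply, torsionL_apply, ← lie_skew X Y]
  abel

/-- The torsion of the Chern connection is complex bilinear. -/
theorem torsionL_J_left (hJ : IsComplexStructure J) (hD : IsChernConnection Γ J g D) (p : G8)
    (X Y : g8) : torsionL D p (J X) Y = J (torsionL D p X Y) := by
  have h1 : ∀ X Y, torsionL D p (J X) (J Y) = -torsionL D p X Y := fun X Y =>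
    (neg_eq_of_add_eq_zero_right (hD.torsion_type p X Y)).symm
  have h2 : torsionL D p X (J Y) = torsionL D p (J X) Y := by
    have := h1 X (J Y)
    rw [hJ.1, map_neg, neg_inj] at this
    exact this.symm
  have hb : ∀ X Y : g8, ⁅X, Y⁆ = D p X Y - D p Y X - torsionL D p X Y := fun X Y => by
    rw [torsionL_apply]
    abel
  have hN := hJ.2 X Y
  -- Once brackets are expressed through `D` and the torsion, all connection terms cancel because
  -- `D` commutes with `J`; vanishing of the Nijenhuis tensor becomes a condition on the torsion
  -- alone.
  simp only [hb, h1, h2, hD.complex, map_sub, hJ.1] at hN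
  have h3 : (2 : ℝ) • (torsionL D p X Y + J (torsionL D p (J X) Y)) = 0 := by
    rw [two_smul, ← neg_eq_zero, ← hN]
    abel
  have h4 := (smul_eq_zero.mp h3).resolve_left two_ne_zero
  have h5 := congrArg J h4
  rw [map_add, hJ.1, map_zero] at h5
  exact (sub_eq_zero.mp (by rw [sub_eq_add_neg]; exact h5)).symm

theorem torsionL_J_right (hJ : IsComplexStructure J) (hD : IsChernConnection Γ J g D) (p : G8)
    (X Y : g8) : torsionL D p X (J Y) = J (torsionL D p X Y) := by
  rw [torsionL_antisymm, torsionL_J_left hJ hD, torsionL_antisymm D p X Y, map_neg, neg_neg]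

/-- The covariant derivative `(∇_X T)(Y, Z)` of the torsion. -/
noncomputable def covTorsion (D : G8 → g8 →L[ℝ] g8 →L[ℝ] g8) (p : G8) (X Y Z : g8) : g8 :=
  lieD X (torsionL D) p Y Z + D p X (torsionL D p Y Z) - torsionL D p (D p X Y) Z -
    torsionL D p Y (D p X Z)

theorem lieD_torsionL_apply (hD : IsSmoothField Γ D) (p : G8) (X Y Z : g8) :
    lieD X (torsionL D) p Y Z = lieD X (fun q => torsionL D q Y Z) p :=
  (lieD_apply_apply_const ((isSmoothField_torsionL hD).differentiableAt p) Y Z X).symm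

theorem lieD_torsionL (hD : IsSmoothField Γ D) (p : G8) (X Y Z : g8) :
    lieD X (torsionL D) p Y Z =
      lieD X (fun q => D q Y Z) p - lieD X (fun q => D q Z Y) p := by
  have h : ∀ Y Z, DifferentiableAt ℝ (fun q => D q Y Z) p := fun Y Z =>
    ((hD.clm_apply (isSmoothField_const Γ Y)).clm_apply (isSmoothField_const Γ Z)).differentiableAt p
  have h' := ((h Y Z).hasFDerivAt.sub (h Z Y).hasFDerivAt).sub_const ⁅Y, Z⁆
  rw [lieD_torsionL_apply hD, lieD, show fderiv ℝ (fun q => torsionL D q Y Z) p = _ from h'.fderiv]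
  rfl

/-- The first Bianchi identity for a connection with torsion. -/
theorem sum_curvature_eq (hD : IsSmoothField Γ D) (p : G8) (X Y Z : g8) :
    curvature D p X Y Z + curvature D p Y Z X + curvature D p Z X Y =
      (covTorsion D p X Y Z + torsionL D p (torsionL D p X Y) Z) +
      (covTorsion D p Y Z X + torsionL D p (torsionL D p Y Z) X) +
      (covTorsion D p Z X Y + torsionL D p (torsionL D p Z X) Y) := by
  have hT : ∀ X Y Z, D p X (torsionL D p Y Z) =
      D p X (D p Y Z) - D p X (D p Z Y) - D p X ⁅Y, Z⁆ := fun X Y Z => by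
    rw [torsionL_apply, map_sub, map_sub]
  have hTT : ∀ X Y Z, torsionL D p (torsionL D p X Y) Z = torsionL D p (D p X Y) Z -
      torsionL D p (D p Y X) Z - (D p ⁅X, Y⁆ Z - D p Z ⁅X, Y⁆ - ⁅⁅X, Y⁆, Z⁆) := fun X Y Z => by
    rw [torsionL_apply D p X Y, map_sub, map_sub, sub_apply, sub_apply, torsionL_apply D p ⁅X, Y⁆ Z]
  have hs : ∀ X Y Z, torsionL D p Y (D p X Z) = -torsionL D p (D p X Z) Y := fun X Y Z =>
    torsionL_antisymm D p (D p X Z) Y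
  have hjac : ⁅⁅X, Y⁆, Z⁆ = -⁅⁅Y, Z⁆, X⁆ - ⁅⁅Z, X⁆, Y⁆ := by
    have := lie_jacobi X Y Z
    rw [← lie_skew X ⁅Y, Z⁆, ← lie_skew Y ⁅Z, X⁆, ← lie_skew Z ⁅X, Y⁆] at this
    rw [← sub_eq_zero, ← neg_eq_zero, ← this]
    abel
  simp only [curvature, covTorsion, lieD_torsionL hD, hT, hTT, hs, hjac]
  abel

theorem covTorsion_J_left (hJ : IsComplexStructure J) (hD : IsChernConnection Γ J g D) (p : G8)
    (X Y Z : g8) : covTorsion D p X (J Y) Z = J (covTorsion D p X Y Z) := by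
  have hdiff : DifferentiableAt ℝ (fun q => torsionL D q Y Z) p :=
    (((isSmoothField_torsionL hD.smooth).clm_apply (isSmoothField_const Γ Y)).clm_apply
      (isSmoothField_const Γ Z)).differentiableAt p
  have h : lieD X (torsionL D) p (J Y) Z = J (lieD X (torsionL D) p Y Z) := by
    rw [lieD_torsionL_apply hD.smooth, lieD_torsionL_apply hD.smooth, ← lieD_clm J hdiff]
    simp only [torsionL_J_left hJ hD]
  simp only [covTorsion, h, torsionL_J_left hJ hD, hD.complex, map_add, map_sub]

theorem covTorsion_antisymm (hD : IsSmoothField Γ D) (p : G8) (X Y Z : g8) :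
    covTorsion D p X Z Y = -covTorsion D p X Y Z := by
  simp only [covTorsion, lieD_torsionL hD, torsionL_antisymm D p Y Z,
    torsionL_antisymm D p Y (D p X Z), torsionL_antisymm D p (D p X Y) Z, map_neg]
  abel

theorem covTorsion_J_right (hJ : IsComplexStructure J) (hD : IsChernConnection Γ J g D) (p : G8)
    (X Y Z : g8) : covTorsion D p X Y (J Z) = J (covTorsion D p X Y Z) := by
  rw [covTorsion_antisymm hD.smooth, covTorsion_J_left hJ hD, covTorsion_antisymm hD.smooth p X Y,
    map_neg, neg_neg]

/-- If the curvature of the Chern connection satisfies the first Bianchi identity, the torsion is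
holomorphic. -/
theorem covTorsion_J (hJ : IsComplexStructure J) (hD : IsChernConnection Γ J g D)
    (hR : ∀ p X Y Z, curvature D p X Y Z + curvature D p Y Z X + curvature D p Z X Y = 0)
    (p : G8) (X Y Z : g8) : covTorsion D p (J X) Y Z = J (covTorsion D p X Y Z) := by
  -- The Bianchi identity solved for `∇_X T`. On the right, `X` occurs only as an argument of the
  -- torsion or of its derivative, where dependence is complex linear.
  have hB : ∀ X Y Z, covTorsion D p X Y Z = -(torsionL D p (torsionL D p X Y) Z +
      (covTorsion D p Y Z X + torsionL D p (torsionL D p Y Z) X) +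
      (covTorsion D p Z X Y + torsionL D p (torsionL D p Z X) Y)) := by
    intro X Y Z
    have h := sum_curvature_eq hD.smooth p X Y Z
    rw [hR] at h
    rw [← sub_eq_zero, h]
    abel
  rw [hB (J X), hB X]
  simp only [covTorsion_J_left hJ hD, covTorsion_J_right hJ hD, torsionL_J_left hJ hD,
    torsionL_J_right hJ hD, map_neg, map_add]

/-- The covariant derivative of the torsion form is the trace of that of the torsion. -/
theorem exists_covTorsion_trace (hD : IsSmoothField Γ D) (p : G8) :
    ∃ M : g8 → g8 → g8 →L[ℝ] g8, (∀ X Y Z, M X Z Y = covTorsion D p X Y Z) ∧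
      ∀ X Z, lieD X (torsionForm D) p Z - torsionForm D p (D p X Z) = traceL (M X Z) := by
  refine ⟨fun X Z => (lieD X (torsionL D) p).flip Z + (D p X).comp ((torsionL D p).flip Z) -
    ((torsionL D p).flip Z).comp (D p X) - (torsionL D p).flip (D p X Z), fun X Y Z => rfl,
    fun X Z => ?_⟩
  -- The two compositions with `D p X` form a commutator, of trace zero.
  rw [map_sub, map_sub, map_add, traceL_comp_comm (D p X), add_sub_cancel_right]
  have hT := isSmoothField_torsionL hD
  have hTZ : DifferentiableAt ℝ (fun q => (torsionL D q).flip Z) p :=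
    (hT.flip.clm_apply (isSmoothField_const Γ Z)).differentiableAt p
  have h1 : lieD X (torsionForm D) p Z = lieD X (fun q => torsionForm D q Z) p :=
    (lieD_apply_const ((isSmoothField_torsionForm hD).differentiableAt p) Z X).symm
  have h2 : lieD X (fun q => torsionForm D q Z) p =
      traceL (lieD X (fun q => (torsionL D q).flip Z) p) := lieD_clm traceL hTZ X
  have h3 : lieD X (fun q => (torsionL D q).flip Z) p = (lieD X (torsionL D) p).flip Z := by
    ext1 Y
    rw [← lieD_apply_const hTZ]
    exact (lieD_torsionL_apply hD p X Y Z).symm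
  rw [h1, h2, h3]
  rfl

/-- `∇T` is complex linear both in the direction of differentiation and in the last argument, so
replacing both by their `J`-images changes the sign; the trace follows. -/
theorem covD_torsionForm_J (hJ : IsComplexStructure J) (hD : IsChernConnection Γ J g D)
    (hR : ∀ p X Y Z, curvature D p X Y Z + curvature D p Y Z X + curvature D p Z X Y = 0)
    (p : G8) (X : g8) :
    (lieD X (torsionForm D) p X - torsionForm D p (D p X X)) +
      (lieD (J X) (torsionForm D) p (J X) - torsionForm D p (D p (J X) (J X))) = 0 := by
  obtain ⟨M, hM, hMτ⟩ := exists_covTorsion_trace hD.smooth p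
  have h : M (J X) (J X) = -M X X := by
    ext1 Y
    change M (J X) (J X) Y = -(M X X Y)
    rw [hM, hM, covTorsion_J hJ hD hR, covTorsion_J_right hJ hD, hJ.1]
  rw [hMτ, hMτ, h, map_neg, add_neg_cancel]

end ChernTorsion

/-! ### Dual vector fields and their divergence. -/

section Sharp

variable {Γ : Subgroup G8} {J : g8 →L[ℝ] g8} {g : G8 → g8 →L[ℝ] g8 →L[ℝ] ℝ}
  {D : G8 → g8 →L[ℝ] g8 →L[ℝ] g8}

theorem exists_metricEquiv (hg : IsHermitianMetric Γ J g) (p : G8) :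
    ∃ e : g8 ≃L[ℝ] (g8 →L[ℝ] ℝ), (e : g8 →L[ℝ] g8 →L[ℝ] ℝ) = g p := by
  have hinj : Function.Injective (g p : g8 →ₗ[ℝ] g8 →L[ℝ] ℝ) := by
    rw [← LinearMap.ker_eq_bot, LinearMap.ker_eq_bot']
    intro X hX
    by_contra hne
    have h := hg.pos p X hne
    rw [show g p X = 0 from hX] at h
    exact lt_irrefl _ h
  have hfin : Module.finrank ℝ g8 = Module.finrank ℝ (g8 →L[ℝ] ℝ) := by
    rw [← (LinearMap.toContinuousLinearMap (𝕜 := ℝ) (E := g8) (F' := ℝ)).finrank_eq]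
    exact Subspace.dual_finrank_eq.symm
  refine ⟨(LinearMap.linearEquivOfInjective _ hinj hfin).toContinuousLinearEquiv, ?_⟩
  ext1 X
  rfl

/-- The vector field dual to a one-form. -/
noncomputable def sharp (g : G8 → g8 →L[ℝ] g8 →L[ℝ] ℝ) (α : G8 → g8 →L[ℝ] ℝ) (p : G8) : g8 :=
  (g p).inverse (α p)

theorem metric_sharp (hg : IsHermitianMetric Γ J g) (α : G8 → g8 →L[ℝ] ℝ) (p : G8) :
    g p (sharp g α p) = α p := by
  obtain ⟨e, he⟩ := exists_metricEquiv hg p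
  rw [sharp, ← he, ContinuousLinearMap.inverse_equiv]
  exact e.apply_symm_apply _

theorem isSmoothField_sharp (hg : IsHermitianMetric Γ J g) {α : G8 → g8 →L[ℝ] ℝ}
    (hα : IsSmoothField Γ α) : IsSmoothField Γ (sharp g α) := by
  have hinv : ContDiff ℝ ∞ (fun p => (g p).inverse) := by
    rw [contDiff_iff_contDiffAt]
    intro p
    obtain ⟨e, he⟩ := exists_metricEquiv hg p
    have h := contDiffAt_map_inverse (𝕜 := ℝ) (n := ∞) e
    rw [he] at h
    exact h.comp p hg.smooth.1.contDiffAt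
  exact ⟨hinv.clm_apply hα.1, fun γ hγ p => by simp only [sharp, hg.smooth.2 γ hγ, hα.2 γ hγ]⟩

/-- Since `∇g = 0`, raising an index commutes with covariant differentiation. -/
theorem metric_covD_sharp (hg : IsHermitianMetric Γ J g) (hD : IsChernConnection Γ J g D)
    {α : G8 → g8 →L[ℝ] ℝ} (hα : IsSmoothField Γ α) (p : G8) (X Z : g8) :
    g p (covD D (sharp g α) p X) Z = lieD X α p Z - α p (D p X Z) := by
  have hV := (isSmoothField_sharp hg hα).differentiableAt p
  have hgd := hg.smooth.differentiableAt p
  have h1 : lieD X α p = lieD X g p (sharp g α p) + g p (lieD X (sharp g α) p) := by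
    rw [← lieD_clm_apply hgd hV]
    simp only [metric_sharp hg]
  rw [h1, covD_apply, map_add, add_apply, add_apply, lieD_metric hg hD, ← metric_sharp hg α p]
  ring

/-- `A` and `-J A J` have the same trace, so one may average over them. The pairing of `v` with `J
v` is what the torsion identities control. -/
theorem exists_traceL_eq_sum_hermitian (hJ : IsComplexStructure J) (hg : IsHermitianMetric Γ J g)
    (p : G8) : ∃ (n : ℕ) (v : Module.Basis (Fin n) ℝ g8), ∀ A : g8 →L[ℝ] g8,
      2 * traceL A = ∑ i, (g p (A (v i)) (v i) + g p (A (J (v i))) (J (v i))) /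
        g p (v i) (v i) := by
  obtain ⟨n, v, hv⟩ := exists_traceL_eq_sum (hg.symm p) (hg.pos p)
  refine ⟨n, v, fun A => ?_⟩
  have hJJ : J.comp J = -ContinuousLinearMap.id ℝ g8 := by
    ext1 X
    exact hJ.1 X
  have h1 : traceL (J.comp (A.comp J)) = -traceL A := by
    rw [traceL_comp_comm, ContinuousLinearMap.comp_assoc, hJJ, ContinuousLinearMap.comp_neg,
      ContinuousLinearMap.comp_id, map_neg]
  have h2 := hv (A - J.comp (A.comp J))
  rw [map_sub, h1, sub_neg_eq_add, ← two_mul] at h2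
  rw [h2]
  refine Finset.sum_congr rfl fun i _ => ?_
  have h3 : g p (J (A (J (v i)))) (v i) = -g p (A (J (v i))) (J (v i)) := by
    rw [← hg.herm, hJ.1, map_neg]
    rfl
  congr 1
  rw [sub_apply, map_sub, sub_apply]
  change _ - g p (J (A (J (v i)))) (v i) = _
  rw [h3, sub_neg_eq_add]

theorem traceL_covD_torsion (hJ : IsComplexStructure J) (hg : IsHermitianMetric Γ J g)
    (hD : IsChernConnection Γ J g D)
    (hR : ∀ p X Y Z, curvature D p X Y Z + curvature D p Y Z X + curvature D p Z X Y = 0)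
    (p : G8) : traceL (covD D (sharp g (torsionForm D)) p) = 0 := by
  obtain ⟨n, v, hv⟩ := exists_traceL_eq_sum_hermitian hJ hg p
  have h := hv (covD D (sharp g (torsionForm D)) p)
  have hτ := isSmoothField_torsionForm hD.smooth
  simp only [metric_covD_sharp hg hD hτ, covD_torsionForm_J hJ hD hR, zero_div,
    Finset.sum_const_zero] at h
  linarith

/-- The vector field dual to `-Re φ¹` has positive divergence, up to torsion. -/
theorem traceL_covD_pos (hJ : IsComplexStructure J) (hg : IsHermitianMetric Γ J g)
    (hD : IsChernConnection Γ J g D) {φ ψ : g8 →ₗ[ℝ] ℂ} {α : g8 →L[ℝ] ℝ}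
    (hφJ : ∀ X, φ (J X) = Complex.I * φ X)
    (hd : ∀ X, φ ⁅J X, X⁆ = -(2 * Complex.normSq (ψ X) : ℝ) * Complex.I)
    (hψ : ψ ≠ 0) (hα : ∀ X, α X = -(φ X).re) (p : G8) :
    0 < traceL (covD D (sharp g fun _ => α) p) := by
  obtain ⟨n, v, hv⟩ := exists_traceL_eq_sum_hermitian hJ hg p
  have h := hv (covD D (sharp g fun _ => α) p)
  have hdiv : ∀ X, α (D p X X) + α (D p (J X) (J X)) = -(2 * Complex.normSq (ψ X)) := by
    intro X
    -- `T(JX, X) = J T(X, X) = 0` gives `∇_{JX} JX = -∇_X X + J [JX, X]`, so only the bracket, that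
    -- is the `(1,1)`-part of `dφ¹`, contributes.
    have hT : torsionL D p (J X) X = 0 := by
      have : torsionL D p X X = 0 := by
        rw [torsionL_apply, lie_self, sub_self, sub_zero]
      rw [torsionL_J_left hJ hD, this, map_zero]
    rw [torsionL_apply, hD.complex, sub_eq_zero, sub_eq_iff_eq_add] at hT
    rw [hD.complex, hT, hα, hα, hφJ, map_add, hφJ, hd]
    simp
  have hα0 := isSmoothField_const Γ α
  simp only [metric_covD_sharp hg hD hα0, lieD_const] at h
  have hterm : ∀ i, ((0 : g8 →L[ℝ] ℝ) (v i) - α (D p (v i) (v i)) +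
      ((0 : g8 →L[ℝ] ℝ) (J (v i)) - α (D p (J (v i)) (J (v i))))) / g p (v i) (v i) =
      2 * Complex.normSq (ψ (v i)) / g p (v i) (v i) := by
    intro i
    congr 1
    have := hdiv (v i)
    simp only [zero_apply]
    linarith
  simp only [hterm] at h
  have hnn : ∀ i, 0 ≤ 2 * Complex.normSq (ψ (v i)) / g p (v i) (v i) := fun i =>
    div_nonneg (mul_nonneg zero_le_two (Complex.normSq_nonneg _)) (hg.pos p _ (v.ne_zero i)).le
  suffices hpos : 0 < ∑ i, 2 * Complex.normSq (ψ (v i)) / g p (v i) (v i) by linarith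
  obtain ⟨i, hi⟩ : ∃ i, ψ (v i) ≠ 0 := by
    by_contra hall
    push Not at hall
    exact hψ (v.ext fun i => by rw [hall, LinearMap.zero_apply])
  refine Finset.sum_pos' (fun i _ => hnn i) ⟨i, Finset.mem_univ i, ?_⟩
  exact div_pos (mul_pos two_pos (Complex.normSq_pos.mpr hi)) (hg.pos p _ (v.ne_zero i))

end Sharp

/-! ### No Chern Kähler-like metric on Family (Siv2). -/

section KahlerLike

/-- No Hermitian metric on a compact quotient with a complex structure of Family (Siv2) is Chern
Kähler-like. -/
theorem not_exists_chernKahlerLike {J : g8 →L[ℝ] g8} (hJ : FamilySiv2 J) {Γ : Subgroup G8}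
    (hΓ : IsCocompactLattice Γ) : ¬ ∃ g, IsHermitianMetric Γ J g ∧ IsChernKahlerLike Γ J g := by
  rintro ⟨g, hg, D, hD, hR, -⟩
  obtain ⟨hJ1, x, φ, -, hφ, hd⟩ := hJ
  obtain ⟨ρ, hρ, hρpos, hρD⟩ := exists_volume_density hg hD
  have hφJ := hφ.1
  let α : g8 →L[ℝ] ℝ :=
    LinearMap.toContinuousLinearMap (-(Complex.reLm.comp (φ 0)))
  have hα : ∀ X, α X = -(φ 0 X).re := fun _ => rfl
  have hdφ : ∀ X, φ 0 ⁅J X, X⁆ = -(2 * Complex.normSq (φ 2 X) : ℝ) * Complex.I := by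
    intro X
    have h := (hd (J X) X).1
    simp only [invD, wedge, wedgeBar, hφJ, map_mul, Complex.conj_I] at h
    rw [neg_eq_iff_eq_neg] at h
    rw [h]
    push_cast
    rw [Complex.normSq_eq_conj_mul_self]
    ring
  have hψ : φ 2 ≠ 0 := hφ.2.ne_zero 2
  set W := sharp g fun _ => α with hW
  set V := sharp g (torsionForm D) with hV
  have hτ := isSmoothField_torsionForm hD.smooth
  have hWs : IsSmoothField Γ W := isSmoothField_sharp hg (isSmoothField_const Γ α)
  have hVs : IsSmoothField Γ V := isSmoothField_sharp hg hτ
  have hWpos : ∀ p, 0 < traceL (covD D W p) := traceL_covD_pos hJ1 hg hD (hφJ 0) hdφ hψ hα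
  have hVzero : ∀ p, traceL (covD D V p) = 0 := traceL_covD_torsion hJ1 hg hD hR
  have hfield : ∀ {U : G8 → g8}, IsSmoothField Γ U → ∀ i,
      IsSmoothField Γ (fun q => ρ q * (U q).co i) := fun hU i => hρ.mul (hU.clm (coL i))
  have hdiv : ∀ {U : G8 → g8}, IsSmoothField Γ U → ∀ p,
      ∑ i, lieD (frameBasis i) (fun q => ρ q * (U q).co i) p =
        ρ p * (traceL (covD D U p) - torsionForm D p (U p)) := fun hU p =>
    sum_lieD_density (hρ.differentiableAt p) (hρD p) (hU.differentiableAt p)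
  have htr : IsSmoothField Γ (fun p => traceL (covD D W p)) := by
    have h : ∀ p, traceL (covD D W p) =
        ∑ i, coL i (lieD (frameBasis i) W p + D p (frameBasis i) (W p)) := fun p =>
      traceL_eq_sum _
    simp only [h]
    exact IsSmoothField.sum fun i _ => ((hWs.lieD _).add
      ((hD.smooth.clm_apply (isSmoothField_const Γ _)).clm_apply hWs)).clm (coL i)
  obtain ⟨c, hc, hcle⟩ := htr.exists_pos_lower_bound hΓ.2 hWpos
  obtain ⟨C, hC⟩ := (hWs.clm α).exists_bound hΓ.2
  have hC0 : 0 ≤ C := (abs_nonneg _).trans (hC 1)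
  -- Completing the square, `tr ∇W - ⟨V, W⟩ + K |V|² ≥ c - C/(4K)`, which is positive since `4 K c =
  -- C + 4 c`. Combining the two fields avoids having to show that the torsion form vanishes.
  set K := C / (4 * c) + 1 with hK
  have hK0 : 0 < K := by positivity
  refine not_forall_divergence_pos hΓ.2 frameBasis
    (fun i q => ρ q * (W q).co i - K * (ρ q * (V q).co i))
    (fun i => (hfield hWs i).sub ((isSmoothField_const Γ K).mul (hfield hVs i))) fun p => ?_
  have hsplit : ∀ i, lieD (frameBasis i) (fun q => ρ q * (W q).co i - K * (ρ q * (V q).co i)) p =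
      lieD (frameBasis i) (fun q => ρ q * (W q).co i) p -
        K * lieD (frameBasis i) (fun q => ρ q * (V q).co i) p := by
    intro i
    have h := ((hfield hWs i).differentiableAt p).hasFDerivAt.sub
      (((hfield hVs i).differentiableAt p).hasFDerivAt.const_mul K)
    rw [lieD, show fderiv ℝ (fun q => ρ q * (W q).co i - K * (ρ q * (V q).co i)) p = _ from
      h.fderiv]
    rfl
  simp only [hsplit]
  rw [Finset.sum_sub_distrib, ← Finset.mul_sum, hdiv hWs, hdiv hVs, hVzero]
  have hWα : g p (W p) = α := metric_sharp hg _ p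
  have hVτ : g p (V p) = torsionForm D p := metric_sharp hg _ p
  rw [← hVτ]
  have hsq : 0 ≤ g p ((2 * K) • V p - W p) ((2 * K) • V p - W p) := by
    by_cases h0 : (2 * K) • V p - W p = 0
    · simp [h0]
    · exact (hg.pos p _ h0).le
  simp only [map_sub, map_smul, sub_apply, smul_apply, smul_eq_mul, hg.symm p (W p) (V p)] at hsq
  have hWW : g p (W p) (W p) ≤ C := by
    rw [hWα]
    exact (le_abs_self _).trans (hC p)
  have hcp := hcle p
  have h4 : 4 * K * c = C + 4 * c := by
    rw [hK]
    field_simp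
  have hmain : 0 < traceL (covD D W p) - g p (V p) (W p) + K * g p (V p) (V p) := by
    have h5 : 0 < 4 * K * (traceL (covD D W p) - g p (V p) (W p) + K * g p (V p) (V p)) := by
      have := mul_le_mul_of_nonneg_left hcp (by positivity : 0 ≤ 4 * K)
      nlinarith
    exact pos_of_mul_pos_right h5 (by positivity)
  refine lt_of_lt_of_eq (mul_pos (hρpos p) hmain) ?_
  ring

end KahlerLike

/-! ## A lattice in `G` -/

namespace G8

/-- The larger root `(3 + √5) / 2` of `x² - 3 x + 1`. -/
noncomputable def unitRoot : ℝ := (3 + √5) / 2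

/-- The smaller root `(3 - √5) / 2` of `x² - 3 x + 1`. -/
noncomputable def unitRoot' : ℝ := (3 - √5) / 2

theorem unitRoot_sq : unitRoot * unitRoot = 3 * unitRoot - 1 := by
  have : √5 * √5 = 5 := Real.mul_self_sqrt (by norm_num)
  rw [unitRoot]
  linear_combination this / 4

theorem unitRoot'_sq : unitRoot' * unitRoot' = 3 * unitRoot' - 1 := by
  have : √5 * √5 = 5 := Real.mul_self_sqrt (by norm_num)
  rw [unitRoot']
  linear_combination this / 4

theorem unitRoot_add : unitRoot + unitRoot' = 3 := by
  rw [unitRoot, unitRoot']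
  ring

theorem unitRoot_mul : unitRoot * unitRoot' = 1 := by
  linear_combination unitRoot * unitRoot_add - unitRoot_sq

theorem two_le_sqrt_five : 2 ≤ √5 := Real.le_sqrt_of_sq_le (by norm_num)

theorem sqrt_five_le_three : √5 ≤ 3 := Real.sqrt_le_iff.mpr (by norm_num)

theorem two_le_unitRoot : 2 ≤ unitRoot := by
  have := two_le_sqrt_five
  rw [unitRoot]
  linarith

theorem unitRoot_le_three : unitRoot ≤ 3 := by
  have := sqrt_five_le_three
  rw [unitRoot]
  linarith

theorem unitRoot'_nonneg : 0 ≤ unitRoot' := by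
  have := sqrt_five_le_three
  rw [unitRoot']
  linarith

theorem unitRoot_pos : 0 < unitRoot := two_pos.trans_le two_le_unitRoot

theorem half_le_log_unitRoot : 1 / 2 ≤ Real.log unitRoot :=
  (by linarith [Real.log_two_gt_d9] : (1 : ℝ) / 2 ≤ Real.log 2).trans
    (Real.log_le_log two_pos two_le_unitRoot)

theorem log_unitRoot_le : Real.log unitRoot ≤ 2 := by
  have := Real.log_le_sub_one_of_pos unitRoot_pos
  linarith [unitRoot_le_three]

/-- The image of `(a + b x)`, with `a, b` Gaussian integers, under the two embeddings of
`ℤ[√-1][x] / (x² - 3 x + 1)`. -/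
def IsLatticePair (u v : ℂ) : Prop :=
  ∃ a b : GaussianInt, u = a + b * unitRoot ∧ v = a + b * unitRoot'

theorem IsLatticePair.add {u v u' v' : ℂ} (h : IsLatticePair u v) (h' : IsLatticePair u' v') :
    IsLatticePair (u + u') (v + v') := by
  obtain ⟨a, b, rfl, rfl⟩ := h
  obtain ⟨a', b', rfl, rfl⟩ := h'
  refine ⟨a + a', b + b', ?_, ?_⟩ <;> rw [GaussianInt.toComplex_add, GaussianInt.toComplex_add] <;>
    ring

theorem IsLatticePair.neg {u v : ℂ} (h : IsLatticePair u v) : IsLatticePair (-u) (-v) := by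
  obtain ⟨a, b, rfl, rfl⟩ := h
  refine ⟨-a, -b, ?_, ?_⟩ <;> rw [GaussianInt.toComplex_neg, GaussianInt.toComplex_neg] <;> ring

theorem isLatticePair_zero : IsLatticePair 0 0 := ⟨0, 0, by simp, by simp⟩

theorem IsLatticePair.mul_unitRoot {u v : ℂ} (h : IsLatticePair u v) :
    IsLatticePair (unitRoot * u) (unitRoot' * v) := by
  obtain ⟨a, b, rfl, rfl⟩ := h
  have h1 : (unitRoot * unitRoot : ℂ) = 3 * unitRoot - 1 := mod_cast unitRoot_sq
  have h2 : (unitRoot' * unitRoot' : ℂ) = 3 * unitRoot' - 1 := mod_cast unitRoot'_sq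
  refine ⟨-b, a + b + b + b, ?_, ?_⟩ <;> simp only [GaussianInt.toComplex_add,
    GaussianInt.toComplex_neg]
  · linear_combination (b : ℂ) * h1
  · linear_combination (b : ℂ) * h2

theorem IsLatticePair.mul_unitRoot' {u v : ℂ} (h : IsLatticePair u v) :
    IsLatticePair (unitRoot' * u) (unitRoot * v) := by
  obtain ⟨a, b, rfl, rfl⟩ := h
  have h1 : (unitRoot * unitRoot' : ℂ) = 1 := mod_cast unitRoot_mul
  have h2 : (unitRoot + unitRoot' : ℂ) = 3 := mod_cast unitRoot_add
  refine ⟨a + a + a + b, -a, ?_, ?_⟩ <;> simp only [GaussianInt.toComplex_add,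
    GaussianInt.toComplex_neg]
  · linear_combination (b : ℂ) * h1 + (a : ℂ) * h2
  · linear_combination (b : ℂ) * h1 + (a : ℂ) * h2

theorem unitRoot_inv : (unitRoot : ℂ)⁻¹ = unitRoot' :=
  inv_eq_of_mul_eq_one_right (mod_cast unitRoot_mul)

theorem unitRoot'_inv : (unitRoot' : ℂ)⁻¹ = unitRoot := by
  rw [← unitRoot_inv, inv_inv]

theorem IsLatticePair.zpow_mul {u v : ℂ} (h : IsLatticePair u v) (m : ℤ) :
    IsLatticePair ((unitRoot : ℂ) ^ m * u) ((unitRoot' : ℂ) ^ m * v) := by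
  have h0 : (unitRoot : ℂ) ≠ 0 := mod_cast unitRoot_pos.ne'
  have h0' : (unitRoot' : ℂ) ≠ 0 := by
    rw [← unitRoot_inv]
    exact inv_ne_zero h0
  induction m using Int.induction_on with
  | zero => simpa using h
  | succ k ih =>
    rw [zpow_add_one₀ h0, zpow_add_one₀ h0', mul_comm _ (unitRoot : ℂ),
      mul_comm _ (unitRoot' : ℂ), mul_assoc, mul_assoc]
    exact ih.mul_unitRoot
  | pred k ih =>
    rw [zpow_sub_one₀ h0, zpow_sub_one₀ h0', unitRoot_inv, unitRoot'_inv,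
      mul_comm _ (unitRoot' : ℂ), mul_comm _ (unitRoot : ℂ), mul_assoc, mul_assoc]
    exact ih.mul_unitRoot'

/-- The elements of the rank two lattice generated in `ℂ` by `log ((3 + √5) / 2)` and `2 π √-1`. -/
noncomputable def period (m n : ℤ) : ℂ :=
  m * (Real.log unitRoot : ℂ) + n * (2 * Real.pi * Complex.I)

theorem exp_period (m n : ℤ) : Complex.exp (period m n) = (unitRoot : ℂ) ^ m := by
  rw [period, Complex.exp_add, Complex.exp_int_mul, Complex.exp_int_mul_two_pi_mul_I, mul_one,
    ← Complex.ofReal_exp, Real.exp_log unitRoot_pos]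

theorem exp_neg_period (m n : ℤ) : Complex.exp (-period m n) = (unitRoot' : ℂ) ^ m := by
  rw [Complex.exp_neg, exp_period, ← inv_zpow, unitRoot_inv]

theorem neg_period (m n : ℤ) : -period m n = period (-m) (-n) := by
  rw [period, period]
  push_cast
  ring

theorem period_add (m n m' n' : ℤ) : period m n + period m' n' = period (m + m') (n + n') := by
  simp only [period]
  push_cast
  ring

theorem period_re (m n : ℤ) : (period m n).re = m * Real.log unitRoot := by
  simp [period]

theorem period_im (m n : ℤ) : (period m n).im = n * (2 * Real.pi) := by
  simp [period]

/-- A lattice in `G`, a semidirect product of `ℤ[√-1]²` and `ℤ²`. -/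
noncomputable def lattice : Subgroup G8 where
  carrier := {p | IsLatticePair p.u p.v ∧ ∃ m n, p.s = period m n}
  one_mem' := ⟨isLatticePair_zero, 0, 0, by simp [period]; rfl⟩
  mul_mem' := by
    rintro p q ⟨hp, m, n, hs⟩ ⟨hq, m', n', hs'⟩
    refine ⟨?_, m + m', n + n', ?_⟩
    · change IsLatticePair (p.u + Complex.exp p.s * q.u) (p.v + Complex.exp (-p.s) * q.v)
      rw [hs, exp_period, exp_neg_period]
      exact hp.add (hq.zpow_mul m)
    · change p.s + q.s = _
      rw [hs, hs', period_add]
  inv_mem' := by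
    rintro p ⟨hp, m, n, hs⟩
    refine ⟨?_, -m, -n, ?_⟩
    · change IsLatticePair (-(Complex.exp (-p.s) * p.u)) (-(Complex.exp p.s * p.v))
      have h := (hp.zpow_mul (-m)).neg
      rwa [← exp_neg_period _ (-n), ← exp_period _ (-n), ← neg_period, neg_neg, ← hs] at h
    · change -p.s = _
      rw [hs, neg_period]

theorem gaussianInt_eq_zero_of_norm_lt_one {a : GaussianInt} (h : ‖(a : ℂ)‖ < 1) : a = 0 := by
  have hre := (Complex.abs_re_le_norm (a : ℂ)).trans_lt h
  have him := (Complex.abs_im_le_norm (a : ℂ)).trans_lt h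
  rw [← GaussianInt.intCast_re, ← Int.cast_abs] at hre
  rw [← GaussianInt.intCast_im, ← Int.cast_abs] at him
  exact Zsqrtd.ext (Int.abs_lt_one_iff.mp (mod_cast hre)) (Int.abs_lt_one_iff.mp (mod_cast him))

/-- The difference `u - v = b √5` has norm below 1, and `√5 ≥ 2`, so the Gaussian integer `b`
vanishes; then so does `a`. -/
theorem IsLatticePair.eq_zero {u v : ℂ} (h : IsLatticePair u v) (hu : ‖u‖ < 1 / 2)
    (hv : ‖v‖ < 1 / 2) : u = 0 ∧ v = 0 := by
  obtain ⟨a, b, rfl, rfl⟩ := h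
  have hb : b = 0 := by
    refine gaussianInt_eq_zero_of_norm_lt_one ?_
    have h1 : ((a + b * unitRoot) - (a + b * unitRoot') : ℂ) = b * (√5 : ℝ) := by
      rw [unitRoot, unitRoot']
      push_cast
      ring
    have h2 := (norm_sub_le (a + b * unitRoot : ℂ) (a + b * unitRoot')).trans_lt (add_lt_add hu hv)
    rw [h1, norm_mul, Complex.norm_real, Real.norm_of_nonneg (Real.sqrt_nonneg _)] at h2
    nlinarith [two_le_sqrt_five, norm_nonneg (b : ℂ)]
  subst hb
  have ha : a = 0 := by
    refine gaussianInt_eq_zero_of_norm_lt_one ?_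
    rw [GaussianInt.toComplex_zero, zero_mul, add_zero] at hu
    linarith
  subst ha
  simp

theorem period_eq_zero {m n : ℤ} (h : ‖period m n‖ < 1 / 2) : period m n = 0 := by
  have hre := (Complex.abs_re_le_norm _).trans_lt h
  have him := (Complex.abs_im_le_norm _).trans_lt h
  rw [period_re, abs_mul, abs_of_nonneg (a := Real.log unitRoot)
    (by linarith [half_le_log_unitRoot]), ← Int.cast_abs] at hre
  rw [period_im, abs_mul, abs_of_nonneg (a := 2 * Real.pi) (by positivity), ← Int.cast_abs] at him
  have hm : m = 0 := by
    refine Int.abs_lt_one_iff.mp ?_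
    have : ((|m| : ℤ) : ℝ) < 1 := by
      by_contra! hc
      nlinarith [half_le_log_unitRoot]
    exact mod_cast this
  have hn : n = 0 := by
    refine Int.abs_lt_one_iff.mp ?_
    have : ((|n| : ℤ) : ℝ) < 1 := by
      by_contra! hc
      nlinarith [Real.pi_gt_three]
    exact mod_cast this
  simp [hm, hn, period]

theorem discreteTopology_lattice : DiscreteTopology lattice := by
  refine DiscreteTopology.of_forall_le_dist (r := 1 / 2) (by norm_num) ?_
  rintro ⟨p, hp, m, n, hs⟩ ⟨q, hq, m', n', hs'⟩ hne
  by_contra! hlt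
  refine hne (Subtype.ext ?_)
  change dist p q < 1 / 2 at hlt
  rw [dist_eq_norm] at hlt
  have h1 : ‖p.u - q.u‖ < 1 / 2 := (norm_fst_le (E := ℂ) (F := ℂ × ℂ) (p - q)).trans_lt hlt
  have h23 : ‖(p - q).2‖ < 1 / 2 := (norm_snd_le (E := ℂ) (F := ℂ × ℂ) (p - q)).trans_lt hlt
  have h2 : ‖p.v - q.v‖ < 1 / 2 := (norm_fst_le (E := ℂ) (F := ℂ) _).trans_lt h23
  have h3 : ‖p.s - q.s‖ < 1 / 2 := (norm_snd_le (E := ℂ) (F := ℂ) _).trans_lt h23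
  have h := hp.add hq.neg
  rw [← sub_eq_add_neg, ← sub_eq_add_neg] at h
  obtain ⟨hu, hv⟩ := h.eq_zero h1 h2
  refine G8.ext (sub_eq_zero.mp hu) (sub_eq_zero.mp hv) (sub_eq_zero.mp ?_)
  rw [hs, hs', sub_eq_add_neg, neg_period, period_add] at h3 ⊢
  exact period_eq_zero h3

theorem exists_gaussianInt_near (z : ℂ) : ∃ a : GaussianInt, ‖z + a‖ ≤ 1 := by
  refine ⟨⟨-round z.re, -round z.im⟩, (Complex.norm_le_abs_re_add_abs_im _).trans ?_⟩
  have h1 := abs_sub_round z.re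
  have h2 := abs_sub_round z.im
  simp only [Complex.add_re, Complex.add_im, ← GaussianInt.intCast_re,
    ← GaussianInt.intCast_im, Int.cast_neg, ← sub_eq_add_neg]
  linarith

/-- The equations `x + y r = u`, `x + y r' = v` in the two roots have `y = (u - v)/√5`. Rounding `x`
and `y` to Gaussian integers costs at most `1 + 1 · 3 = 4`, the roots being at most 3. -/
theorem exists_isLatticePair_near (u v : ℂ) :
    ∃ u' v', IsLatticePair u' v' ∧ ‖u' + u‖ ≤ 4 ∧ ‖v' + v‖ ≤ 4 := by
  have h5 : ((√5 : ℝ) : ℂ) ≠ 0 := mod_cast (two_pos.trans_le two_le_sqrt_five).ne'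
  set y : ℂ := (u - v) / (√5 : ℝ) with hy
  have hy' : y * (√5 : ℝ) = u - v := div_mul_cancel₀ _ h5
  obtain ⟨b, hb⟩ := exists_gaussianInt_near y
  obtain ⟨a, ha⟩ := exists_gaussianInt_near (u - y * unitRoot)
  have key : ∀ r : ℝ, 0 ≤ r → r ≤ 3 →
      ‖(u - y * unitRoot + a) + (y + b) * (r : ℂ)‖ ≤ 4 := by
    intro r h0 h3
    refine (norm_add_le _ _).trans ?_
    rw [norm_mul, Complex.norm_real, Real.norm_of_nonneg h0]
    nlinarith [norm_nonneg (y + b)]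
  refine ⟨_, _, ⟨a, b, rfl, rfl⟩, ?_, ?_⟩
  · convert key unitRoot unitRoot_pos.le unitRoot_le_three using 2
    ring
  · convert key unitRoot' unitRoot'_nonneg
      (by linarith [unitRoot_add, unitRoot_pos]) using 2
    have : (unitRoot : ℂ) - unitRoot' = (√5 : ℝ) := by
      rw [unitRoot, unitRoot']
      push_cast
      ring
    linear_combination hy' + y * this

theorem exists_int_near (x : ℝ) {r : ℝ} (hr : 0 < r) : ∃ m : ℤ, |m * r + x| ≤ r := by
  refine ⟨-round (x / r), ?_⟩
  have h := abs_sub_round (x / r)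
  have h1 : ((-round (x / r) : ℤ) : ℝ) * r + x = (x / r - round (x / r)) * r := by
    push_cast
    field_simp
    ring
  rw [h1, abs_mul, abs_of_pos hr]
  nlinarith

theorem exists_period_near (s : ℂ) : ∃ m n, ‖period m n + s‖ ≤ 10 := by
  obtain ⟨m, hm⟩ := exists_int_near s.re (r := Real.log unitRoot)
    (by linarith [half_le_log_unitRoot])
  obtain ⟨n, hn⟩ := exists_int_near s.im Real.two_pi_pos
  refine ⟨m, n, (Complex.norm_le_abs_re_add_abs_im _).trans ?_⟩
  rw [Complex.add_re, Complex.add_im, period_re, period_im]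
  linarith [log_unitRoot_le, Real.pi_lt_four]

/-- A ball meeting every coset: `s` is reduced by a period, at cost at most `2 + 8`, and afterwards
`u` and `v` by a lattice pair. -/
theorem exists_mem_lattice_norm_mul_le (p : G8) : ∃ γ ∈ lattice, ‖γ * p‖ ≤ 10 := by
  obtain ⟨m, n, hs⟩ := exists_period_near p.s
  obtain ⟨u, v, huv, hu, hv⟩ := exists_isLatticePair_near (Complex.exp (period m n) * p.u)
    (Complex.exp (-period m n) * p.v)
  refine ⟨mk u v (period m n), ⟨huv, m, n, rfl⟩, ?_⟩
  exact norm_prod_le_iff.mpr ⟨hu.trans (by norm_num), norm_prod_le_iff.mpr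
    ⟨hv.trans (by norm_num), hs⟩⟩

theorem isCocompactLattice_lattice : IsCocompactLattice lattice := by
  refine ⟨discreteTopology_lattice, ⟨?_⟩⟩
  have : ProperSpace G8 := FiniteDimensional.proper ℝ G8
  have hc := (isCompact_closedBall (0 : G8) 10).image
    (continuous_quotient_mk' (s := QuotientGroup.rightRel lattice))
  convert hc
  refine (Set.eq_univ_of_forall fun x => ?_).symm
  induction x using Quotient.inductionOn with
  | h p =>
    obtain ⟨γ, hγ, hn⟩ := exists_mem_lattice_norm_mul_le p
    refine ⟨γ * p, mem_closedBall_zero_iff.mpr hn, Quotient.sound ?_⟩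
    refine QuotientGroup.rightRel_apply.mpr ?_
    rw [mul_inv_rev, mul_inv_cancel_left]
    exact inv_mem hγ

end G8

theorem corollary3p2 :
    -- complex structures of Family (Siv3) live on `𝔤₈`, for every value of the parameter
    (∀ A : ℂ, ‖A‖ ≠ 1 → ∃ J : g8 →L[ℝ] g8, FamilySiv3With A J) ∧
    -- each of them has an invariant Chern-flat, hence Chern Kähler-like, Hermitian metric
    (∀ J : g8 →L[ℝ] g8, FamilySiv3 J → ∃ g₀ : g8 →L[ℝ] g8 →L[ℝ] ℝ, ∀ Γ : Subgroup G8,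
      IsHermitianMetric Γ J (fun _ => g₀) ∧ IsChernFlat Γ J (fun _ => g₀) ∧
        IsChernKahlerLike Γ J (fun _ => g₀)) ∧
    -- those with `|A| > 1` degenerate holomorphically to Family (Siv2)
    (∀ (A : ℂ) (J₁ : g8 →L[ℝ] g8), 1 < ‖A‖ → FamilySiv3With A J₁ →
      ∃ J : ℂ → g8 →L[ℝ] g8, IsHolomorphicFamily J ∧
        (∃ a ∈ Metric.ball (0 : ℂ) 1, a ≠ 0 ∧ J a = J₁) ∧
        (∀ a ∈ Metric.ball (0 : ℂ) 1, a ≠ 0 → FamilySiv3 (J a)) ∧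
        FamilySiv2 (J 0)) ∧
    -- the limits have neither balanced nor Chern Kähler-like metrics, invariant or not
    (∀ J : g8 →L[ℝ] g8, FamilySiv2 J → ∀ Γ : Subgroup G8, IsCocompactLattice Γ →
      (¬ ∃ g, IsHermitianMetric Γ J g ∧ IsBalanced J g) ∧
      (¬ ∃ g, IsHermitianMetric Γ J g ∧ IsChernKahlerLike Γ J g)) ∧
    -- the Chern Kähler-like property is not closed under holomorphic deformations
    (∃ Γ : Subgroup G8, IsCocompactLattice Γ ∧ ∃ J : ℂ → g8 →L[ℝ] g8, IsHolomorphicFamily J ∧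
      (∀ a ∈ Metric.ball (0 : ℂ) 1, a ≠ 0 →
        ∃ g, IsHermitianMetric Γ (J a) g ∧ IsChernKahlerLike Γ (J a) g) ∧
      ¬ ∃ g, IsHermitianMetric Γ (J 0) g ∧ IsChernKahlerLike Γ (J 0) g) := by
  refine ⟨exists_familySiv3With, fun J hJ => exists_chernFlat hJ,
    fun A J₁ hA hJ₁ => exists_degeneration hA hJ₁,
    fun J hJ Γ hΓ => ⟨not_exists_balanced hJ hΓ, not_exists_chernKahlerLike hJ hΓ⟩, ?_⟩
  -- Any parameter of modulus greater than 1 would do.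
  have h2 : 1 < ‖(2 : ℂ)‖ := by simp
  obtain ⟨J₁, hJ₁⟩ := exists_familySiv3With 2 h2.ne'
  obtain ⟨J, hJ, -, hJa, hJ0⟩ := exists_degeneration h2 hJ₁
  refine ⟨G8.lattice, G8.isCocompactLattice_lattice, J, hJ, fun a ha ha0 => ?_,
    not_exists_chernKahlerLike hJ0 G8.isCocompactLattice_lattice⟩
  obtain ⟨g₀, hg₀⟩ := exists_chernFlat (hJa a ha ha0)
  exact ⟨_, (hg₀ G8.lattice).1, (hg₀ G8.lattice).2.2⟩
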